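/- Let $\mathbb S^2\subset\mathbb R^3$ be the unit sphere with surface measure $dx$ (total mass $4\pi$), and let $Y_{lm}$ ($-l\le m\le l$) be the complex spherical harmonics, orthonormal with respect to $dx$: in spherical coordinates, for $0\le m\le l$, $$Y_{lm}(\theta,\varphi)=\sqrt{\tfrac{2l+1}{4\pi}\tfrac{(l-m)!}{(l+m)!}}\,P_{lm}(\cos\theta)e^{im\varphi},\qquad P_{lm}(t)=\frac{(-1)^m}{2^l\,l!}(1-t^2)^{m/2}\frac{d^{l+m}}{dt^{l+m}}(t^2-1)^l,$$ and $Y_{l,-m}=(-1)^m\overline{Y_{lm}}$. Let $f_l(x)=\sum_{m=-l}^{l}a_{lm}Y_{lm}(x)$, where $(a_{lm})_{-l\le m\le l}$ are jointly Gaussian complex random variables with $\mathbb E a_{lm}=0$, $\mathbb E a_{lm}\overline{a_{lm'}}=\frac{4\pi}{2l+1}\delta_m^{m'}$ and $a_{l,-m}=(-1)^m\overline{a_{lm}}$ almost surely (so that $f_l$ is almost surely real and $\mathbb E f_l(x)^2=1$). With $\phi$ and $\Phi$ the standard Gaussian density and distribution function and $H_2(u)=u^2-1$, put, for $z\in\mathbb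 R$, $$G_l(z)=\sqrt l\Big[\int_{\mathbb S^2}\mathbb 1(f_l(x)\le z)\,dx-4\pi\Phi(z)\Big],\quad h_{l;2}=\int_{\mathbb S^2}H_2(f_l(x))\,dx,\quad J_2(z)=-z\phi(z),$$ $$S_l(z)=G_l(z)-\frac{J_2(z)}{2}\sqrt l\,h_{l;2}.$$ There is an absolute constant $C>0$ such that the following hold. 1. For every integer $l\ge 2$ and every $0<\varepsilon\le 1$, $$\Pr\Big\{\sup_{z\in\mathbb R}|S_l(z)|>\varepsilon\Big\}\le \frac{C}{l}\,\frac{\log^6 l}{\varepsilon^3}.$$ 2. For every integer $l\ge 1$ and every $\varepsilon\ge 1$, $$\Pr\Big\{\sup_{z\in\mathbb R}|S_l(z)|>\varepsilon\Big\}\le \frac{C}{l}\Big\{\varepsilon^{-4/3}+\frac{\log^6 l}{\varepsilon^{7/3}}\Big\}.$$ -/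

import Mathlib

open MeasureTheory ProbabilityTheory Polynomial
open scoped ComplexConjugate

noncomputable section

namespace SphericalEmpirical

/-- The unit sphere `S²` in `ℝ³`. -/
abbrev S2 : Type := Metric.sphere (0 : EuclideanSpace ℝ (Fin 3)) 1

/-- The surface measure `dx = sin θ dθ dφ` on `S²`, of total mass `4π`. -/
def surf : Measure S2 := (volume : Measure (EuclideanSpace ℝ (Fin 3))).toSphere

/-- `(2^l l!)⁻¹ d^{l+m}/dt^{l+m} (t² - 1)^l`; the associated Legendre function is
`P_{lm}(t) = (-1)^m (1 - t²)^{m/2} * rodrigues l m t` for `0 ≤ m ≤ l`. -/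
def rodrigues (l m : ℕ) (t : ℝ) : ℝ :=
  ((2 : ℝ) ^ l * (l.factorial : ℝ))⁻¹ *
    (derivative^[l + m] (((X : ℝ[X]) ^ 2 - 1) ^ l)).eval t

/-- `Y_{lm}` for `0 ≤ m ≤ l`, that is
`√((2l+1)/(4π) · (l-m)!/(l+m)!) P_{lm}(cos θ) e^{imφ}`, written in Cartesian coordinates by means of
`sin^m θ e^{imφ} = (x₀ + i x₁)^m` and `cos θ = x₂`
(see `sphericalHarmonicNat_spherical_coordinates`). -/
def sphericalHarmonicNat (l m : ℕ) (x : S2) : ℂ :=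
  (Real.sqrt ((2 * (l : ℝ) + 1) / (4 * Real.pi) *
      (((l - m).factorial : ℝ) / ((l + m).factorial : ℝ))) : ℂ) *
    ((-1) ^ m * ((x.1 0 : ℂ) + Complex.I * (x.1 1 : ℂ)) ^ m * (rodrigues l m (x.1 2) : ℂ))

/-- The complex spherical harmonics `Y_{lm}`, `-l ≤ m ≤ l`, with
`Y_{l,-m} = (-1)^m conj Y_{lm}`. -/
def sphericalHarmonic (l : ℕ) (m : ℤ) (x : S2) : ℂ :=
  if 0 ≤ m then sphericalHarmonicNat l m.natAbs x
  else (-1) ^ m.natAbs * conj (sphericalHarmonicNat l m.natAbs x)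

/-- The associated Legendre function `P_{lm}`, `0 ≤ m ≤ l`. -/
def assocLegendre (l m : ℕ) (t : ℝ) : ℝ :=
  (-1) ^ m * Real.sqrt (1 - t ^ 2) ^ m * rodrigues l m t

/-- Agreement with the formula for `Y_{lm}` in spherical coordinates. -/
theorem sphericalHarmonicNat_spherical_coordinates (l m : ℕ) (x : S2) (θ φ : ℝ)
    (hθ : 0 ≤ θ) (hθ' : θ ≤ Real.pi) (h0 : x.1 0 = Real.sin θ * Real.cos φ)
    (h1 : x.1 1 = Real.sin θ * Real.sin φ) (h2 : x.1 2 = Real.cos θ) :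
    sphericalHarmonicNat l m x =
      (Real.sqrt ((2 * (l : ℝ) + 1) / (4 * Real.pi) *
        (((l - m).factorial : ℝ) / ((l + m).factorial : ℝ))) : ℂ) *
      (assocLegendre l m (Real.cos θ) : ℂ) * Complex.exp (Complex.I * m * φ) := by
  have hs : Real.sqrt (1 - Real.cos θ ^ 2) = Real.sin θ := by
    rw [← Real.sin_sq, Real.sqrt_sq (Real.sin_nonneg_of_nonneg_of_le_pi hθ hθ')]
  have he : Complex.exp (Complex.I * m * φ) = Complex.exp (φ * Complex.I) ^ m := by
    rw [← Complex.exp_nat_mul]; congr 1; ring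
  have hc : ((x.1 0 : ℂ) + Complex.I * (x.1 1 : ℂ)) =
      (Real.sin θ : ℂ) * Complex.exp (φ * Complex.I) := by
    rw [h0, h1, Complex.exp_mul_I]; push_cast; ring
  rw [sphericalHarmonicNat, hc, he, h2, assocLegendre, hs]
  push_cast
  ring

/-- The coefficients `(a_{lm})_{-l ≤ m ≤ l}` of the random eigenfunction of degree `l`: jointly
Gaussian complex random variables with mean zero, `E a_{lm} conj a_{lm'} = 4π/(2l+1) δ_m^{m'}` and
`a_{l,-m} = (-1)^m conj a_{lm}` almost surely. -/
structure IsGaussianCoeff {Ω : Type*} [MeasurableSpace Ω] (P : Measure Ω) (l : ℕ)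
    (a : ℤ → Ω → ℂ) : Prop where
  gaussian : HasGaussianLaw (fun ω (m : Finset.Icc (-(l : ℤ)) (l : ℤ)) => a m.1 ω) P
  mean_zero : ∀ m ∈ Finset.Icc (-(l : ℤ)) (l : ℤ), ∫ ω, a m ω ∂P = 0
  covariance : ∀ m ∈ Finset.Icc (-(l : ℤ)) (l : ℤ), ∀ m' ∈ Finset.Icc (-(l : ℤ)) (l : ℤ),
    ∫ ω, a m ω * conj (a m' ω) ∂P =
      if m = m' then ((4 * Real.pi / (2 * (l : ℝ) + 1) : ℝ) : ℂ) else 0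
  symmetric : ∀ m ∈ Finset.Icc (-(l : ℤ)) (l : ℤ),
    ∀ᵐ ω ∂P, a (-m) ω = (-1) ^ m.natAbs * conj (a m ω)

section Random

variable {Ω : Type*} (l : ℕ) (a : ℤ → Ω → ℂ)

/-- The sum `∑_{m=-l}^{l} a_{lm} Y_{lm}(x)`. -/
def harmonicSum (ω : Ω) (x : S2) : ℂ :=
  ∑ m ∈ Finset.Icc (-(l : ℤ)) (l : ℤ), a m ω * sphericalHarmonic l m x

/-- The random eigenfunction `f_l(x) = ∑_{m=-l}^{l} a_{lm} Y_{lm}(x)`. The sum is real when the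
coefficients satisfy `a_{l,-m} = (-1)^m conj a_{lm}`, see `harmonicSum_im`. -/
def field (ω : Ω) (x : S2) : ℝ := (harmonicSum l a ω x).re

/-- `Φ_l(z)`, the area of the set where `f_l ≤ z`. -/
def empiricalMeasure (ω : Ω) (z : ℝ) : ℝ := surf.real {x | field l a ω x ≤ z}

/-- `G_l(z) = √l (Φ_l(z) - 4π Φ(z))`, with `Φ` the standard Gaussian distribution function. -/
def empiricalProcess (ω : Ω) (z : ℝ) : ℝ :=
  Real.sqrt l * (empiricalMeasure l a ω z - 4 * Real.pi * cdf (gaussianReal 0 1) z)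

/-- `h_{l;q} = ∫_{S²} H_q(f_l(x)) dx`, with `H_q` the (probabilists') Hermite polynomial. -/
def hermiteIntegral (q : ℕ) (ω : Ω) : ℝ := ∫ x, aeval (field l a ω x) (hermite q) ∂surf

/-- `J_2(z) = -z φ(z)`, with `φ` the standard Gaussian density. -/
def J2 (z : ℝ) : ℝ := -z * gaussianPDFReal 0 1 z

/-- `S_l(z) = G_l(z) - (J_2(z) / 2!) √l h_{l;2}`: the empirical process minus the second order term
of its Hermite expansion. -/
def remainder (ω : Ω) (z : ℝ) : ℝ :=
  empiricalProcess l a ω z - J2 z / 2 * Real.sqrt l * hermiteIntegral l a 2 ω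

/-- `sup_z |S_l(z)|`, as an element of `[0, ∞]`. -/
def supRemainder (ω : Ω) : ENNReal := ⨆ z : ℝ, ENNReal.ofReal |remainder l a ω z|

end Random

theorem conj_sphericalHarmonic (l : ℕ) (m : ℤ) (x : S2) :
    conj (sphericalHarmonic l m x) = (-1) ^ m.natAbs * sphericalHarmonic l (-m) x := by
  have h1 : ((-1 : ℂ) ^ m.natAbs) * (-1) ^ m.natAbs = 1 := by
    rw [← mul_pow]; simp
  rcases lt_trichotomy m 0 with h | h | h
  · have h' : 0 ≤ -m := by omega
    simp [sphericalHarmonic, not_le.mpr h, h.le]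
  · subst h
    simp [sphericalHarmonic, sphericalHarmonicNat, Complex.conj_ofReal]
  · have h' : ¬ (0 ≤ -m) := by omega
    simp only [sphericalHarmonic, h.le, h', if_true, if_false, Int.natAbs_neg]
    rw [← mul_assoc, h1, one_mul]

theorem harmonicSum_im {Ω : Type*} (l : ℕ) (a : ℤ → Ω → ℂ) (ω : Ω) (x : S2)
    (ha : ∀ m ∈ Finset.Icc (-(l : ℤ)) (l : ℤ), a (-m) ω = (-1) ^ m.natAbs * conj (a m ω)) :
    (harmonicSum l a ω x).im = 0 := by
  rw [← Complex.conj_eq_iff_im, harmonicSum, map_sum]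
  refine Finset.sum_bij' (fun m _ => -m) (fun m _ => -m) ?_ ?_ ?_ ?_ ?_
  · intro m hm; rw [Finset.mem_Icc] at *; omega
  · intro m hm; rw [Finset.mem_Icc] at *; omega
  · intro m _; simp
  · intro m _; simp
  · intro m hm
    rw [map_mul, conj_sphericalHarmonic, ha m hm]
    ring

end SphericalEmpirical

end

noncomputable section

namespace SphericalEmpirical

/-! The covariance of the field is `E f_l(x) f_l(y) = P_l(⟨x, y⟩)`
(`sum_sphericalHarmonic_mul_conj`). For a standard Gaussian pair with correlation `r`, the Hermite
expansion gives `E ψ(X) ψ(Y) = ∑ c_q² r^q / q!`, and the tail from order 4 on is at most `r⁴ ‖ψ‖²`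
(`IsGaussianPair.abs_integral_sub_le`). If the components of orders 0 and 2 vanish, integration over
pairs of points leaves three terms. The first involves `∫ P_l = 0`, the second `∫ P_l³ = O(l⁻²)` and
the last `∫ P_l⁴ = O(l⁻² log l)`. So `∫ ψ(f_l)` has second moment `O(l⁻² log l) ‖ψ‖²`
(`integral_sq_sphere_integral_le`).

The Legendre moments come from `I_k = ∫ P_l² P_k`. These satisfy a two-term recurrence, which gives
a sharp enough bound on each `I_k`; `∫ P_l³` is `I_l`, and `∫ P_l⁴` is a Parseval sum of the `I_k²`.

Extended to Borel sets `B`, the remainder is additive. With `ψ` the indicator of `B` stripped of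
orders 0 and 2, its second moment is `O(l⁻¹ log l) γ(B)`, with `γ` the Gaussian measure
(`integral_sq_setRemainder_le`). A bound linear in `γ(B)` is what a Rademacher-Menshov argument
needs: cutting the line into `2^K` cells of equal Gaussian mass costs a factor `(K + 1)²` for the
maximum over the grid, and monotonicity of the empirical measure controls the interior of a cell.
With `2^K` of order `l²`, Markov's inequality gives `O((1 + log l)³ / (l ε²))` as soon as `ε l^{3/2}
≥ 1` (`measureReal_lt_supRemainder_le_log`). This implies both claims; for smaller `ε` the first
claim is trivial. -/

/-! ### Legendre polynomials -/

/-- The Legendre polynomial `P_n`. -/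
def legendre (n : ℕ) : ℝ[X] :=
  C (((2 : ℝ) ^ n * (n.factorial : ℝ))⁻¹) * derivative^[n] (((X : ℝ[X]) ^ 2 - 1) ^ n)

theorem rodrigues_zero (l : ℕ) (t : ℝ) : rodrigues l 0 t = (legendre l).eval t := by
  simp [rodrigues, legendre]

theorem legendre_zero : legendre 0 = 1 := by simp [legendre]

theorem legendre_one : legendre 1 = X := by
  simp only [legendre, Function.iterate_one, pow_one, Nat.factorial_one]
  have h : derivative ((X : ℝ[X]) ^ 2 - 1) = C 2 * X := by
    rw [derivative_sub, derivative_X_sq, derivative_one, sub_zero]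
  rw [h, ← mul_assoc, ← C_mul]; norm_num

theorem derivative_sq_sub_one_pow_succ (n : ℕ) :
    derivative (((X : ℝ[X]) ^ 2 - 1) ^ (n + 1)) = C (2 * ((n : ℝ) + 1)) * (X * (X ^ 2 - 1) ^ n) := by
  rw [derivative_pow_succ]
  have h : derivative ((X : ℝ[X]) ^ 2 - 1) = C 2 * X := by
    rw [derivative_sub, derivative_X_sq, derivative_one, sub_zero]
  rw [h]
  simp only [C_mul, C_add, map_natCast, C_1]
  ring

theorem legendre_const_succ (n : ℕ) :
    ((2 : ℝ) ^ (n + 1) * ((n + 1).factorial : ℝ))⁻¹ * (2 * ((n : ℝ) + 1)) =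
      ((2 : ℝ) ^ n * (n.factorial : ℝ))⁻¹ := by
  have h1 : ((n : ℝ) + 1) ≠ 0 := by positivity
  have h2 : (n.factorial : ℝ) ≠ 0 := by positivity
  rw [Nat.factorial_succ]; push_cast
  field_simp
  ring

/-- Differentiating `(X² - 1)^(n+1)` once brings out a factor `X`, and Leibniz' rule for `X` times a
polynomial has only two terms. The contiguous relations up to `legendre_recurrence` are combinations
of this identity and `derivative_legendre_add_two`. -/
theorem derivative_legendre_succ (n : ℕ) :
    derivative (legendre (n + 1)) = X * derivative (legendre n) + ((n : ℝ[X]) + 1) * legendre n := by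
  simp only [legendre, derivative_C_mul]
  rw [← Function.iterate_succ_apply' derivative, Function.iterate_succ_apply,
    derivative_sq_sub_one_pow_succ, iterate_derivative_C_mul, ← mul_assoc, ← C_mul,
    legendre_const_succ, mul_comm X, iterate_derivative_mul_X, ← Function.iterate_succ_apply' derivative]
  simp only [Nat.succ_eq_add_one, Nat.add_one_sub_one, nsmul_eq_mul, Nat.cast_add, Nat.cast_one]
  ring

theorem derivative_legendre_add_two (n : ℕ) :
    derivative (legendre (n + 2)) =
      (2 * (n : ℝ[X]) + 3) * legendre (n + 1) + derivative (legendre n) := by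
  have h : derivative (derivative (((X : ℝ[X]) ^ 2 - 1) ^ (n + 2))) =
      C (2 * (((n + 1 : ℕ) : ℝ) + 1)) * ((2 * (n : ℝ[X]) + 3) * (X ^ 2 - 1) ^ (n + 1) +
        C (2 * ((n : ℝ) + 1)) * (X ^ 2 - 1) ^ n) := by
    rw [derivative_sq_sub_one_pow_succ (n + 1), derivative_C_mul, derivative_mul,
      derivative_sq_sub_one_pow_succ n]
    simp only [derivative_X, C_mul, C_add, map_natCast, C_1, C_ofNat]
    push_cast
    ring
  have hn : ((2 * (n : ℝ[X]) + 3)) = C (2 * (n : ℝ) + 3) := by simp [C_ofNat]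
  simp only [legendre, derivative_C_mul]
  rw [← Function.iterate_succ_apply' derivative, Function.iterate_succ_apply,
    Function.iterate_succ_apply, h, iterate_derivative_C_mul, ← mul_assoc, ← C_mul,
    legendre_const_succ (n + 1), ← Function.iterate_succ_apply' derivative,
    iterate_map_add, hn, iterate_derivative_C_mul, iterate_derivative_C_mul,
    ← legendre_const_succ n]
  simp only [C_mul, Nat.succ_eq_add_one]
  ring

theorem X_mul_derivative_legendre_succ (n : ℕ) :
    X * derivative (legendre (n + 1)) =
      ((n : ℝ[X]) + 1) * legendre (n + 1) + derivative (legendre n) := by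
  have h1 := derivative_legendre_succ (n + 1)
  have h2 := derivative_legendre_add_two n
  rw [h2] at h1
  push_cast at h1
  linear_combination -h1

theorem one_sub_sq_mul_derivative_legendre_succ (n : ℕ) :
    (1 - X ^ 2) * derivative (legendre (n + 1)) =
      ((n : ℝ[X]) + 1) * (legendre n - X * legendre (n + 1)) := by
  linear_combination derivative_legendre_succ n - X * X_mul_derivative_legendre_succ n

theorem one_sub_sq_mul_derivative_legendre (n : ℕ) :
    (1 - X ^ 2) * derivative (legendre n) =
      ((n : ℝ[X]) + 1) * (X * legendre n - legendre (n + 1)) := by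
  linear_combination X * derivative_legendre_succ n - X_mul_derivative_legendre_succ n

theorem legendre_recurrence (n : ℕ) :
    (2 * (n : ℝ[X]) + 3) * (X * legendre (n + 1)) =
      ((n : ℝ[X]) + 2) * legendre (n + 2) + ((n : ℝ[X]) + 1) * legendre n := by
  have h1 := one_sub_sq_mul_derivative_legendre_succ n
  have h2 := one_sub_sq_mul_derivative_legendre (n + 1)
  push_cast at h2
  linear_combination h1 - h2

theorem derivative_one_sub_sq_mul_derivative_legendre (n : ℕ) :
    derivative ((1 - X ^ 2) * derivative (legendre n)) =
      -((n : ℝ[X]) * ((n : ℝ[X]) + 1)) * legendre n := by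
  have h : ∀ k : ℕ, (k : ℝ[X]) + 1 = C ((k : ℝ) + 1) := fun k => by simp
  rw [one_sub_sq_mul_derivative_legendre, h, derivative_C_mul, derivative_sub, derivative_mul,
    derivative_X, derivative_legendre_succ n, ← h]
  ring

theorem eval_one_legendre (n : ℕ) : (legendre n).eval 1 = 1 := by
  induction n with
  | zero => simp [legendre_zero]
  | succ n ih =>
    have h := congrArg (eval 1) (one_sub_sq_mul_derivative_legendre n)
    simp [ih] at h
    rcases h with h | h
    · exact absurd h (by positivity)
    · linarith

/-! ### Integration over `[-1, 1]` -/

/-- The integral of a polynomial over `[-1, 1]`. -/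
def intervalInt : ℝ[X] →ₗ[ℝ] ℝ where
  toFun p := ∫ t in (-1 : ℝ)..1, p.eval t
  map_add' p q := by
    simp only [eval_add]
    exact intervalIntegral.integral_add (p.continuous.intervalIntegrable _ _)
      (q.continuous.intervalIntegrable _ _)
  map_smul' c p := by simp

theorem intervalInt_apply (p : ℝ[X]) : intervalInt p = ∫ t in (-1 : ℝ)..1, p.eval t := rfl

theorem intervalInt_derivative (p : ℝ[X]) :
    intervalInt (derivative p) = p.eval 1 - p.eval (-1) := by
  rw [intervalInt_apply]
  exact intervalIntegral.integral_eq_sub_of_hasDerivAt (fun t _ => p.hasDerivAt t)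
    ((derivative p).continuous.intervalIntegrable _ _)

theorem intervalInt_derivative_one_sub_sq_mul (q : ℝ[X]) :
    intervalInt (derivative ((1 - X ^ 2) * q)) = 0 := by
  rw [intervalInt_derivative]; simp

theorem intervalInt_C_mul (c : ℝ) (p : ℝ[X]) : intervalInt (C c * p) = c * intervalInt p := by
  rw [← smul_eq_C_mul, map_smul, smul_eq_mul]

/-- Eigenfunctions of the self-adjoint Legendre operator with distinct eigenvalues: the eigenvalue
difference times the product is the derivative of `1 - X²` times the Wronskian, which vanishes at
both endpoints. -/
theorem intervalInt_legendre_mul_legendre {m n : ℕ} (h : m ≠ n) :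
    intervalInt (legendre m * legendre n) = 0 := by
  have key : C (((m : ℝ) - n) * (m + n + 1)) * (legendre m * legendre n) =
      derivative ((1 - X ^ 2) * (legendre m * derivative (legendre n) -
        derivative (legendre m) * legendre n)) := by
    have hm := derivative_one_sub_sq_mul_derivative_legendre m
    have hn := derivative_one_sub_sq_mul_derivative_legendre n
    simp only [derivative_mul, derivative_sub, derivative_X_sq, derivative_one, C_ofNat] at hm hn ⊢
    simp only [map_mul, map_add, map_sub, map_natCast, map_one]
    linear_combination legendre n * hm - legendre m * hn
  have h2 := congrArg intervalInt key
  rw [intervalInt_derivative_one_sub_sq_mul, intervalInt_C_mul] at h2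
  rcases mul_eq_zero.mp h2 with h3 | h3
  · exfalso
    rcases mul_eq_zero.mp h3 with h4 | h4
    · exact h (by exact_mod_cast sub_eq_zero.mp h4)
    · have : (0 : ℝ) < m + n + 1 := by positivity
      linarith
  · exact h3

theorem intervalInt_legendre_sq (n : ℕ) :
    intervalInt (legendre n * legendre n) = 2 / (2 * n + 1) := by
  induction n with
  | zero => simp [legendre_zero, intervalInt_apply]; norm_num
  | succ n ih =>
    have h1 : ((n : ℝ) + 2) * intervalInt (legendre (n + 2) * legendre n) +
        ((n : ℝ) + 1) * intervalInt (legendre n * legendre n) =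
        (2 * n + 3) * intervalInt (X * legendre (n + 1) * legendre n) := by
      rw [← intervalInt_C_mul, ← intervalInt_C_mul, ← intervalInt_C_mul, ← map_add]
      congr 1
      simp only [map_mul, map_add, map_natCast, map_one, C_ofNat]
      linear_combination -(legendre n) * legendre_recurrence n
    rw [intervalInt_legendre_mul_legendre (by omega), ih] at h1
    -- The same mixed integral, now evaluated by the recurrence one index lower and tested against
    -- the higher polynomial.
    have h2 : (2 * (n : ℝ) + 1) * intervalInt (X * legendre (n + 1) * legendre n) =
        ((n : ℝ) + 1) * intervalInt (legendre (n + 1) * legendre (n + 1)) := by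
      rcases n with _ | n
      · simp [legendre_zero, legendre_one]
      · have h3 : ((n : ℝ) + 2) * intervalInt (legendre (n + 2) * legendre (n + 2)) +
          ((n : ℝ) + 1) * intervalInt (legendre n * legendre (n + 2)) =
          (2 * n + 3) * intervalInt (X * legendre (n + 2) * legendre (n + 1)) := by
          rw [← intervalInt_C_mul, ← intervalInt_C_mul, ← intervalInt_C_mul, ← map_add]
          congr 1
          simp only [map_mul, map_add, map_natCast, map_one, C_ofNat]
          linear_combination -(legendre (n + 2)) * legendre_recurrence n
        rw [intervalInt_legendre_mul_legendre (m := n) (by omega)] at h3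
        push_cast
        linarith
    have hp : (0 : ℝ) < n + 1 := by positivity
    have hq : (0 : ℝ) < 2 * n + 1 := by positivity
    have hr : (0 : ℝ) < 2 * n + 3 := by positivity
    push_cast
    have h5 : intervalInt (X * legendre (n + 1) * legendre n) =
      (n + 1) * intervalInt (legendre (n + 1) * legendre (n + 1)) / (2 * n + 1) := by
      rw [← h2]; field_simp
    rw [h5] at h1
    have h6 : (2 * ((n : ℝ) + 1) + 1) = 2 * n + 3 := by ring
    rw [h6, eq_div_iff hr.ne']
    field_simp at h1
    have h7 : ((n : ℝ) + 1) * (intervalInt (legendre (n + 1) * legendre (n + 1)) * (2 * n + 3)) =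
        (n + 1) * 2 := by linear_combination -h1
    exact mul_left_cancel₀ hp.ne' h7

/-- Recurrence for the integrals `∫ P_l² P_k`. -/
theorem intervalInt_legendre_sq_mul_recurrence (l k : ℕ) :
    ((k : ℝ) + 2) ^ 2 * ((2 * l + 1) ^ 2 - (k + 2) ^ 2) *
        intervalInt (legendre l ^ 2 * legendre (k + 2)) =
      ((k : ℝ) + 1) ^ 2 * ((2 * l + 1) ^ 2 - (k + 1) ^ 2) *
        intervalInt (legendre l ^ 2 * legendre k) := by
  -- Since `P_l` solves a second-order equation, `u = P_l²` solves a third-order one. Pairing it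
  -- with `φ = P_{k+1}` and integrating by parts gives one linear relation between `∫ u p φ'` and `∫
  -- u X φ`. Both `p φ'` and `X φ` are combinations of `P_k` and `P_{k+2}`.
  rw [← intervalInt_C_mul, ← intervalInt_C_mul, ← sub_eq_zero, ← map_sub]
  set P := legendre l with hP
  set φ := legendre (k + 1) with hφ
  set p : ℝ[X] := 1 - X ^ 2 with hp
  have hp' : derivative p = -2 * X := by
    rw [hp, derivative_sub, derivative_X_sq, derivative_one, C_ofNat]; ring
  set u := P ^ 2
  set dP := derivative P with hdP
  have hu : derivative u = 2 * P * dP := by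
    rw [derivative_sq, C_ofNat]
  have hODE : p * derivative dP = 2 * X * dP - (l : ℝ[X]) * ((l : ℝ[X]) + 1) * P := by
    have := derivative_one_sub_sq_mul_derivative_legendre l
    rw [derivative_mul, ← hp, hp'] at this
    linear_combination this
  have hODEφ : p * derivative (derivative φ) = 2 * X * derivative φ -
      ((k : ℝ[X]) + 1) * ((k : ℝ[X]) + 2) * φ := by
    have := derivative_one_sub_sq_mul_derivative_legendre (k + 1)
    rw [derivative_mul, ← hp, hp'] at this
    push_cast at this
    linear_combination this
  have h1 := one_sub_sq_mul_derivative_legendre_succ k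
  have h2 := legendre_recurrence k
  rw [← hp, ← hφ] at h1
  rw [← hφ] at h2
  set lam : ℝ[X] := (l : ℝ[X]) * ((l : ℝ[X]) + 1) with hlam
  set mu : ℝ[X] := ((k : ℝ[X]) + 1) * ((k : ℝ[X]) + 2) with hmu
  have hdlam : derivative lam = 0 := by simp [hlam]
  have hdmu : derivative mu = 0 := by simp [hmu]
  -- `(p u')' = 2 p P'² - 2 λ P²`
  have hstuff : intervalInt (u * ((mu - 4 * lam) * (p * derivative φ - 2 * X * φ) -
      4 * lam * X * φ)) = 0 := by
    have : u * ((mu - 4 * lam) * (p * derivative φ - 2 * X * φ) - 4 * lam * X * φ) =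
        -derivative (p * ((2 * p * dP ^ 2 - 2 * lam * u) * φ - 2 * P * dP * p * derivative φ
          - mu * u * φ + 4 * lam * u * φ)) := by
      simp only [derivative_mul, derivative_sub, derivative_add, hp', hu, derivative_sq, hdlam,
        hdmu, ← hdP]
      simp only [derivative_ofNat, C_ofNat]
      linear_combination (4 * p * dP * φ - 2 * P * p * derivative φ) * hODE -
        (2 * P * dP * p) * hODEφ
    rw [this, map_neg, intervalInt_derivative_one_sub_sq_mul, neg_zero]
  -- The factor `2k + 3` clears the denominator in the expansion of `X P_{k+1}`.
  have hfin : C (2 * (k : ℝ) + 3) * (u * ((mu - 4 * lam) * (p * derivative φ - 2 * X * φ) -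
      4 * lam * X * φ)) = C (((k : ℝ) + 2) ^ 2 * ((2 * l + 1) ^ 2 - (k + 2) ^ 2)) *
      (u * legendre (k + 2)) - C (((k : ℝ) + 1) ^ 2 * ((2 * l + 1) ^ 2 - (k + 1) ^ 2)) *
      (u * legendre k) := by
    simp only [map_mul, map_add, map_sub, map_pow, map_natCast, map_one, C_ofNat]
    rw [h1, hmu, hlam]
    generalize (k : ℝ[X]) = K at *
    generalize (l : ℝ[X]) = M at *
    linear_combination (-u * ((K + 3) * ((K + 1) * (K + 2) - 4 * (M * (M + 1))) +
      4 * (M * (M + 1)))) * h2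
  rw [← hfin, intervalInt_C_mul, hstuff, mul_zero]

/-! ### Moments of Legendre polynomials -/

/-- The recurrence links `k` to `k + 2`, so the odd indices need their own starting value. By the
Legendre equation the integrand is a multiple of an exact derivative. -/
theorem intervalInt_legendre_sq_mul_legendre_one {l : ℕ} (hl : 1 ≤ l) :
    intervalInt (legendre l ^ 2 * legendre 1) = 0 := by
  have key : C (4 * ((l : ℝ) * (l + 1))) * (legendre l ^ 2 * X) =
      -derivative ((1 - X ^ 2) * ((2 * (1 - X ^ 2) * derivative (legendre l) ^ 2 +
        2 * C ((l : ℝ) * (l + 1)) * legendre l ^ 2))) := by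
    have h := derivative_one_sub_sq_mul_derivative_legendre l
    simp only [derivative_mul, derivative_sub, derivative_add, derivative_X, derivative_one,
      derivative_sq, C_ofNat, derivative_ofNat, derivative_C] at h ⊢
    simp only [map_mul, map_add, map_natCast, map_one, C_ofNat] at h ⊢
    linear_combination (4 * (1 - X ^ 2) * derivative (legendre l)) * h
  have h2 := congrArg intervalInt key
  rw [map_neg, intervalInt_derivative_one_sub_sq_mul, intervalInt_C_mul, neg_zero] at h2
  rw [legendre_one]
  refine (mul_eq_zero.mp h2).resolve_left ?_
  have : (0 : ℝ) < l := by exact_mod_cast hl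
  positivity

/-- With `g(m) = m² ((2l+1)² - m²)` the recurrence reads `g(k+2) I_{k+2} = g(k+1) I_k`. As `g(m-1)
g(m+1) ≤ g(m)²`, the quantity `I_k² g(k+1)` does not increase along `k ↦ k + 2`, and it starts below
4. -/
theorem sq_intervalInt_legendre_sq_mul_le {l : ℕ} (hl : 1 ≤ l) (k : ℕ) (hk : k < 2 * l) :
    intervalInt (legendre l ^ 2 * legendre k) ^ 2 *
      (((k : ℝ) + 1) ^ 2 * ((2 * l + 1) ^ 2 - (k + 1) ^ 2)) ≤ 4 := by
  induction k using Nat.twoStepInduction with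
  | zero =>
    rw [legendre_zero, mul_one, pow_two (legendre l), intervalInt_legendre_sq]
    have : (0 : ℝ) < 2 * l + 1 := by positivity
    rw [div_pow, div_mul_eq_mul_div, div_le_iff₀ (by positivity)]
    push_cast
    nlinarith
  | one => rw [intervalInt_legendre_sq_mul_legendre_one hl]; norm_num
  | more k ih _ =>
    have ih := ih (by omega)
    have hr := intervalInt_legendre_sq_mul_recurrence l k
    set I := intervalInt (legendre l ^ 2 * legendre k)
    set J := intervalInt (legendre l ^ 2 * legendre (k + 2))
    have hN : (k : ℝ) + 3 ≤ 2 * l := by exact_mod_cast hk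
    push_cast
    set N : ℝ := 2 * l + 1 with hNdef
    set m : ℝ := (k : ℝ) + 2 with hm
    have hm2 : 2 ≤ m := by rw [hm]; linarith [Nat.cast_nonneg (α := ℝ) k]
    have e1 : (k : ℝ) + 1 = m - 1 := by rw [hm]; ring
    have e3 : (m + 1) ≤ N - 1 := by rw [hm, hNdef]; linarith
    rw [e1] at ih hr
    have hA : 0 < N ^ 2 - m ^ 2 := by nlinarith
    have hB : 0 ≤ N ^ 2 - (m + 1) ^ 2 := by nlinarith
    have hB' : 0 ≤ N ^ 2 - (m - 1) ^ 2 := by nlinarith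
    have hg : 0 < m ^ 2 * (N ^ 2 - m ^ 2) := by positivity
    have hconc : ((m - 1) ^ 2 * (N ^ 2 - (m - 1) ^ 2)) * ((m + 1) ^ 2 * (N ^ 2 - (m + 1) ^ 2)) ≤
        (m ^ 2 * (N ^ 2 - m ^ 2)) ^ 2 := by
      have h1 : ((m - 1) * (m + 1)) ^ 2 ≤ (m ^ 2) ^ 2 := by
        apply pow_le_pow_left₀ <;> nlinarith
      have h2 : (N ^ 2 - (m - 1) ^ 2) * (N ^ 2 - (m + 1) ^ 2) ≤ (N ^ 2 - m ^ 2) ^ 2 := by nlinarith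
      calc _ = ((m - 1) * (m + 1)) ^ 2 * ((N ^ 2 - (m - 1) ^ 2) * (N ^ 2 - (m + 1) ^ 2)) := by ring
        _ ≤ (m ^ 2) ^ 2 * (N ^ 2 - m ^ 2) ^ 2 := mul_le_mul h1 h2 (by positivity) (by positivity)
        _ = _ := by ring
    refine le_of_mul_le_mul_right ?_ (pow_pos hg 2)
    calc J ^ 2 * ((m + 1) ^ 2 * (N ^ 2 - (m + 1) ^ 2)) * (m ^ 2 * (N ^ 2 - m ^ 2)) ^ 2
        = (m ^ 2 * (N ^ 2 - m ^ 2) * J) ^ 2 * ((m + 1) ^ 2 * (N ^ 2 - (m + 1) ^ 2)) := by ring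
      _ = (I ^ 2 * ((m - 1) ^ 2 * (N ^ 2 - (m - 1) ^ 2))) *
          (((m - 1) ^ 2 * (N ^ 2 - (m - 1) ^ 2)) * ((m + 1) ^ 2 * (N ^ 2 - (m + 1) ^ 2))) := by
          rw [hr]; ring
      _ ≤ 4 * (m ^ 2 * (N ^ 2 - m ^ 2)) ^ 2 :=
          mul_le_mul ih hconc (by positivity) (by norm_num)

/-- The case `k = l` of the preceding bound, where the weight is at least `l⁴`. -/
theorem abs_intervalInt_legendre_cube_le {l : ℕ} (hl : 1 ≤ l) :
    |intervalInt (legendre l ^ 3)| ≤ 2 / (l : ℝ) ^ 2 := by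
  have h := sq_intervalInt_legendre_sq_mul_le hl l (by omega)
  have e : legendre l ^ 2 * legendre l = legendre l ^ 3 := by ring
  rw [e] at h
  have hl' : (1 : ℝ) ≤ l := by exact_mod_cast hl
  apply abs_le_of_sq_le_sq _ (by positivity)
  rw [div_pow, le_div_iff₀ (by positivity)]
  refine le_trans (mul_le_mul_of_nonneg_left ?_ (sq_nonneg _)) (h.trans (by norm_num))
  have : ((l : ℝ) + 1) ^ 2 * ((2 * l + 1) ^ 2 - (l + 1) ^ 2) - (l ^ 2) ^ 2 =
    2 * (l : ℝ) ^ 4 + 8 * l ^ 3 + 7 * l ^ 2 + 2 * l := by ring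
  have : (0 : ℝ) ≤ 2 * (l : ℝ) ^ 4 + 8 * l ^ 3 + 7 * l ^ 2 + 2 * l := by positivity
  linarith

theorem X_mul_mem_span_legendre {n : ℕ} {q : ℝ[X]}
    (hq : q ∈ Submodule.span ℝ (legendre '' Set.Iic n)) :
    X * q ∈ Submodule.span ℝ (legendre '' Set.Iic (n + 1)) := by
  induction hq using Submodule.span_induction with
  | mem q hq =>
    obtain ⟨k, hk, rfl⟩ := hq
    rw [Set.mem_Iic] at hk
    rcases k with _ | k
    · rw [legendre_zero, mul_one, ← legendre_one]
      exact Submodule.subset_span ⟨1, by simp, rfl⟩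
    · have h : X * legendre (k + 1) = (((k : ℝ) + 2) / (2 * k + 3)) • legendre (k + 2) +
          (((k : ℝ) + 1) / (2 * k + 3)) • legendre k := by
        have h0 : (2 * (k : ℝ) + 3) ≠ 0 := by positivity
        have h1 : (C (2 * (k : ℝ) + 3)) ≠ 0 := C_ne_zero.mpr h0
        apply mul_left_cancel₀ h1
        rw [mul_add, smul_eq_C_mul, smul_eq_C_mul, ← mul_assoc, ← mul_assoc, ← mul_assoc,
          ← C_mul, ← C_mul, mul_div_cancel₀ _ h0, mul_div_cancel₀ _ h0]
        have := legendre_recurrence k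
        simp only [map_mul, map_add, map_natCast, map_one, C_ofNat]
        linear_combination this
      rw [h]
      refine Submodule.add_mem _ (Submodule.smul_mem _ _ ?_) (Submodule.smul_mem _ _ ?_)
      · exact Submodule.subset_span ⟨k + 2, by simp; omega, rfl⟩
      · exact Submodule.subset_span ⟨k, by simp; omega, rfl⟩
  | zero => simp
  | add p q _ _ hp hq => rw [mul_add]; exact Submodule.add_mem _ hp hq
  | smul c p _ hp => rw [mul_smul_comm]; exact Submodule.smul_mem _ _ hp

theorem mem_span_legendre {n : ℕ} {q : ℝ[X]} (hq : q.natDegree ≤ n) :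
    q ∈ Submodule.span ℝ (legendre '' Set.Iic n) := by
  have hX : ∀ k, (X : ℝ[X]) ^ k ∈ Submodule.span ℝ (legendre '' Set.Iic k) := by
    intro k
    induction k with
    | zero => exact Submodule.subset_span ⟨0, by simp, by simp [legendre_zero]⟩
    | succ k ih => rw [pow_succ']; exact X_mul_mem_span_legendre ih
  rw [q.as_sum_range_C_mul_X_pow]
  refine Submodule.sum_mem _ fun k hk => ?_
  rw [← smul_eq_C_mul]
  refine Submodule.smul_mem _ _ (Submodule.span_mono (Set.image_mono ?_) (hX k))
  rw [Finset.mem_range] at hk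
  exact Set.Iic_subset_Iic.mpr (by omega)

/-- Parseval's identity in the Legendre basis; the sum is finite because one factor is a polynomial
of degree at most `n`. -/
theorem intervalInt_mul_eq_sum {n : ℕ} {q : ℝ[X]} (hq : q.natDegree ≤ n) (r : ℝ[X]) :
    intervalInt (q * r) = ∑ k ∈ Finset.range (n + 1), (2 * (k : ℝ) + 1) / 2 *
      (intervalInt (q * legendre k) * intervalInt (r * legendre k)) := by
  replace hq := mem_span_legendre hq
  induction hq using Submodule.span_induction with
  | mem q hq =>
    obtain ⟨j, hj, rfl⟩ := hq
    rw [Set.mem_Iic] at hj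
    rw [Finset.sum_eq_single_of_mem j (by rw [Finset.mem_range]; omega), intervalInt_legendre_sq,
      mul_comm r]
    · have : (2 * (j : ℝ) + 1) ≠ 0 := by positivity
      field_simp
    · intro k _ hk
      rw [intervalInt_legendre_mul_legendre hk.symm]; ring
  | zero => simp
  | add p q _ _ hp hq =>
    rw [add_mul, map_add, hp, hq, ← Finset.sum_add_distrib]
    refine Finset.sum_congr rfl fun k _ => ?_
    rw [add_mul, map_add]; ring
  | smul c p _ hp =>
    rw [smul_mul_assoc, map_smul, hp, Finset.smul_sum]
    refine Finset.sum_congr rfl fun k _ => ?_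
    rw [smul_mul_assoc, map_smul, smul_eq_mul, smul_eq_mul]; ring

theorem natDegree_legendre_le (n : ℕ) : (legendre n).natDegree ≤ n := by
  refine (natDegree_C_mul_le _ _).trans ((natDegree_iterate_derivative _ _).trans ?_)
  have h1 : ((X : ℝ[X]) ^ 2 - 1).natDegree ≤ 2 :=
    (natDegree_sub_le _ _).trans (by simp)
  have h2 := natDegree_pow_le_of_le n h1
  omega

/-- Parseval for `P_l²`, whose coefficients are the `I_k` with `k ≤ 2l`. The bounds on `I_k²` sum
like a harmonic series, which is the source of the logarithm. -/
theorem intervalInt_legendre_four_le {l : ℕ} (hl : 1 ≤ l) :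
    intervalInt (legendre l ^ 4) ≤ 6 * (1 + Real.log l) / (l : ℝ) ^ 2 := by
  have hl' : (1 : ℝ) ≤ l := by exact_mod_cast hl
  have hlog : 0 ≤ Real.log l := Real.log_nonneg hl'
  have hd : (legendre l ^ 2).natDegree ≤ 2 * l :=
    natDegree_pow_le_of_le 2 (natDegree_legendre_le l)
  have e : legendre l ^ 4 = legendre l ^ 2 * legendre l ^ 2 := by ring
  rw [e, intervalInt_mul_eq_sum hd, Finset.sum_range_succ]
  -- At `k = 2l` the weight in `sq_intervalInt_legendre_sq_mul_le` vanishes, so the last coefficient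
  -- is obtained from `I_{2l-2}` by one step of the recurrence.
  have hlast : (2 * ((2 * l : ℕ) : ℝ) + 1) / 2 * (intervalInt (legendre l ^ 2 * legendre (2 * l)) *
      intervalInt (legendre l ^ 2 * legendre (2 * l))) ≤ 5 / 4 / (l : ℝ) ^ 2 := by
    obtain ⟨m, rfl⟩ : ∃ m, l = m + 1 := ⟨l - 1, by omega⟩
    have h1 := intervalInt_legendre_sq_mul_recurrence (m + 1) (2 * m)
    have h2 := sq_intervalInt_legendre_sq_mul_le hl (2 * m) (by omega)
    have e2 : 2 * (m + 1) = 2 * m + 2 := by ring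
    rw [e2]
    set I := intervalInt (legendre (m + 1) ^ 2 * legendre (2 * m))
    set J := intervalInt (legendre (m + 1) ^ 2 * legendre (2 * m + 2))
    push_cast at h1 h2 ⊢
    set x : ℝ := (m : ℝ) + 1 with hx
    have hm : (m : ℝ) = x - 1 := by rw [hx]; ring
    have hx1 : 1 ≤ x := by rw [hx]; linarith [Nat.cast_nonneg (α := ℝ) m]
    rw [hm] at h1 h2 ⊢
    have h3 : J * (4 * x ^ 2 * (4 * x + 1)) = I * ((2 * x - 1) ^ 2 * (8 * x)) := by
      linear_combination h1
    have h4 : I ^ 2 * ((2 * x - 1) ^ 2 * (8 * x)) ≤ 4 := by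
      refine le_trans (le_of_eq ?_) h2; ring
    have h5 : J ^ 2 * (4 * x ^ 2 * (4 * x + 1)) ^ 2 ≤ 4 * (32 * x ^ 3) := by
      calc _ = (J * (4 * x ^ 2 * (4 * x + 1))) ^ 2 := by ring
        _ = (I ^ 2 * ((2 * x - 1) ^ 2 * (8 * x))) * ((2 * x - 1) ^ 2 * (8 * x)) := by rw [h3]; ring
        _ ≤ 4 * (32 * x ^ 3) := by
          apply mul_le_mul h4 _ (by positivity) (by norm_num)
          nlinarith
    have h6 : J ^ 2 * (256 * x ^ 6) ≤ J ^ 2 * (4 * x ^ 2 * (4 * x + 1)) ^ 2 := by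
      apply mul_le_mul_of_nonneg_left _ (sq_nonneg _)
      have h : (4 * x ^ 2 * (4 * x + 1)) ^ 2 - 256 * x ^ 6 = 128 * x ^ 5 + 16 * x ^ 4 := by ring
      have : 0 ≤ 128 * x ^ 5 + 16 * x ^ 4 := by positivity
      linarith
    have h7 : J ^ 2 * (2 * x ^ 3) ≤ 1 := by
      have h8 : J ^ 2 * (2 * x ^ 3) * (128 * x ^ 3) ≤ 1 * (128 * x ^ 3) := by linarith
      exact le_of_mul_le_mul_right h8 (by positivity)
    rw [le_div_iff₀ (by positivity)]
    nlinarith [mul_nonneg (sq_nonneg J) (pow_nonneg (zero_le_one.trans hx1) 2)]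
  -- The weight contains `(2l+1)² - (k+1)² = (2l-k)(2l+k+2)`. Partial fractions split the resulting
  -- bound into two harmonic terms, exchanged by the reflection `k ↦ 2l - 1 - k`.
  have hmain : ∀ k ∈ Finset.range (2 * l), (2 * (k : ℝ) + 1) / 2 *
      (intervalInt (legendre l ^ 2 * legendre k) * intervalInt (legendre l ^ 2 * legendre k)) ≤
      4 / (2 * l + 1) ^ 2 * (1 / ((k : ℝ) + 1) + 1 / (((2 * l - 1 - k : ℕ) : ℝ) + 1)) := by
    intro k hk
    rw [Finset.mem_range] at hk
    have h2 := sq_intervalInt_legendre_sq_mul_le hl k hk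
    have e3 : (((2 * l - 1 - k : ℕ) : ℝ) + 1) = 2 * l - k := by
      have : 2 * l - 1 - k + 1 + k = 2 * l := by omega
      have := congrArg (Nat.cast (R := ℝ)) this
      push_cast at this; linarith
    rw [e3]
    have hk' : (k : ℝ) + 1 ≤ 2 * l := by exact_mod_cast hk
    have hk0 : (0 : ℝ) ≤ k := Nat.cast_nonneg k
    set I := intervalInt (legendre l ^ 2 * legendre k)
    set y : ℝ := 2 * l - k with hy
    have hy1 : 1 ≤ y := by rw [hy]; linarith
    have hyk : (2 * (l : ℝ) + 1) = y + (k + 1) := by rw [hy]; ring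
    rw [hyk] at h2 ⊢
    have h3 : I ^ 2 ≤ 4 / (((k : ℝ) + 1) ^ 2 * (y * (y + (k + 1)))) := by
      rw [le_div_iff₀ (by positivity)]
      refine le_trans (mul_le_mul_of_nonneg_left ?_ (sq_nonneg _)) h2
      apply mul_le_mul_of_nonneg_left _ (sq_nonneg _)
      nlinarith
    calc (2 * (k : ℝ) + 1) / 2 * (I * I) = (2 * (k : ℝ) + 1) / 2 * I ^ 2 := by ring
      _ ≤ ((k : ℝ) + 1) * (4 / (((k : ℝ) + 1) ^ 2 * (y * (y + (k + 1))))) :=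
          mul_le_mul (by linarith) h3 (sq_nonneg _) (by positivity)
      _ = _ := by field_simp
  have hsum := Finset.sum_le_sum hmain
  rw [← Finset.mul_sum, Finset.sum_add_distrib,
    Finset.sum_range_reflect (fun j => 1 / ((j : ℝ) + 1)) (2 * l)] at hsum
  have hH : ∑ k ∈ Finset.range (2 * l), 1 / ((k : ℝ) + 1) ≤ 1 + Real.log ((2 * l : ℕ) : ℝ) := by
    have := harmonic_le_one_add_log (2 * l)
    refine le_trans (le_of_eq ?_) this
    simp [harmonic]
  have hlog2 : Real.log ((2 * l : ℕ) : ℝ) ≤ 1 + Real.log l := by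
    push_cast
    rw [Real.log_mul (by norm_num) (by positivity)]
    linarith [Real.log_two_lt_d9]
  have hb : 4 / (2 * (l : ℝ) + 1) ^ 2 ≤ 1 / (l : ℝ) ^ 2 := by
    rw [div_le_div_iff₀ (by positivity) (by positivity)]
    nlinarith
  have hS0 : 0 ≤ ∑ k ∈ Finset.range (2 * l), 1 / ((k : ℝ) + 1) :=
    Finset.sum_nonneg fun k _ => by positivity
  calc _ ≤ 1 / (l : ℝ) ^ 2 * (2 * (2 + Real.log l)) + 5 / 4 / (l : ℝ) ^ 2 := by
        refine add_le_add (hsum.trans ?_) hlast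
        apply mul_le_mul hb (by linarith) (by linarith) (by positivity)
    _ ≤ _ := by
        rw [div_mul_eq_mul_div, ← add_div]
        apply div_le_div_of_nonneg_right _ (by positivity)
        linarith

/-! ### Zonal integrals over the sphere -/

theorem integral_pow_mul_exp_neg_sq_Ioi_even (k : ℕ) :
    ∫ u in Set.Ioi (0 : ℝ), u ^ (2 * k) * Real.exp (-u ^ 2) = 1 / 2 * Real.Gamma (k + 1 / 2) := by
  have h := integral_rpow_mul_exp_neg_rpow (p := 2) (q := ((2 * k : ℕ) : ℝ)) (by norm_num)
    (by have : (0 : ℝ) ≤ ((2 * k : ℕ) : ℝ) := Nat.cast_nonneg _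
        linarith)
  simp only [Real.rpow_natCast, Real.rpow_two] at h
  rw [h]; congr 2; push_cast; ring

theorem integral_even_pow_mul_exp_neg_sq (k : ℕ) :
    ∫ u : ℝ, u ^ (2 * k) * Real.exp (-u ^ 2) = Real.Gamma (k + 1 / 2) := by
  have h := integral_comp_abs (f := fun u : ℝ => u ^ (2 * k) * Real.exp (-u ^ 2))
  rw [integral_pow_mul_exp_neg_sq_Ioi_even] at h
  simp only [sq_abs, pow_mul] at h ⊢
  rw [h]; ring

theorem integral_odd_pow_mul_exp_neg_sq (k : ℕ) :
    ∫ u : ℝ, u ^ (2 * k + 1) * Real.exp (-u ^ 2) = 0 := by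
  have h := integral_neg_eq_self (fun u : ℝ => u ^ (2 * k + 1) * Real.exp (-u ^ 2)) volume
  have e : ∀ u : ℝ, (-u) ^ (2 * k + 1) * Real.exp (-(-u) ^ 2) =
    -(u ^ (2 * k + 1) * Real.exp (-u ^ 2)) := by intro u; rw [Odd.neg_pow ⟨k, rfl⟩, neg_sq]; ring
  simp only [e, integral_neg] at h
  linarith

/-- A Gaussian integral over `ℝ³` computed in two ways, in polar coordinates here and as a product
next, determines the moments of `⟨x, y⟩` on the sphere. -/
theorem integral_inner_pow_mul_exp_neg_norm_sq_polar (y : EuclideanSpace ℝ (Fin 3)) (n : ℕ) :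
    ∫ v : EuclideanSpace ℝ (Fin 3), inner ℝ v y ^ n * Real.exp (-‖v‖ ^ 2) =
      (∫ x : S2, inner ℝ x.1 y ^ n ∂surf) *
        ∫ r in Set.Ioi (0 : ℝ), r ^ (n + 2) * Real.exp (-r ^ 2) := by
  have hdim : Module.finrank ℝ (EuclideanSpace ℝ (Fin 3)) - 1 = 2 := by simp
  calc ∫ v : EuclideanSpace ℝ (Fin 3), inner ℝ v y ^ n * Real.exp (-‖v‖ ^ 2)
      = ∫ v : ({(0)}ᶜ : Set (EuclideanSpace ℝ (Fin 3))), inner ℝ v.1 y ^ n * Real.exp (-‖v.1‖ ^ 2)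
          ∂((volume : Measure (EuclideanSpace ℝ (Fin 3))).comap (↑)) := by
        rw [integral_subtype_comap (measurableSet_singleton _).compl
          fun v : EuclideanSpace ℝ (Fin 3) => inner ℝ v y ^ n * Real.exp (-‖v‖ ^ 2), restrict_compl_singleton]
    _ = ∫ p : S2 × Set.Ioi (0 : ℝ), inner ℝ p.1.1 y ^ n * (p.2.1 ^ n * Real.exp (-p.2.1 ^ 2))
          ∂((volume : Measure (EuclideanSpace ℝ (Fin 3))).toSphere.prod (.volumeIoiPow (Module.finrank ℝ (EuclideanSpace ℝ (Fin 3)) - 1))) := by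
        rw [← (volume : Measure (EuclideanSpace ℝ (Fin 3))).measurePreserving_homeomorphUnitSphereProd.integral_comp
          (Homeomorph.measurableEmbedding _)]
        refine integral_congr_ae (Filter.Eventually.of_forall fun v => ?_)
        have hv : ‖v.1‖ ≠ 0 := norm_ne_zero_iff.mpr v.2
        simp only [homeomorphUnitSphereProd_apply_fst_coe, homeomorphUnitSphereProd_apply_snd_coe,
          inner_smul_left]
        rw [← mul_assoc, ← mul_pow]
        congr 2
        simp only [map_inv₀, conj_trivial]
        field_simp
    _ = (∫ x : S2, inner ℝ x.1 y ^ n ∂surf) *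
          ∫ r : Set.Ioi (0 : ℝ), r.1 ^ n * Real.exp (-r.1 ^ 2) ∂(.volumeIoiPow 2) := by
        rw [integral_prod_mul (fun x : S2 => inner ℝ x.1 y ^ n)
          (fun r : Set.Ioi (0 : ℝ) => r.1 ^ n * Real.exp (-r.1 ^ 2)), hdim]
        rfl
    _ = _ := by
        congr 1
        simp only [Measure.volumeIoiPow, ENNReal.ofReal]
        rw [integral_withDensity_eq_integral_smul
            ((measurable_subtype_coe.pow_const _).real_toNNReal),
          integral_subtype_comap measurableSet_Ioi
            fun a => Real.toNNReal (a ^ 2) • (a ^ n * Real.exp (-a ^ 2)),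
          setIntegral_congr_fun measurableSet_Ioi fun x hx => ?_]
        rw [NNReal.smul_def, Real.coe_toNNReal _ (pow_nonneg (le_of_lt hx) _), smul_eq_mul]
        ring

theorem integral_inner_pow_mul_exp_neg_norm_sq {y : EuclideanSpace ℝ (Fin 3)} (hy : ‖y‖ = 1)
    (n : ℕ) :
    ∫ v : EuclideanSpace ℝ (Fin 3), inner ℝ v y ^ n * Real.exp (-‖v‖ ^ 2) =
      Real.pi * ∫ u : ℝ, u ^ n * Real.exp (-u ^ 2) := by
  set e : EuclideanSpace ℝ (Fin 3) := EuclideanSpace.single 2 1 with he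
  have hye : ‖y‖ = ‖e‖ := by simp [hy, he]
  set R := (Submodule.span ℝ {y - e})ᗮ.reflection with hR
  have hRy : R y = e := Submodule.reflection_sub hye
  have h1 := R.measurePreserving.integral_comp R.toHomeomorph.measurableEmbedding
    (fun v : EuclideanSpace ℝ (Fin 3) => inner ℝ v e ^ n * Real.exp (-‖v‖ ^ 2))
  have h2 : ∀ v, inner ℝ (R v) e = inner ℝ v y := fun v => by
    rw [← hRy, R.inner_map_map]
  simp only [h2, R.norm_map] at h1
  rw [h1]
  have h3 := (EuclideanSpace.volume_preserving_symm_measurableEquiv_toLp (Fin 3)).symm.integral_comp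
    (MeasurableEquiv.measurableEmbedding _)
    (fun v : EuclideanSpace ℝ (Fin 3) => inner ℝ v e ^ n * Real.exp (-‖v‖ ^ 2))
  rw [← h3]
  have h4 : ∀ u : Fin 3 → ℝ, inner ℝ (WithLp.toLp 2 u) e ^ n * Real.exp (-‖WithLp.toLp 2 u‖ ^ 2) =
      ∏ i : Fin 3, (if i = 2 then u i ^ n else 1) * Real.exp (-u i ^ 2) := by
    intro u
    rw [Fin.prod_univ_three, EuclideanSpace.norm_sq_eq, Fin.sum_univ_three, he,
      EuclideanSpace.inner_single_right, neg_add, neg_add, Real.exp_add, Real.exp_add]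
    simp
    ring
  have h5 : ∀ u : Fin 3 → ℝ, (MeasurableEquiv.toLp 2 (Fin 3 → ℝ)).symm.symm u =
    WithLp.toLp 2 u := fun u => rfl
  simp only [h5, h4]
  rw [integral_fintype_prod_volume_eq_prod
    (fun (i : Fin 3) (t : ℝ) => (if i = 2 then t ^ n else 1) * Real.exp (-t ^ 2)),
    Fin.prod_univ_three]
  have hg : ∫ t : ℝ, Real.exp (-t ^ 2) = Real.sqrt Real.pi := by
    have := integral_gaussian 1
    simpa using this
  simp only [Fin.isValue, Fin.reduceEq, if_false, one_mul, hg, if_true]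
  rw [Real.mul_self_sqrt Real.pi_pos.le]

/-- Archimedes' theorem at the level of moments: `⟨x, y⟩` is uniformly distributed on `[-1, 1]`. For
even `n` the ratio of the Gamma values is `n/2 + 1/2`; for odd `n` both sides vanish. -/
theorem integral_inner_pow_surf {y : EuclideanSpace ℝ (Fin 3)} (hy : ‖y‖ = 1) (n : ℕ) :
    ∫ x : S2, inner ℝ x.1 y ^ n ∂surf = 2 * Real.pi * ∫ t in (-1 : ℝ)..1, t ^ n := by
  have h := integral_inner_pow_mul_exp_neg_norm_sq_polar y n
  rw [integral_inner_pow_mul_exp_neg_norm_sq hy] at h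
  have hpos : 0 < ∫ r in Set.Ioi (0 : ℝ), r ^ (n + 2) * Real.exp (-r ^ 2) := by
    have h' := integral_rpow_mul_exp_neg_rpow (p := 2) (q := ((n + 2 : ℕ) : ℝ)) (by norm_num)
      (by have : (0 : ℝ) ≤ ((n + 2 : ℕ) : ℝ) := Nat.cast_nonneg _
          linarith)
    simp only [Real.rpow_natCast, Real.rpow_two] at h'
    rw [h']
    exact mul_pos (by norm_num) (Real.Gamma_pos_of_pos (by positivity))
  rcases Nat.even_or_odd' n with ⟨k, rfl | rfl⟩
  · rw [integral_even_pow_mul_exp_neg_sq, show 2 * k + 2 = 2 * (k + 1) by ring,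
      integral_pow_mul_exp_neg_sq_Ioi_even] at h
    have e : (((k + 1 : ℕ) : ℝ) + 1 / 2) = ((k : ℝ) + 1 / 2) + 1 := by push_cast; ring
    rw [e, Real.Gamma_add_one (by positivity)] at h
    have hG : 0 < Real.Gamma ((k : ℝ) + 1 / 2) := Real.Gamma_pos_of_pos (by positivity)
    rw [integral_pow]
    have ho : Odd (2 * k + 1) := ⟨k, rfl⟩
    rw [ho.neg_pow, one_pow]
    set M := ∫ x : S2, inner ℝ x.1 y ^ (2 * k) ∂surf
    have h2 : Real.Gamma ((k : ℝ) + 1 / 2) * Real.pi =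
        Real.Gamma ((k : ℝ) + 1 / 2) * (M * (1 / 2) * ((k : ℝ) + 1 / 2)) := by linarith
    have h3 := mul_left_cancel₀ hG.ne' h2
    push_cast
    field_simp
    linarith
  · rw [integral_odd_pow_mul_exp_neg_sq, mul_zero] at h
    have h2 := (mul_eq_zero.mp h.symm).resolve_right hpos.ne'
    rw [h2, integral_pow, Even.neg_pow ⟨k + 1, by ring⟩]
    simp

instance : IsFiniteMeasure surf := by unfold surf; infer_instance

theorem surf_real_univ : surf.real Set.univ = 4 * Real.pi := by
  have hy : ‖(EuclideanSpace.single 2 1 : EuclideanSpace ℝ (Fin 3))‖ = 1 := by simp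
  have h := integral_inner_pow_surf hy 0
  simp at h
  rw [h]; ring

theorem integral_zonal_surf {y : EuclideanSpace ℝ (Fin 3)} (hy : ‖y‖ = 1) (p : ℝ[X]) :
    ∫ x : S2, p.eval (inner ℝ x.1 y) ∂surf = 2 * Real.pi * intervalInt p := by
  induction p using Polynomial.induction_on' with
  | add p q hp hq =>
    have hi : ∀ p : ℝ[X], Integrable (fun x : S2 => p.eval (inner ℝ x.1 y)) surf := fun p => by
      apply Continuous.integrable_of_hasCompactSupport
      · exact p.continuous.comp (by fun_prop)
      · exact HasCompactSupport.of_compactSpace _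
    simp only [eval_add]
    rw [integral_add (hi p) (hi q), hp, hq, map_add]; ring
  | monomial n a =>
    simp only [eval_monomial, intervalInt_apply]
    rw [integral_const_mul, integral_inner_pow_surf hy, intervalIntegral.integral_const_mul]; ring

/-! ### The addition theorem -/

theorem rodrigues_eq_eval_legendre (l m : ℕ) (t : ℝ) :
    rodrigues l m t = (derivative^[m] (legendre l)).eval t := by
  rw [legendre, iterate_derivative_C_mul, ← Function.iterate_add_apply, add_comm m l, eval_C_mul,
    rodrigues]

theorem hasDerivAt_rodrigues (l m : ℕ) (t : ℝ) :
    HasDerivAt (rodrigues l m) (rodrigues l (m + 1) t) t := by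
  have h := (derivative^[m] (legendre l)).hasDerivAt t
  rw [← Function.iterate_succ_apply' derivative] at h
  rw [rodrigues_eq_eval_legendre]
  exact h.congr_of_eventuallyEq
    (Filter.Eventually.of_forall fun s => rodrigues_eq_eval_legendre l m s)

theorem rodrigues_succ_self (l : ℕ) (t : ℝ) : rodrigues l (l + 1) t = 0 := by
  rw [rodrigues_eq_eval_legendre, iterate_derivative_eq_zero, eval_zero]
  exact Nat.lt_succ_of_le (natDegree_legendre_le l)

theorem rodrigues_ode (l m : ℕ) (t : ℝ) :
    (1 - t ^ 2) * rodrigues l (m + 2) t = 2 * (m + 1) * t * rodrigues l (m + 1) t -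
      (l + m + 1) * (l - m) * rodrigues l m t := by
  have key : (1 - X ^ 2) * derivative^[m + 2] (legendre l) =
      2 * ((m : ℝ[X]) + 1) * X * derivative^[m + 1] (legendre l) -
      ((l : ℝ[X]) + (m : ℝ[X]) + 1) * ((l : ℝ[X]) - (m : ℝ[X])) * derivative^[m] (legendre l) := by
    induction m with
    | zero =>
      have h := derivative_one_sub_sq_mul_derivative_legendre l
      simp only [derivative_mul, derivative_sub, derivative_X_sq, derivative_one, C_ofNat] at h
      simp only [Function.iterate_succ, Function.iterate_zero, Function.comp, id]
      push_cast
      linear_combination h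
    | succ m ih =>
      have h := congrArg derivative ih
      have h2 : derivative (2 * ((m : ℝ[X]) + 1) * X) = 2 * ((m : ℝ[X]) + 1) := by simp
      have h3 : derivative (((l : ℝ[X]) + (m : ℝ[X]) + 1) * ((l : ℝ[X]) - (m : ℝ[X]))) = 0 := by simp
      have h4 : ∀ k, derivative (derivative^[k] (legendre l)) = derivative^[k + 1] (legendre l) :=
        fun k => (Function.iterate_succ_apply' derivative k _).symm
      rw [derivative_mul, derivative_sub, derivative_sub, derivative_mul (f := 2 * ((m : ℝ[X]) + 1) * X),
        derivative_mul (f := ((l : ℝ[X]) + (m : ℝ[X]) + 1) * ((l : ℝ[X]) - (m : ℝ[X]))), h2, h3, h4, h4, h4,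
        derivative_X_sq, derivative_one, C_ofNat] at h
      push_cast
      linear_combination h
  have h := congrArg (eval t) key
  simpa [rodrigues_eq_eval_legendre] using h

/-- `ζ^m R_{lm}(t)`, proportional to `Y_{lm}` at `(ζ, t)` with `ζ = x₀ + i x₁` and `t = x₂`. -/
def solidHarm (l m : ℕ) (ζ : ℂ) (t : ℝ) : ℂ := ζ ^ m * (rodrigues l m t : ℂ)

/-- `(l-m)!/(l+m)!`. -/
def harmWeight (l m : ℕ) : ℝ := ((l - m).factorial : ℝ) / ((l + m).factorial : ℝ)

/-- The sum `∑_m (l-|m|)!/(l+|m|)! u_m(ζ, t) conj u_m(ζ', t')`, up to its imaginary part. -/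
def zonalSum (l : ℕ) (ζ : ℂ) (t : ℝ) (ζ' : ℂ) (t' : ℝ) : ℂ :=
  harmWeight l 0 * (solidHarm l 0 ζ t * conj (solidHarm l 0 ζ' t')) +
    2 * ∑ m ∈ Finset.range l,
      harmWeight l (m + 1) * (solidHarm l (m + 1) ζ t * conj (solidHarm l (m + 1) ζ' t'))

theorem harmWeight_zero (l : ℕ) : harmWeight l 0 = 1 := by
  simp only [harmWeight, Nat.sub_zero, Nat.add_zero]
  exact div_self (by positivity)

theorem harmWeight_succ {l m : ℕ} (h : m < l) :
    harmWeight l (m + 1) * ((l + m + 1) * (l - m)) = harmWeight l m := by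
  obtain ⟨k, rfl⟩ : ∃ k, l = m + 1 + k := ⟨l - (m + 1), by omega⟩
  have e1 : m + 1 + k - (m + 1) = k := by omega
  have e2 : m + 1 + k - m = k + 1 := by omega
  simp only [harmWeight]
  rw [e1, e2, ← add_assoc (m + 1 + k) m 1, Nat.factorial_succ, Nat.factorial_succ]
  have : ((m + 1 + k + m).factorial : ℝ) ≠ 0 := by positivity
  have : ((m + 1 + k + m : ℕ) : ℝ) + 1 ≠ 0 := by positivity
  push_cast at *
  field_simp
  ring

theorem hasDerivAt_solidHarm_rotation (l m : ℕ) {a t : ℝ → ℝ} {b : ℝ} {s : ℝ}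
    (ha : HasDerivAt a (t s) s) (ht : HasDerivAt t (-a s) s) :
    HasDerivAt (fun s => solidHarm l m (a s + Complex.I * b) (t s))
      (m * (a s + Complex.I * b) ^ (m - 1) * t s * rodrigues l m (t s) -
        a s * ((a s + Complex.I * b) ^ m * rodrigues l (m + 1) (t s))) s := by
  have h1 : HasDerivAt (fun s => ((a s : ℂ) + Complex.I * b) ^ m)
      (m * ((a s : ℂ) + Complex.I * b) ^ (m - 1) * (t s)) s :=
    (ha.ofReal_comp.add_const _).fun_pow m
  have h2 : HasDerivAt (fun s => ((rodrigues l m (t s) : ℝ) : ℂ))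
      ((rodrigues l (m + 1) (t s) * (-a s) : ℝ) : ℂ) s :=
    ((hasDerivAt_rodrigues l m (t s)).comp s ht).ofReal_comp
  refine (h1.mul h2).congr_deriv ?_
  push_cast
  ring

/-- A rotation about the second axis is, infinitesimally, a combination of the raising and lowering
operators. The differentiated Legendre equation and `a² + b² + t² = 1` reduce the derivative to the
two neighbouring orders. -/
theorem hasDerivAt_solidHarm_succ_rotation (l m : ℕ) {a t : ℝ → ℝ} {b : ℝ} {s : ℝ}
    (ha : HasDerivAt a (t s) s) (ht : HasDerivAt t (-a s) s)
    (h1 : a s ^ 2 + b ^ 2 + t s ^ 2 = 1) :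
    HasDerivAt (fun s => solidHarm l (m + 1) (a s + Complex.I * b) (t s))
      (-(1 / 2) * solidHarm l (m + 2) (a s + Complex.I * b) (t s) +
        1 / 2 * ((l + m + 1) * (l - m)) * solidHarm l m (a s + Complex.I * b) (t s)) s := by
  refine (hasDerivAt_solidHarm_rotation l (m + 1) ha ht).congr_deriv ?_
  have h := congrArg (fun r : ℝ => (r : ℂ)) (rodrigues_ode l m (t s))
  have h1' := congrArg (fun r : ℝ => (r : ℂ)) h1
  push_cast at h h1'
  simp only [solidHarm, Nat.add_sub_cancel]
  push_cast
  generalize (rodrigues l (m + 2) (t s) : ℂ) = r2 at *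
  generalize (rodrigues l (m + 1) (t s) : ℂ) = r1 at *
  generalize (rodrigues l m (t s) : ℂ) = r0 at *
  rw [pow_add _ m 2, pow_add _ m 1]
  generalize ha' : (a s : ℂ) = A at *
  generalize (b : ℂ) = B at *
  generalize (t s : ℂ) = T at *
  generalize (A + Complex.I * B) ^ m = Z at *
  linear_combination (-(1 / 2) * Z) * h + (-(1 / 2) * Z * r2) * h1' +
    (1 / 2 * Z * r2 * B ^ 2) * Complex.I_sq

/-- Rotating both points simultaneously does not change the sum: the ladder terms telescope, because
`harmWeight` satisfies `harmWeight_succ`, and the derivative of the real part is zero. -/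
theorem zonalSum_rotation (l : ℕ) {a t a' t' : ℝ → ℝ} {b b' : ℝ}
    (ha : ∀ s, HasDerivAt a (t s) s) (ht : ∀ s, HasDerivAt t (-a s) s)
    (h1 : ∀ s, a s ^ 2 + b ^ 2 + t s ^ 2 = 1)
    (ha' : ∀ s, HasDerivAt a' (t' s) s) (ht' : ∀ s, HasDerivAt t' (-a' s) s)
    (h1' : ∀ s, a' s ^ 2 + b' ^ 2 + t' s ^ 2 = 1) (s₁ s₂ : ℝ) :
    (zonalSum l (a s₁ + Complex.I * b) (t s₁) (a' s₁ + Complex.I * b') (t' s₁)).re =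
      (zonalSum l (a s₂ + Complex.I * b) (t s₂) (a' s₂ + Complex.I * b') (t' s₂)).re := by
  suffices h : ∀ s, HasDerivAt (fun s => (zonalSum l (a s + Complex.I * b) (t s)
      (a' s + Complex.I * b') (t' s)).re) 0 s from
    is_const_of_deriv_eq_zero (fun s => (h s).differentiableAt) (fun s => (h s).deriv) s₁ s₂
  intro s
  set u : ℕ → ℂ := fun m => solidHarm l m (a s + Complex.I * b) (t s) with hu
  set v : ℕ → ℂ := fun m => solidHarm l m (a' s + Complex.I * b') (t' s) with hv
  set D : ℂ := harmWeight l 0 * (-(a s * rodrigues l 1 (t s)) * conj (v 0) +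
      u 0 * -(a' s * rodrigues l 1 (t' s))) +
    2 * ∑ m ∈ Finset.range l, harmWeight l (m + 1) *
      ((-(1 / 2) * u (m + 2) + 1 / 2 * ((l + m + 1) * (l - m)) * u m) * conj (v (m + 1)) +
        u (m + 1) * (-(1 / 2) * conj (v (m + 2)) +
          1 / 2 * ((l + m + 1) * (l - m)) * conj (v m))) with hD
  have hderiv : HasDerivAt (fun s => zonalSum l (a s + Complex.I * b) (t s)
      (a' s + Complex.I * b') (t' s)) D s := by
    have hzero : ∀ {a t : ℝ → ℝ} {b : ℝ}, HasDerivAt a (t s) s → HasDerivAt t (-a s) s →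
        HasDerivAt (fun s => solidHarm l 0 (a s + Complex.I * b) (t s))
          (-(a s * rodrigues l 1 (t s))) s := fun ha ht =>
      (hasDerivAt_solidHarm_rotation l 0 ha ht).congr_deriv (by simp)
    refine HasDerivAt.add (HasDerivAt.const_mul _ ?_) (HasDerivAt.const_mul _
      (HasDerivAt.fun_sum fun m _ => HasDerivAt.const_mul _ ?_))
    · have h := (hzero (b := b) (ha s) (ht s)).mul (hzero (b := b') (ha' s) (ht' s)).star_conj
      refine h.congr_deriv ?_
      simp [hu, hv]
    · have h := (hasDerivAt_solidHarm_succ_rotation l m (ha s) (ht s) (h1 s)).mul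
        (hasDerivAt_solidHarm_succ_rotation l m (ha' s) (ht' s) (h1' s)).star_conj
      refine h.congr_deriv ?_
      simp [hu, hv]
  have hre : D.re = 0 := by
    have hsum : 2 * ∑ m ∈ Finset.range l, (harmWeight l (m + 1) : ℂ) *
      ((-(1 / 2) * u (m + 2) + 1 / 2 * ((l + m + 1) * (l - m)) * u m) * conj (v (m + 1)) +
        u (m + 1) * (-(1 / 2) * conj (v (m + 2)) +
          1 / 2 * ((l + m + 1) * (l - m)) * conj (v m))) =
        u 1 * conj (v 0) + u 0 * conj (v 1) := by
      -- The telescoping quantity. It vanishes at `m = l`, since a polynomial of degree at most `l`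
      -- has zero derivative of order `l + 1`.
      set T : ℕ → ℂ := fun m => harmWeight l m * (u (m + 1) * conj (v m) + u m * conj (v (m + 1)))
        with hT
      have hT0 : T 0 = u 1 * conj (v 0) + u 0 * conj (v 1) := by
        simp [hT, harmWeight_zero]
      have hTl : T l = 0 := by
        simp [hT, hu, hv, solidHarm, rodrigues_succ_self]
      rw [Finset.mul_sum, Finset.sum_congr rfl (g := fun m => T m - T (m + 1)),
        Finset.sum_range_sub', hTl, hT0, sub_zero]
      intro m hm
      have hw := congrArg (fun r : ℝ => (r : ℂ)) (harmWeight_succ (Finset.mem_range.mp hm))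
      push_cast at hw
      simp only [hT]
      rw [← hw]
      ring
    -- The surviving `T 0` cancels the derivative of the order-zero term in the real part only: the
    -- coordinates `b`, `b'` contribute purely imaginary terms.
    rw [hD, hsum, harmWeight_zero]
    have hu0 : u 0 = ((rodrigues l 0 (t s) : ℝ) : ℂ) := by simp [hu, solidHarm]
    have hv0 : v 0 = ((rodrigues l 0 (t' s) : ℝ) : ℂ) := by simp [hv, solidHarm]
    have hu1 : u 1 = (a s + Complex.I * b) * ((rodrigues l 1 (t s) : ℝ) : ℂ) := by
      simp [hu, solidHarm]
    have hv1 : v 1 = (a' s + Complex.I * b') * ((rodrigues l 1 (t' s) : ℝ) : ℂ) := by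
      simp [hv, solidHarm]
    rw [hu0, hv0, hu1, hv1]
    simp
    ring
  have := Complex.reCLM.hasFDerivAt.comp_hasDerivAt s hderiv
  exact this.congr_deriv (by simp [hre])

theorem zonalSum_phase (l : ℕ) (ζ : ℂ) (t : ℝ) (ζ' : ℂ) (t' : ℝ) {c : ℂ} (hc : c * conj c = 1) :
    zonalSum l (c * ζ) t (c * ζ') t' = zonalSum l ζ t ζ' t' := by
  have h : ∀ m, solidHarm l m (c * ζ) t * conj (solidHarm l m (c * ζ') t') =
      solidHarm l m ζ t * conj (solidHarm l m ζ' t') := by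
    intro m
    simp only [solidHarm, map_mul, map_pow, mul_pow]
    calc _ = (c * conj c) ^ m * (ζ ^ m * (rodrigues l m t : ℂ) *
          ((conj ζ') ^ m * conj (rodrigues l m t' : ℂ))) := by rw [mul_pow]; ring
      _ = _ := by rw [hc, one_pow, one_mul]
  simp only [zonalSum, h]

/-- A phase brings the second point into the plane `b' = 0`, and a rotation then takes it to the
pole. There all orders `m ≥ 1` vanish, and the remaining term is `P_l` at the third coordinate of
the rotated first point, that is, at the inner product. -/
theorem zonalSum_re_eq_legendre (l : ℕ) {ζ ζ' : ℂ} {t t' : ℝ} (h : Complex.normSq ζ + t ^ 2 = 1)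
    (h' : Complex.normSq ζ' + t' ^ 2 = 1) :
    (zonalSum l ζ t ζ' t').re = (legendre l).eval ((ζ * conj ζ').re + t * t') := by
  obtain ⟨c, ρ, hc, hρ⟩ : ∃ (c : ℂ) (ρ : ℝ), c * conj c = 1 ∧ c * ζ' = ρ := by
    by_cases hz : ζ' = 0
    · exact ⟨1, 0, by simp, by simp [hz]⟩
    · have hn : (‖ζ'‖ : ℂ) ≠ 0 := by simpa using hz
      have hm := Complex.conj_mul' ζ'
      refine ⟨conj ζ' / ‖ζ'‖, ‖ζ'‖, ?_, ?_⟩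
      · rw [map_div₀, Complex.conj_conj, Complex.conj_ofReal, div_mul_div_comm, hm, div_eq_one_iff_eq]
        · ring
        · exact mul_ne_zero hn hn
      · rw [div_mul_eq_mul_div, hm]; field_simp
  have hcn : Complex.normSq c = 1 := by
    rw [Complex.mul_conj] at hc; exact_mod_cast hc
  have hinner : (ζ * conj ζ').re = (c * ζ).re * ρ := by
    have : ζ * conj ζ' = (c * ζ) * conj (c * ζ') := by
      rw [map_mul]; linear_combination (-(ζ * conj ζ')) * hc
    rw [this, hρ, Complex.conj_ofReal, Complex.re_mul_ofReal]
  have hρ2 : ρ ^ 2 + t' ^ 2 = 1 := by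
    have : Complex.normSq (c * ζ') = Complex.normSq ζ' := by rw [map_mul, hcn, one_mul]
    rw [hρ, Complex.normSq_ofReal] at this
    linarith
  have hz2 : (c * ζ).re ^ 2 + (c * ζ).im ^ 2 + t ^ 2 = 1 := by
    have : Complex.normSq (c * ζ) = Complex.normSq ζ := by rw [map_mul, hcn, one_mul]
    rw [Complex.normSq_apply] at this
    linarith
  rw [← zonalSum_phase l ζ t ζ' t' hc, hρ, hinner]
  set a₀ := (c * ζ).re
  set b₀ := (c * ζ).im
  -- The angle for which the rotated second point has `a' = 0` and third coordinate 1.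
  obtain ⟨τ, hcos, hsin⟩ : ∃ τ, Real.cos τ = t' ∧ Real.sin τ = -ρ := by
    have hn : ‖(⟨t', -ρ⟩ : ℂ)‖ = 1 := by
      rw [← sq_eq_sq₀ (norm_nonneg _) zero_le_one, Complex.sq_norm, Complex.normSq_mk]
      linarith
    have hne : (⟨t', -ρ⟩ : ℂ) ≠ 0 := by
      rw [← norm_ne_zero_iff, hn]; exact one_ne_zero
    exact ⟨Complex.arg ⟨t', -ρ⟩, by rw [Complex.cos_arg hne, hn, div_one],
      by rw [Complex.sin_arg, hn, div_one]⟩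
  have hrot : ∀ (a t s : ℝ), HasDerivAt (fun s => a * Real.cos s + t * Real.sin s)
      (-a * Real.sin s + t * Real.cos s) s ∧
      HasDerivAt (fun s => -a * Real.sin s + t * Real.cos s)
        (-(a * Real.cos s + t * Real.sin s)) s := by
    intro a t s
    constructor
    · refine (((Real.hasDerivAt_cos s).const_mul a).add
        ((Real.hasDerivAt_sin s).const_mul t)).congr_deriv (by ring)
    · refine (((Real.hasDerivAt_sin s).const_mul (-a)).add
        ((Real.hasDerivAt_cos s).const_mul t)).congr_deriv (by ring)
  have key := zonalSum_rotation l (b := b₀) (b' := 0) (fun s => (hrot a₀ t s).1)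
    (fun s => (hrot a₀ t s).2)
    (fun s => by nlinarith [Real.sin_sq_add_cos_sq s])
    (fun s => (hrot ρ t' s).1) (fun s => (hrot ρ t' s).2)
    (fun s => by nlinarith [Real.sin_sq_add_cos_sq s]) 0 τ
  have e0 : (c * ζ) = ((a₀ * Real.cos 0 + t * Real.sin 0 : ℝ) : ℂ) + Complex.I * b₀ := by
    apply Complex.ext <;> simp [a₀, b₀]
  have e1 : (ρ : ℂ) = ((ρ * Real.cos 0 + t' * Real.sin 0 : ℝ) : ℂ) + Complex.I * (0 : ℝ) := by
    simp
  have e2 : t = -a₀ * Real.sin 0 + t * Real.cos 0 := by simp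
  have e3 : t' = -ρ * Real.sin 0 + t' * Real.cos 0 := by simp
  have e4 : ρ * Real.cos τ + t' * Real.sin τ = 0 := by rw [hcos, hsin]; ring
  have e5 : -ρ * Real.sin τ + t' * Real.cos τ = 1 := by rw [hcos, hsin]; linarith
  have e6 : -a₀ * Real.sin τ + t * Real.cos τ = a₀ * ρ + t * t' := by rw [hcos, hsin]; ring
  rw [← e0, ← e1, ← e2, ← e3, e4, e5, e6] at key
  rw [key]
  simp [zonalSum, solidHarm, harmWeight_zero, rodrigues_zero, eval_one_legendre]

theorem sum_Icc_neg_eq {M : Type*} [AddCommMonoid M] (l : ℕ) (F : ℤ → M) :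
    ∑ m ∈ Finset.Icc (-(l : ℤ)) l, F m =
      F 0 + ∑ m ∈ Finset.range l, (F ((m : ℤ) + 1) + F (-((m : ℤ) + 1))) := by
  induction l with
  | zero => simp
  | succ l ih =>
    have h : Finset.Icc (-((l + 1 : ℕ) : ℤ)) ((l + 1 : ℕ) : ℤ) =
        insert ((l : ℤ) + 1) (insert (-((l : ℤ) + 1)) (Finset.Icc (-(l : ℤ)) l)) := by
      ext m; simp only [Finset.mem_Icc, Finset.mem_insert]; push_cast; omega
    rw [h, Finset.sum_insert, Finset.sum_insert, ih, Finset.sum_range_succ]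
    · abel
    · simp
    · simp only [Finset.mem_insert, Finset.mem_Icc]; omega

theorem sphericalHarmonicNat_mul_conj (l m : ℕ) (x y : S2) :
    sphericalHarmonicNat l m x * conj (sphericalHarmonicNat l m y) =
      ((2 * (l : ℝ) + 1) / (4 * Real.pi) : ℝ) * (harmWeight l m *
        (solidHarm l m (x.1 0 + Complex.I * x.1 1) (x.1 2) *
          conj (solidHarm l m (y.1 0 + Complex.I * y.1 1) (y.1 2)))) := by
  have h0 : 0 ≤ (2 * (l : ℝ) + 1) / (4 * Real.pi) *
      (((l - m).factorial : ℝ) / ((l + m).factorial : ℝ)) := by positivity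
  have hs := congrArg (fun r : ℝ => (r : ℂ)) (Real.mul_self_sqrt h0)
  have h1 : ((-1 : ℂ) ^ m) * (-1) ^ m = 1 := by rw [← mul_pow]; simp
  rw [show ((2 * (l : ℝ) + 1) / (4 * Real.pi) : ℝ) * ((harmWeight l m : ℝ) *
        (solidHarm l m (x.1 0 + Complex.I * x.1 1) (x.1 2) *
          conj (solidHarm l m (y.1 0 + Complex.I * y.1 1) (y.1 2)))) =
      (((2 * (l : ℝ) + 1) / (4 * Real.pi) * harmWeight l m : ℝ) : ℂ) *
        (solidHarm l m (x.1 0 + Complex.I * x.1 1) (x.1 2) *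
          conj (solidHarm l m (y.1 0 + Complex.I * y.1 1) (y.1 2))) by push_cast; ring]
  rw [harmWeight, ← hs]
  simp only [sphericalHarmonicNat, solidHarm, map_mul, map_pow, map_neg, map_one,
    Complex.conj_ofReal, Complex.ofReal_mul]
  linear_combination (((Real.sqrt ((2 * (l : ℝ) + 1) / (4 * Real.pi) *
      (((l - m).factorial : ℝ) / ((l + m).factorial : ℝ))) : ℂ)) *
    ((Real.sqrt ((2 * (l : ℝ) + 1) / (4 * Real.pi) *
      (((l - m).factorial : ℝ) / ((l + m).factorial : ℝ))) : ℂ)) *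
    ((x.1 0 + Complex.I * x.1 1) ^ m * rodrigues l m (x.1 2)) *
    ((conj ((y.1 0 : ℂ) + Complex.I * y.1 1)) ^ m * rodrigues l m (y.1 2))) * h1

/-- The addition theorem for spherical harmonics. -/
theorem sum_sphericalHarmonic_mul_conj (l : ℕ) (x y : S2) :
    (∑ m ∈ Finset.Icc (-(l : ℤ)) l, sphericalHarmonic l m x * conj (sphericalHarmonic l m y)).re =
      (2 * (l : ℝ) + 1) / (4 * Real.pi) * (legendre l).eval (inner ℝ x.1 y.1) := by
  have hnorm : ∀ x : S2, Complex.normSq (x.1 0 + Complex.I * x.1 1) + x.1 2 ^ 2 = 1 := by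
    intro x
    have h : ‖x.1‖ = 1 := by simp
    have h2 := EuclideanSpace.norm_sq_eq x.1
    rw [h, Fin.sum_univ_three] at h2
    simp only [Real.norm_eq_abs, sq_abs] at h2
    simp [Complex.normSq_apply]
    linarith
  have hin : inner ℝ x.1 y.1 = ((x.1 0 + Complex.I * x.1 1) *
      conj ((y.1 0 : ℂ) + Complex.I * y.1 1)).re + x.1 2 * y.1 2 := by
    rw [PiLp.inner_apply, Fin.sum_univ_three]
    simp
    ring
  rw [hin, ← zonalSum_re_eq_legendre l (hnorm x) (hnorm y), sum_Icc_neg_eq]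
  -- Orders `m` and `-m` contribute conjugate terms, so their real parts agree; this is the factor 2
  -- in `zonalSum`.
  have hneg : ∀ m : ℕ, sphericalHarmonic l (-((m : ℤ) + 1)) x *
      conj (sphericalHarmonic l (-((m : ℤ) + 1)) y) =
      conj (sphericalHarmonicNat l (m + 1) x * conj (sphericalHarmonicNat l (m + 1) y)) := by
    intro m
    have h1 : ¬ (0 ≤ -((m : ℤ) + 1)) := by omega
    have h2 : (-((m : ℤ) + 1)).natAbs = m + 1 := by omega
    have h3 : ((-1 : ℂ) ^ (m + 1)) * (-1) ^ (m + 1) = 1 := by rw [← mul_pow]; simp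
    simp only [sphericalHarmonic, h1, if_false, h2, map_mul, map_pow, map_neg, map_one,
      Complex.conj_conj]
    linear_combination (conj (sphericalHarmonicNat l (m + 1) x) *
      sphericalHarmonicNat l (m + 1) y) * h3
  have hpos : ∀ m : ℕ, ∀ z, sphericalHarmonic l ((m : ℤ) + 1) z =
      sphericalHarmonicNat l (m + 1) z := by
    intro m z
    have h1 : 0 ≤ (m : ℤ) + 1 := by omega
    have h2 : ((m : ℤ) + 1).natAbs = m + 1 := by omega
    simp only [sphericalHarmonic, h1, if_true, h2]
  have hz : ∀ z, sphericalHarmonic l 0 z = sphericalHarmonicNat l 0 z := fun z => by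
    simp [sphericalHarmonic]
  simp only [hneg, hpos, hz, Complex.add_re, Complex.re_sum, Complex.conj_re]
  simp only [sphericalHarmonicNat_mul_conj, Complex.re_ofReal_mul, zonalSum, Complex.add_re]
  rw [show (2 : ℂ) = ((2 : ℝ) : ℂ) by simp, Complex.re_ofReal_mul, Complex.re_sum, mul_add,
    Finset.mul_sum, Finset.mul_sum]
  simp only [Complex.re_ofReal_mul]
  congr 1
  refine Finset.sum_congr rfl fun m _ => ?_
  ring

/-! ### Hermite polynomials -/

/-- The probabilists' Hermite polynomial with real coefficients. -/
def hermiteR (n : ℕ) : ℝ[X] := (hermite n).map (Int.castRingHom ℝ)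

theorem aeval_hermite (n : ℕ) (x : ℝ) : aeval x (hermite n) = (hermiteR n).eval x := by
  rw [hermiteR, eval_map, aeval_def]; rfl

theorem hermiteR_zero : hermiteR 0 = 1 := by simp [hermiteR]

theorem hermiteR_succ (n : ℕ) :
    hermiteR (n + 1) = X * hermiteR n - derivative (hermiteR n) := by
  simp [hermiteR, hermite_succ]

theorem hermiteR_one : hermiteR 1 = X := by simp [hermiteR]

theorem hermiteR_two : hermiteR 2 = X ^ 2 - 1 := by
  rw [hermiteR_succ, hermiteR_one, derivative_X, pow_two]

theorem derivative_hermiteR_succ (n : ℕ) :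
    derivative (hermiteR (n + 1)) = ((n : ℝ[X]) + 1) * hermiteR n := by
  induction n with
  | zero => simp [hermiteR_one, hermiteR_zero]
  | succ n ih =>
    rw [hermiteR_succ (n + 1), derivative_sub, derivative_mul, ih, derivative_X]
    have h : derivative (((n : ℝ[X]) + 1) * hermiteR n) =
        ((n : ℝ[X]) + 1) * derivative (hermiteR n) := by
      rw [derivative_mul]; simp
    rw [h]
    push_cast
    linear_combination -((n : ℝ[X]) + 1) * hermiteR_succ n

theorem integrable_eval_gaussianReal (p : ℝ[X]) :
    Integrable (fun x => p.eval x) (gaussianReal 0 1) := by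
  induction p using Polynomial.induction_on' with
  | add p q hp hq => simp only [eval_add]; exact hp.add hq
  | monomial n a =>
    simp only [eval_monomial]
    exact (integrable_pow_of_mem_interior_integrableExpSet (X := id) (by simp) n).const_mul a

theorem memLp_eval_gaussianReal (p : ℝ[X]) :
    MemLp (fun x => p.eval x) 2 (gaussianReal 0 1) := by
  rw [memLp_two_iff_integrable_sq p.continuous.aestronglyMeasurable]
  simp only [← eval_pow]
  exact integrable_eval_gaussianReal (p ^ 2)

/-- Integration of polynomials against the standard Gaussian measure. -/
def gaussInt : ℝ[X] →ₗ[ℝ] ℝ where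
  toFun p := ∫ x, p.eval x ∂gaussianReal 0 1
  map_add' p q := by
    simp only [eval_add]
    exact integral_add (integrable_eval_gaussianReal p) (integrable_eval_gaussianReal q)
  map_smul' c p := by simp [integral_const_mul]

theorem gaussInt_apply (p : ℝ[X]) : gaussInt p = ∫ x, p.eval x ∂gaussianReal 0 1 := rfl

theorem gaussInt_C_mul (c : ℝ) (p : ℝ[X]) : gaussInt (C c * p) = c * gaussInt p := by
  rw [← smul_eq_C_mul, map_smul, smul_eq_mul]

theorem hasDerivAt_gaussianPDFReal (x : ℝ) :
    HasDerivAt (gaussianPDFReal 0 1) (-x * gaussianPDFReal 0 1 x) x := by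
  have h : HasDerivAt (fun x : ℝ => (Real.sqrt (2 * Real.pi * (1 : NNReal)))⁻¹ *
      Real.exp (-(x - 0) ^ 2 / (2 * (1 : NNReal)))) ((Real.sqrt (2 * Real.pi * (1 : NNReal)))⁻¹ *
      (Real.exp (-(x - 0) ^ 2 / (2 * (1 : NNReal))) *
        (-(2 * (x - 0)) / (2 * (1 : NNReal))))) x := by
    refine HasDerivAt.const_mul _ (HasDerivAt.exp ?_)
    refine HasDerivAt.div_const ?_ _
    refine HasDerivAt.fun_neg ?_
    simpa using ((hasDerivAt_id x).sub_const 0).fun_pow 2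
  refine h.congr_deriv ?_
  rw [gaussianPDFReal]
  simp
  ring

theorem integrable_gaussianPDFReal_mul_eval (p : ℝ[X]) :
    Integrable (fun x => gaussianPDFReal 0 1 x * p.eval x) := by
  have h := integrable_eval_gaussianReal p
  rw [gaussianReal_of_var_ne_zero 0 one_ne_zero,
    integrable_withDensity_iff_integrable_smul' (measurable_gaussianPDF 0 1)
      (Filter.Eventually.of_forall fun x => gaussianPDF_lt_top)] at h
  simpa [toReal_gaussianPDF] using h

/-- Gaussian integration by parts. -/
theorem gaussInt_X_mul (p : ℝ[X]) : gaussInt (X * p) = gaussInt (derivative p) := by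
  have hd : ∀ x, HasDerivAt (fun x => gaussianPDFReal 0 1 x * p.eval x)
      (gaussianPDFReal 0 1 x * (derivative p - X * p).eval x) x := by
    intro x
    refine ((hasDerivAt_gaussianPDFReal x).mul (p.hasDerivAt x)).congr_deriv ?_
    simp; ring
  have h := integral_eq_zero_of_hasDerivAt_of_integrable hd
    (integrable_gaussianPDFReal_mul_eval _) (integrable_gaussianPDFReal_mul_eval _)
  have h2 : gaussInt (derivative p - X * p) = 0 := by
    rw [gaussInt_apply, integral_gaussianReal_eq_integral_smul one_ne_zero]
    exact h
  rw [map_sub] at h2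
  linarith

theorem gaussInt_hermiteR_succ_mul (n : ℕ) (p : ℝ[X]) :
    gaussInt (hermiteR (n + 1) * p) = gaussInt (hermiteR n * derivative p) := by
  have h := gaussInt_X_mul (hermiteR n * p)
  rw [derivative_mul, map_add] at h
  rw [hermiteR_succ, sub_mul, map_sub, mul_assoc, h]
  ring

theorem gaussInt_hermiteR_mul_hermiteR (p q : ℕ) :
    gaussInt (hermiteR p * hermiteR q) = if p = q then (q.factorial : ℝ) else 0 := by
  induction p generalizing q with
  | zero =>
    rcases q with _ | q
    · simp [hermiteR_zero, gaussInt_apply]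
    · rw [mul_comm, gaussInt_hermiteR_succ_mul, hermiteR_zero]; simp
  | succ p ih =>
    rcases q with _ | q
    · rw [gaussInt_hermiteR_succ_mul, hermiteR_zero]; simp
    · have e : ((q : ℝ[X]) + 1) = C ((q : ℝ) + 1) := by simp
      rw [gaussInt_hermiteR_succ_mul, derivative_hermiteR_succ, e, ← mul_assoc,
        mul_comm (hermiteR p), mul_assoc, gaussInt_C_mul, ih, Nat.factorial_succ]
      by_cases h : p = q <;> simp [h]

/-- Hermite polynomials diagonalize the Ornstein-Uhlenbeck semigroup. The induction combines the
three-term recurrence with Gaussian integration by parts in `z`. -/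
theorem integral_eval_hermiteR_affine {r s : ℝ} (h : r ^ 2 + s ^ 2 = 1) (n : ℕ) (x : ℝ) :
    ∫ z, (hermiteR n).eval (r * x + s * z) ∂gaussianReal 0 1 = r ^ n * (hermiteR n).eval x := by
  have e : ∀ p : ℝ[X], ∫ z, p.eval (r * x + s * z) ∂gaussianReal 0 1 =
      gaussInt (p.comp (C (r * x) + C s * X)) := fun p => by simp [gaussInt_apply]
  have hC : ∀ n : ℕ, C ((n : ℝ) + 1) = (n : ℝ[X]) + 1 := fun n => by simp
  rw [e]
  induction n using Nat.twoStepInduction with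
  | zero => simp [hermiteR_zero, gaussInt_apply]
  | one =>
    have h0 : gaussInt X = 0 := by
      have := gaussInt_X_mul 1
      simpa using this
    have h1 : gaussInt 1 = 1 := by simp [gaussInt_apply]
    rw [hermiteR_one, X_comp, map_add, ← mul_one (C (r * x)), gaussInt_C_mul, gaussInt_C_mul, h0,
      h1]
    simp
  | more n ih0 ih1 =>
    set L := C (r * x) + C s * X with hL
    have hL' : derivative L = C s := by simp [hL]
    have hS := gaussInt_X_mul ((hermiteR (n + 1)).comp L)
    rw [derivative_comp, hL', derivative_hermiteR_succ, ← hC, mul_comp, C_comp,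
      gaussInt_C_mul, gaussInt_C_mul, ih0] at hS
    have h2 : (hermiteR (n + 2)).comp L = C (r * x) * (hermiteR (n + 1)).comp L +
        C s * (X * (hermiteR (n + 1)).comp L) - C ((n : ℝ) + 1) * (hermiteR n).comp L := by
      rw [hermiteR_succ (n + 1), derivative_hermiteR_succ, ← hC, sub_comp, mul_comp, mul_comp,
        X_comp, C_comp]
      rw [hL]; ring
    rw [h2, map_sub, map_add, gaussInt_C_mul, gaussInt_C_mul, gaussInt_C_mul, ih0, ih1, hS,
      hermiteR_succ (n + 1), derivative_hermiteR_succ, ← hC, eval_sub, eval_mul, eval_mul, eval_X,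
      eval_C]
    have hs : s ^ 2 = 1 - r ^ 2 := by linarith
    linear_combination (((n : ℝ) + 1) * (r ^ n * eval x (hermiteR n))) * hs

theorem integral_hermiteR_mul_hermiteR_affine {r s : ℝ} (h : r ^ 2 + s ^ 2 = 1) (p q : ℕ)
    (hint : Integrable (fun w : ℝ × ℝ => (hermiteR p).eval w.1 *
      (hermiteR q).eval (r * w.1 + s * w.2)) ((gaussianReal 0 1).prod (gaussianReal 0 1))) :
    ∫ w : ℝ × ℝ, (hermiteR p).eval w.1 * (hermiteR q).eval (r * w.1 + s * w.2)
      ∂((gaussianReal 0 1).prod (gaussianReal 0 1)) =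
      if p = q then (q.factorial : ℝ) * r ^ q else 0 := by
  rw [integral_prod _ hint]
  simp only [integral_const_mul, integral_eval_hermiteR_affine h]
  have h2 := gaussInt_hermiteR_mul_hermiteR p q
  rw [gaussInt_apply] at h2
  simp only [eval_mul] at h2
  have e : ∀ x, eval x (hermiteR p) * (r ^ q * eval x (hermiteR q)) =
    r ^ q * (eval x (hermiteR p) * eval x (hermiteR q)) := fun x => by ring
  simp only [e, integral_const_mul, h2]
  by_cases hpq : p = q <;> simp [hpq, mul_comm]

/-! ### Completeness of the Hermite polynomials -/

/-- The exponential series may be integrated term by term: its partial sums are dominated by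
`exp(|t||x|) |g|`, a product of two square integrable functions. -/
theorem integral_mul_cexp_eq_zero {g : ℝ → ℝ} (hg : MemLp g 2 (gaussianReal 0 1))
    (h : ∀ n : ℕ, ∫ x, x ^ n * g x ∂gaussianReal 0 1 = 0) (t : ℝ) :
    ∫ x, Complex.exp (t * x * Complex.I) * g x ∂gaussianReal 0 1 = 0 := by
  have hexp : MemLp (fun x : ℝ => Real.exp (|t| * |x|)) 2 (gaussianReal 0 1) := by
    rw [memLp_two_iff_integrable_sq (by fun_prop)]
    have := integrable_exp_mul_abs (X := id) (μ := gaussianReal 0 1) (t := 2 * |t|)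
      (integrable_exp_mul_gaussianReal _) (integrable_exp_mul_gaussianReal _)
    refine this.congr (Filter.Eventually.of_forall fun x => ?_)
    simp only [id]
    rw [← Real.exp_nat_mul]
    congr 1; push_cast; ring
  have hs := hasSum_integral_of_dominated_convergence (μ := gaussianReal 0 1)
    (F := fun (n : ℕ) (x : ℝ) => ((t * x * Complex.I) ^ n / n.factorial * g x : ℂ))
    (f := fun x => Complex.exp (t * x * Complex.I) * g x)
    (fun (n : ℕ) (x : ℝ) => (|t| * |x|) ^ n / n.factorial * |g x|) ?_ ?_ ?_ ?_ ?_
  · have hz : ∀ n : ℕ, ∫ x, ((t * x * Complex.I) ^ n / n.factorial * g x : ℂ)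
        ∂gaussianReal 0 1 = 0 := by
      intro n
      have e : ∀ x : ℝ, ((t * x * Complex.I) ^ n / n.factorial * g x : ℂ) =
          ((t * Complex.I) ^ n / n.factorial : ℂ) * ((x ^ n * g x : ℝ) : ℂ) := by
        intro x; push_cast; ring
      simp only [e]
      rw [integral_const_mul, integral_complex_ofReal, h n]
      simp
    simp only [hz] at hs
    exact hs.unique hasSum_zero |>.symm ▸ rfl
  · intro n
    exact AEStronglyMeasurable.mul (by fun_prop)
      (Complex.continuous_ofReal.comp_aestronglyMeasurable hg.1)
  · intro n
    refine Filter.Eventually.of_forall fun x => ?_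
    simp
  · refine Filter.Eventually.of_forall fun x => ?_
    exact (Real.summable_pow_div_factorial _).mul_right _
  · have : ∀ x, ∑' n : ℕ, (|t| * |x|) ^ n / n.factorial * |g x| =
        Real.exp (|t| * |x|) * |g x| := by
      intro x
      rw [tsum_mul_right, Real.exp_eq_exp_ℝ, NormedSpace.exp_eq_tsum_div]
    simp only [this]
    exact hexp.integrable_mul hg.abs
  · refine Filter.Eventually.of_forall fun x => ?_
    refine HasSum.mul_right _ ?_
    rw [Complex.exp_eq_exp_ℂ]
    exact NormedSpace.expSeries_div_hasSum_exp _

/-- The positive and negative parts of `g` are densities of two finite measures with the same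
characteristic function, hence they agree almost everywhere. -/
theorem ae_eq_zero_of_moments_eq_zero {g : ℝ → ℝ} (hg : MemLp g 2 (gaussianReal 0 1))
    (h : ∀ n : ℕ, ∫ x, x ^ n * g x ∂gaussianReal 0 1 = 0) : g =ᵐ[gaussianReal 0 1] 0 := by
  set γ := gaussianReal 0 1
  have hi : Integrable g γ := hg.integrable (by norm_num)
  have hfin : ∀ f : ℝ → ℝ, Integrable f γ →
      IsFiniteMeasure (γ.withDensity fun x => ENNReal.ofReal (f x)) := fun f hf =>
    isFiniteMeasure_withDensity_ofReal hf.2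
  have hchar : ∀ f : ℝ → ℝ, Integrable f γ → (∀ x, 0 ≤ f x) → ∀ t : ℝ,
      charFun (γ.withDensity fun x => ENNReal.ofReal (f x)) t =
      ∫ x, Complex.exp (t * x * Complex.I) * f x ∂γ := by
    intro f hf hf0 t
    rw [charFun_apply_real, integral_withDensity_eq_integral_toReal_smul₀
      hf.1.aemeasurable.ennreal_ofReal (Filter.Eventually.of_forall fun x => ENNReal.ofReal_lt_top)]
    refine integral_congr_ae (Filter.Eventually.of_forall fun x => ?_)
    simp only [ENNReal.toReal_ofReal (hf0 x), Complex.real_smul]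
    ring
  have hp := hi.pos_part
  have hn := hi.neg_part
  have := hfin _ hp
  have := hfin _ hn
  have heq : γ.withDensity (fun x => ENNReal.ofReal (max (g x) 0)) =
      γ.withDensity (fun x => ENNReal.ofReal (max (-g x) 0)) := by
    refine Measure.ext_of_charFun ?_
    ext t
    rw [hchar _ hp (fun x => le_max_right _ _), hchar _ hn (fun x => le_max_right _ _),
      ← sub_eq_zero]
    have hb : ∀ f : ℝ → ℝ, Integrable f γ →
        Integrable (fun x : ℝ => Complex.exp (t * x * Complex.I) * f x) γ := by
      intro f hf
      refine hf.ofReal.bdd_mul (c := 1) (by fun_prop) (Filter.Eventually.of_forall fun x => ?_)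
      rw [← Complex.ofReal_mul, Complex.norm_exp_ofReal_mul_I]
    rw [← integral_sub (hb _ hp) (hb _ hn), ← integral_mul_cexp_eq_zero hg h t]
    refine integral_congr_ae (Filter.Eventually.of_forall fun x => ?_)
    simp only
    rw [← mul_sub, ← Complex.ofReal_sub]
    congr 2
    exact max_zero_sub_max_neg_zero_eq_self (g x)
  rw [withDensity_eq_iff hp.1.aemeasurable.ennreal_ofReal hn.1.aemeasurable.ennreal_ofReal
    (hp.lintegral_lt_top.ne)] at heq
  filter_upwards [heq] with x hx
  rw [ENNReal.ofReal_eq_ofReal_iff (le_max_right _ _) (le_max_right _ _)] at hx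
  have := max_zero_sub_max_neg_zero_eq_self (g x)
  simp only [Pi.zero_apply]
  linarith

/-- The Hermite polynomial as an element of `L²` of the standard Gaussian measure. -/
def hermiteLp (n : ℕ) : Lp ℝ 2 (gaussianReal 0 1) :=
  (memLp_eval_gaussianReal (hermiteR n)).toLp _

theorem inner_hermiteLp (n : ℕ) (u : Lp ℝ 2 (gaussianReal 0 1)) :
    inner ℝ (hermiteLp n) u = ∫ x, (hermiteR n).eval x * u x ∂gaussianReal 0 1 := by
  rw [L2.inner_def]
  refine integral_congr_ae ?_
  filter_upwards [(memLp_eval_gaussianReal (hermiteR n)).coeFn_toLp] with x hx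
  rw [hermiteLp, hx]
  simp [mul_comm]

theorem mem_span_hermiteR (p : ℝ[X]) : p ∈ Submodule.span ℝ (Set.range hermiteR) := by
  have hX : ∀ q ∈ Submodule.span ℝ (Set.range hermiteR),
      X * q ∈ Submodule.span ℝ (Set.range hermiteR) := by
    intro q hq
    induction hq using Submodule.span_induction with
    | mem q hq =>
      obtain ⟨n, rfl⟩ := hq
      rcases n with _ | n
      · rw [hermiteR_zero, mul_one, ← hermiteR_one]
        exact Submodule.subset_span ⟨1, rfl⟩
      · have : X * hermiteR (n + 1) = hermiteR (n + 2) + ((n : ℝ) + 1) • hermiteR n := by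
          rw [hermiteR_succ (n + 1), derivative_hermiteR_succ, smul_eq_C_mul]
          simp
        rw [this]
        exact Submodule.add_mem _ (Submodule.subset_span ⟨_, rfl⟩)
          (Submodule.smul_mem _ _ (Submodule.subset_span ⟨_, rfl⟩))
    | zero => simp
    | add p q _ _ hp hq => rw [mul_add]; exact Submodule.add_mem _ hp hq
    | smul c p _ hp => rw [mul_smul_comm]; exact Submodule.smul_mem _ _ hp
  have hXn : ∀ n, (X : ℝ[X]) ^ n ∈ Submodule.span ℝ (Set.range hermiteR) := by
    intro n
    induction n with
    | zero => exact Submodule.subset_span ⟨0, by simp [hermiteR_zero]⟩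
    | succ n ih => rw [pow_succ']; exact hX _ ih
  rw [p.as_sum_range_C_mul_X_pow]
  refine Submodule.sum_mem _ fun k _ => ?_
  rw [← smul_eq_C_mul]
  exact Submodule.smul_mem _ _ (hXn k)

theorem topologicalClosure_span_hermiteLp :
    (Submodule.span ℝ (Set.range hermiteLp)).topologicalClosure = ⊤ := by
  rw [Submodule.topologicalClosure_eq_top_iff, Submodule.eq_bot_iff]
  intro u hu
  have h0 : ∀ n, ∫ x, (hermiteR n).eval x * u x ∂gaussianReal 0 1 = 0 := fun n => by
    rw [← inner_hermiteLp]
    exact (Submodule.mem_orthogonal _ _).mp hu _ (Submodule.subset_span ⟨n, rfl⟩)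
  have hp : ∀ p : ℝ[X], ∫ x, p.eval x * u x ∂gaussianReal 0 1 = 0 := by
    intro p
    have hp := mem_span_hermiteR p
    have hint : ∀ p : ℝ[X], Integrable (fun x => p.eval x * u x) (gaussianReal 0 1) := fun p =>
      (memLp_eval_gaussianReal p).integrable_mul (Lp.memLp u)
    induction hp using Submodule.span_induction with
    | mem q hq => obtain ⟨n, rfl⟩ := hq; exact h0 n
    | zero => simp
    | add p q _ _ hp hq =>
      simp only [eval_add, add_mul]
      rw [integral_add (hint p) (hint q), hp, hq, add_zero]
    | smul c p _ hp =>
      simp only [eval_smul, smul_eq_mul, mul_assoc]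
      rw [integral_const_mul, hp, mul_zero]
  have h := ae_eq_zero_of_moments_eq_zero (Lp.memLp u) fun n => by simpa using hp (X ^ n)
  exact (Lp.eq_zero_iff_ae_eq_zero).mpr h

/-! ### Functionals of correlated Gaussian pairs -/

/-- On finite combinations of the `e q` both sides are explicit, and `|r|^q ≤ |r|^k` for `q ≥ k`.
The inequality is a closed condition on `u`, so it passes to the closure without summing an infinite
expansion. -/
theorem abs_inner_sub_le_of_dense_orthogonal {V W : Type*} [NormedAddCommGroup V]
    [InnerProductSpace ℝ V] [NormedAddCommGroup W] [InnerProductSpace ℝ W] {e : ℕ → V}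
    (he : ∀ p q, inner ℝ (e p) (e q) = if p = q then (q.factorial : ℝ) else 0)
    (hdense : (Submodule.span ℝ (Set.range e)).topologicalClosure = ⊤) (A B : V →ₗᵢ[ℝ] W) {r : ℝ}
    (hr : |r| ≤ 1)
    (hAB : ∀ p q, inner ℝ (A (e p)) (B (e q)) = if p = q then (q.factorial : ℝ) * r ^ q else 0)
    (k : ℕ) (u : V) :
    |inner ℝ (A u) (B u) - ∑ q ∈ Finset.range k, inner ℝ (e q) u ^ 2 * r ^ q / q.factorial| ≤
      |r| ^ k * ‖u‖ ^ 2 := by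
  have hclosed : IsClosed {u : V | |inner ℝ (A u) (B u) -
      ∑ q ∈ Finset.range k, inner ℝ (e q) u ^ 2 * r ^ q / q.factorial| ≤ |r| ^ k * ‖u‖ ^ 2} := by
    refine isClosed_le ?_ (by fun_prop)
    refine Continuous.abs (Continuous.sub ?_ ?_)
    · exact A.continuous.inner B.continuous
    · exact continuous_finsetSum _ fun q _ => by fun_prop
  have hu : u ∈ closure ((Submodule.span ℝ (Set.range e) : Submodule ℝ V) : Set V) := by
    rw [← Submodule.topologicalClosure_coe, hdense]; trivial
  refine hclosed.closure_subset_iff.mpr ?_ hu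
  intro u hu
  obtain ⟨c, rfl⟩ := Finsupp.mem_span_range_iff_exists_finsupp.mp hu
  rw [Set.mem_ofPred_eq]
  set s := c.support ∪ Finset.range k
  have hsum : (c.sum fun i a => a • e i) = ∑ q ∈ s, c q • e q :=
    c.sum_of_support_subset Finset.subset_union_left _ (by simp)
  rw [hsum]
  have h1 : inner ℝ (A (∑ q ∈ s, c q • e q)) (B (∑ q ∈ s, c q • e q)) =
      ∑ q ∈ s, c q ^ 2 * q.factorial * r ^ q := by
    simp only [map_sum, map_smul, sum_inner, inner_sum, inner_smul_left, inner_smul_right, hAB,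
      conj_trivial]
    refine Finset.sum_congr rfl fun q hq => ?_
    rw [Finset.sum_eq_single_of_mem q hq fun j _ hj => by simp [hj]]
    simp; ring
  have h2 : ‖∑ q ∈ s, c q • e q‖ ^ 2 = ∑ q ∈ s, c q ^ 2 * q.factorial := by
    rw [← real_inner_self_eq_norm_sq]
    simp only [sum_inner, inner_sum, inner_smul_left, inner_smul_right, he, conj_trivial]
    refine Finset.sum_congr rfl fun q hq => ?_
    rw [Finset.sum_eq_single_of_mem q hq fun j _ hj => by simp [hj]]
    simp; ring
  have h3 : ∑ q ∈ Finset.range k, inner ℝ (e q) (∑ q ∈ s, c q • e q) ^ 2 * r ^ q / q.factorial =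
      ∑ q ∈ Finset.range k, c q ^ 2 * q.factorial * r ^ q := by
    refine Finset.sum_congr rfl fun q hq => ?_
    have hqs : q ∈ s := Finset.mem_union_right _ hq
    have : inner ℝ (e q) (∑ q ∈ s, c q • e q) = c q * q.factorial := by
      simp only [inner_sum, inner_smul_right, he]
      rw [Finset.sum_eq_single_of_mem q hqs fun j _ hj => by simp [hj.symm]]
      simp
    rw [this]
    have : (q.factorial : ℝ) ≠ 0 := by positivity
    field_simp
  rw [h1, h2, h3, ← Finset.sum_sdiff (Finset.subset_union_right : Finset.range k ⊆ s),
    add_sub_cancel_right]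
  calc |∑ q ∈ s \ Finset.range k, c q ^ 2 * q.factorial * r ^ q|
      ≤ ∑ q ∈ s \ Finset.range k, |r| ^ k * (c q ^ 2 * q.factorial) := by
        refine (Finset.abs_sum_le_sum_abs _ _).trans (Finset.sum_le_sum fun q hq => ?_)
        rw [Finset.mem_sdiff, Finset.mem_range, not_lt] at hq
        have h4 : |r| ^ q ≤ |r| ^ k := pow_le_pow_of_le_one (abs_nonneg r) hr hq.2
        have h5 : 0 ≤ c q ^ 2 * (q.factorial : ℝ) := by positivity
        rw [abs_mul, abs_of_nonneg h5, abs_pow, mul_comm]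
        exact mul_le_mul_of_nonneg_right h4 h5
    _ ≤ |r| ^ k * ∑ q ∈ s, c q ^ 2 * q.factorial := by
        rw [← Finset.mul_sum]
        refine mul_le_mul_of_nonneg_left ?_ (by positivity)
        exact Finset.sum_le_sum_of_subset_of_nonneg Finset.sdiff_subset fun q _ _ => by positivity

section Pair

variable {Ω : Type*} [MeasurableSpace Ω] {P : Measure Ω} {X Y : Ω → ℝ} {r : ℝ}

/-- A standard Gaussian pair with correlation `r`. -/
structure IsGaussianPair (P : Measure Ω) (X Y : Ω → ℝ) (r : ℝ) : Prop where
  gaussian : HasGaussianLaw (fun ω => (X ω, Y ω)) P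
  mean_left : ∫ ω, X ω ∂P = 0
  mean_right : ∫ ω, Y ω ∂P = 0
  sq_left : ∫ ω, X ω * X ω ∂P = 1
  sq_right : ∫ ω, Y ω * Y ω ∂P = 1
  corr : ∫ ω, X ω * Y ω ∂P = r

/-- The right side depends on `r` alone, so the correlation determines the law of the pair. This
permits replacing any pair by the model `(Z, r Z + s Z')`. -/
theorem IsGaussianPair.charFunDual_map (h : IsGaussianPair P X Y r) (L : StrongDual ℝ (ℝ × ℝ)) :
    charFunDual (P.map fun ω => (X ω, Y ω)) L =
      Complex.exp (-((L (1, 0) ^ 2 + 2 * L (1, 0) * L (0, 1) * r + L (0, 1) ^ 2 : ℝ) : ℂ) / 2) := by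
  have := h.gaussian.isProbabilityMeasure
  have hX : MemLp X 2 P := h.gaussian.fst.memLp_two
  have hY : MemLp Y 2 P := h.gaussian.snd.memLp_two
  have hL : (L ∘ fun ω => (X ω, Y ω)) = fun ω => L (1, 0) * X ω + L (0, 1) * Y ω := by
    ext ω
    have : (X ω, Y ω) = X ω • ((1 : ℝ), (0 : ℝ)) + Y ω • ((0 : ℝ), (1 : ℝ)) := by simp
    rw [Function.comp_apply, this, map_add, map_smul, map_smul, smul_eq_mul, smul_eq_mul]
    ring
  have hmean : ∫ ω, (L (1, 0) * X ω + L (0, 1) * Y ω) ∂P = 0 := by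
    rw [integral_add ((hX.integrable (by norm_num)).const_mul _)
      ((hY.integrable (by norm_num)).const_mul _), integral_const_mul, integral_const_mul,
      h.mean_left, h.mean_right]
    simp
  have hvar : Var[fun ω => L (1, 0) * X ω + L (0, 1) * Y ω; P] =
      L (1, 0) ^ 2 + 2 * L (1, 0) * L (0, 1) * r + L (0, 1) ^ 2 := by
    rw [variance_of_integral_eq_zero _ hmean]
    · have e : ∀ ω, (L (1, 0) * X ω + L (0, 1) * Y ω) ^ 2 = L (1, 0) ^ 2 * (X ω * X ω) +
          2 * L (1, 0) * L (0, 1) * (X ω * Y ω) + L (0, 1) ^ 2 * (Y ω * Y ω) := fun ω => by ring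
      simp only [e]
      rw [integral_add, integral_add, integral_const_mul, integral_const_mul, integral_const_mul,
        h.sq_left, h.sq_right, h.corr]
      · ring
      · exact (hX.integrable_mul hX).const_mul _
      · exact (hX.integrable_mul hY).const_mul _
      · exact ((hX.integrable_mul hX).const_mul _).add ((hX.integrable_mul hY).const_mul _)
      · exact (hY.integrable_mul hY).const_mul _
    · exact ((hX.const_mul _).add (hY.const_mul _)).aemeasurable
  rw [h.gaussian.charFunDual_map_eq, hL, hvar, hmean]
  congr 1
  push_cast
  ring

theorem IsGaussianPair.map_left (h : IsGaussianPair P X Y r) : P.map X = gaussianReal 0 1 := by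
  have := h.gaussian.isProbabilityMeasure
  rw [h.gaussian.fst.map_eq_gaussianReal, h.mean_left,
    variance_of_integral_eq_zero h.gaussian.fst.aemeasurable h.mean_left]
  simp only [pow_two, h.sq_left]
  simp

theorem IsGaussianPair.map_right (h : IsGaussianPair P X Y r) : P.map Y = gaussianReal 0 1 := by
  have := h.gaussian.isProbabilityMeasure
  rw [h.gaussian.snd.map_eq_gaussianReal, h.mean_right,
    variance_of_integral_eq_zero h.gaussian.snd.aemeasurable h.mean_right]
  simp only [pow_two, h.sq_right]
  simp

theorem IsGaussianPair.abs_le_one (h : IsGaussianPair P X Y r) : |r| ≤ 1 := by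
  have := h.gaussian.isProbabilityMeasure
  have hX : MemLp X 2 P := h.gaussian.fst.memLp_two
  have hY : MemLp Y 2 P := h.gaussian.snd.memLp_two
  have key : ∀ c : ℝ, c ^ 2 = 1 → 0 ≤ 2 + 2 * c * r := by
    intro c hc
    have h0 : 0 ≤ ∫ ω, (X ω + c * Y ω) ^ 2 ∂P := integral_nonneg fun ω => sq_nonneg _
    have e : ∀ ω, (X ω + c * Y ω) ^ 2 = X ω * X ω + 2 * c * (X ω * Y ω) + c ^ 2 * (Y ω * Y ω) :=
      fun ω => by ring
    simp only [e] at h0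
    rw [integral_add, integral_add, integral_const_mul, integral_const_mul,
      h.sq_left, h.sq_right, h.corr, hc] at h0
    · linarith
    · exact hX.integrable_mul hX
    · exact (hX.integrable_mul hY).const_mul _
    · exact (hX.integrable_mul hX).add ((hX.integrable_mul hY).const_mul _)
    · exact (hY.integrable_mul hY).const_mul _
  have h1 := key 1 (by norm_num)
  have h2 := key (-1) (by norm_num)
  rw [abs_le]
  constructor <;> linarith

theorem isGaussianPair_affine {r s : ℝ} (h : r ^ 2 + s ^ 2 = 1) :
    IsGaussianPair ((gaussianReal 0 1).prod (gaussianReal 0 1)) (fun w : ℝ × ℝ => w.1)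
      (fun w => r * w.1 + s * w.2) r := by
  set μ := (gaussianReal 0 1).prod (gaussianReal 0 1)
  have hid : MemLp (fun x : ℝ => x) 2 (gaussianReal 0 1) := by
    simpa using memLp_eval_gaussianReal (X : ℝ[X])
  have h1 : MemLp (fun w : ℝ × ℝ => w.1) 2 μ := hid.comp_measurePreserving measurePreserving_fst
  have h2 : MemLp (fun w : ℝ × ℝ => w.2) 2 μ := hid.comp_measurePreserving measurePreserving_snd
  have hm : ∫ x : ℝ, x ∂gaussianReal 0 1 = 0 := integral_id_gaussianReal
  have hs : ∫ x : ℝ, x * x ∂gaussianReal 0 1 = 1 := by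
    have := gaussInt_hermiteR_mul_hermiteR 1 1
    simpa [gaussInt_apply, hermiteR_one] using this
  have m1 : ∫ w : ℝ × ℝ, w.1 ∂μ = 0 := by
    rw [integral_fun_fst (fun x : ℝ => x), hm]; simp
  have m2 : ∫ w : ℝ × ℝ, w.2 ∂μ = 0 := by
    rw [integral_fun_snd (fun x : ℝ => x), hm]; simp
  have s1 : ∫ w : ℝ × ℝ, w.1 * w.1 ∂μ = 1 := by
    rw [integral_fun_fst (fun x : ℝ => x * x), hs]; simp
  have s2 : ∫ w : ℝ × ℝ, w.2 * w.2 ∂μ = 1 := by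
    rw [integral_fun_snd (fun x : ℝ => x * x), hs]; simp
  have c12 : ∫ w : ℝ × ℝ, w.1 * w.2 ∂μ = 0 := by
    rw [integral_prod_mul (fun x : ℝ => x) (fun x : ℝ => x), hm, zero_mul]
  have i1 : Integrable (fun w : ℝ × ℝ => w.1 * w.1) μ := h1.integrable_mul h1
  have i2 : Integrable (fun w : ℝ × ℝ => w.2 * w.2) μ := h2.integrable_mul h2
  have i12 : Integrable (fun w : ℝ × ℝ => w.1 * w.2) μ := h1.integrable_mul h2
  refine ⟨?_, m1, ?_, s1, ?_, ?_⟩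
  · let L : ℝ × ℝ →L[ℝ] ℝ × ℝ := (ContinuousLinearMap.fst ℝ ℝ ℝ).prod
      (r • ContinuousLinearMap.fst ℝ ℝ ℝ + s • ContinuousLinearMap.snd ℝ ℝ ℝ)
    exact (IsGaussian.hasGaussianLaw_id (μ := μ)).map_fun L
  · rw [integral_add ((h1.integrable (by norm_num)).const_mul _)
      ((h2.integrable (by norm_num)).const_mul _), integral_const_mul, integral_const_mul, m1, m2]
    simp
  · have e : ∀ w : ℝ × ℝ, (r * w.1 + s * w.2) * (r * w.1 + s * w.2) = r ^ 2 * (w.1 * w.1) +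
        2 * r * s * (w.1 * w.2) + s ^ 2 * (w.2 * w.2) := fun w => by ring
    simp only [e]
    rw [integral_add, integral_add (i1.const_mul _) (i12.const_mul _), integral_const_mul,
      integral_const_mul, integral_const_mul, s1, s2, c12]
    · linarith
    · exact (i1.const_mul _).add (i12.const_mul _)
    · exact i2.const_mul _
  · have e : ∀ w : ℝ × ℝ, w.1 * (r * w.1 + s * w.2) = r * (w.1 * w.1) + s * (w.1 * w.2) :=
      fun w => by ring
    simp only [e]
    rw [integral_add (i1.const_mul _) (i12.const_mul _), integral_const_mul, integral_const_mul,
      s1, c12]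
    ring

theorem IsGaussianPair.integral_hermiteR (h : IsGaussianPair P X Y r) (p q : ℕ) :
    ∫ ω, (hermiteR p).eval (X ω) * (hermiteR q).eval (Y ω) ∂P =
      if p = q then (q.factorial : ℝ) * r ^ q else 0 := by
  have := h.gaussian.isProbabilityMeasure
  have hr : r ^ 2 ≤ 1 := (sq_le_one_iff_abs_le_one r).mpr h.abs_le_one
  have hs : r ^ 2 + Real.sqrt (1 - r ^ 2) ^ 2 = 1 := by
    rw [Real.sq_sqrt (by linarith)]; ring
  set s := Real.sqrt (1 - r ^ 2)
  have h' := isGaussianPair_affine hs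
  have hmap : P.map (fun ω => (X ω, Y ω)) = ((gaussianReal 0 1).prod (gaussianReal 0 1)).map
      (fun w : ℝ × ℝ => (w.1, r * w.1 + s * w.2)) := by
    have := h.gaussian.isGaussian_map
    have := h'.gaussian.isGaussian_map
    refine Measure.ext_of_charFunDual ?_
    ext L
    rw [h.charFunDual_map, h'.charFunDual_map]
  have hc : Continuous fun w : ℝ × ℝ => (hermiteR p).eval w.1 * (hermiteR q).eval w.2 :=
    ((hermiteR p).continuous.comp continuous_fst).mul ((hermiteR q).continuous.comp continuous_snd)
  have e1 := integral_map h.gaussian.aemeasurable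
    (hc.aestronglyMeasurable (μ := P.map (fun ω => (X ω, Y ω))))
  have e2 := integral_map h'.gaussian.aemeasurable (hc.aestronglyMeasurable
    (μ := ((gaussianReal 0 1).prod (gaussianReal 0 1)).map
      (fun w : ℝ × ℝ => (w.1, r * w.1 + s * w.2))))
  rw [← e1, hmap, e2]
  refine integral_hermiteR_mul_hermiteR_affine hs p q ?_
  refine MemLp.integrable_mul (p := 2) (q := 2) ?_ ?_
  · exact (memLp_eval_gaussianReal _).comp_measurePreserving measurePreserving_fst
  · exact (memLp_eval_gaussianReal _).comp_measurePreserving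
      ⟨by fun_prop, h'.map_right⟩

/-- The isometries are `u ↦ u ∘ X` and `u ↦ u ∘ Y` from `L²` of the Gaussian measure; the basis is
that of the Hermite polynomials. -/
theorem IsGaussianPair.abs_integral_sub_le (h : IsGaussianPair P X Y r) (hX : Measurable X)
    (hY : Measurable Y) {ψ : ℝ → ℝ} (hψ : MemLp ψ 2 (gaussianReal 0 1)) (k : ℕ) :
    |∫ ω, ψ (X ω) * ψ (Y ω) ∂P - ∑ q ∈ Finset.range k,
      (∫ x, (hermiteR q).eval x * ψ x ∂gaussianReal 0 1) ^ 2 * r ^ q / q.factorial| ≤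
      |r| ^ k * ∫ x, ψ x ^ 2 ∂gaussianReal 0 1 := by
  have mX : MeasurePreserving X P (gaussianReal 0 1) := ⟨hX, h.map_left⟩
  have mY : MeasurePreserving Y P (gaussianReal 0 1) := ⟨hY, h.map_right⟩
  have hH : ∀ n, hermiteLp n =ᵐ[gaussianReal 0 1] fun x => (hermiteR n).eval x := fun n =>
    (memLp_eval_gaussianReal (hermiteR n)).coeFn_toLp
  have hcomp : ∀ u v : Lp ℝ 2 (gaussianReal 0 1),
      inner ℝ (Lp.compMeasurePreservingₗᵢ ℝ X mX u) (Lp.compMeasurePreservingₗᵢ ℝ Y mY v) =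
      ∫ ω, u (X ω) * v (Y ω) ∂P := by
    intro u v
    rw [L2.inner_def]
    refine integral_congr_ae ?_
    filter_upwards [Lp.coeFn_compMeasurePreserving u mX, Lp.coeFn_compMeasurePreserving v mY]
      with ω h1 h2
    change inner ℝ ((Lp.compMeasurePreserving X mX u : Lp ℝ 2 P) ω)
      ((Lp.compMeasurePreserving Y mY v : Lp ℝ 2 P) ω) = _
    rw [h1, h2]
    simp [mul_comm]
  have main := abs_inner_sub_le_of_dense_orthogonal (e := hermiteLp) (r := r) ?_
    topologicalClosure_span_hermiteLp (Lp.compMeasurePreservingₗᵢ ℝ X mX)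
    (Lp.compMeasurePreservingₗᵢ ℝ Y mY) h.abs_le_one ?_ k (hψ.toLp ψ)
  · have hc := hψ.coeFn_toLp
    rw [hcomp] at main
    have e1 : ∫ ω, (hψ.toLp ψ) (X ω) * (hψ.toLp ψ) (Y ω) ∂P = ∫ ω, ψ (X ω) * ψ (Y ω) ∂P := by
      refine integral_congr_ae ?_
      filter_upwards [mX.quasiMeasurePreserving.ae_eq_comp hc,
        mY.quasiMeasurePreserving.ae_eq_comp hc] with ω h1 h2
      simp only [Function.comp_apply] at h1 h2
      rw [h1, h2]
    have e2 : ∀ q, inner ℝ (hermiteLp q) (hψ.toLp ψ) =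
        ∫ x, (hermiteR q).eval x * ψ x ∂gaussianReal 0 1 := by
      intro q
      rw [inner_hermiteLp]
      refine integral_congr_ae ?_
      filter_upwards [hc] with x hx
      rw [hx]
    have e3 : ‖hψ.toLp ψ‖ ^ 2 = ∫ x, ψ x ^ 2 ∂gaussianReal 0 1 := by
      rw [← real_inner_self_eq_norm_sq, L2.inner_def]
      refine integral_congr_ae ?_
      filter_upwards [hc] with x hx
      rw [hx]
      simp [pow_two]
    rw [e1, e3] at main
    simp only [e2] at main
    exact main
  · intro p q
    rw [inner_hermiteLp, ← gaussInt_hermiteR_mul_hermiteR p q, gaussInt_apply]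
    refine integral_congr_ae ?_
    filter_upwards [hH q] with x hx
    rw [hx, eval_mul]
  · intro p q
    rw [hcomp, ← h.integral_hermiteR]
    refine integral_congr_ae ?_
    filter_upwards [mX.quasiMeasurePreserving.ae_eq_comp (hH p),
      mY.quasiMeasurePreserving.ae_eq_comp (hH q)] with ω h1 h2
    simp only [Function.comp_apply] at h1 h2
    rw [h1, h2]

end Pair

/-! ### The random field -/

theorem continuous_sphericalHarmonic (l : ℕ) (m : ℤ) : Continuous (sphericalHarmonic l m) := by
  have hc : ∀ i : Fin 3, Continuous fun x : S2 => x.1 i := fun i => by fun_prop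
  have hrod : ∀ k, Continuous (rodrigues l k) := fun k =>
    continuous_iff_continuousAt.mpr fun t => (hasDerivAt_rodrigues l k t).continuousAt
  have h : ∀ k, Continuous (sphericalHarmonicNat l k) := by
    intro k
    unfold sphericalHarmonicNat
    have h0 := hc 0
    have h1 := hc 1
    have h2 := (hrod k).comp (hc 2)
    have h3 : Continuous fun x : S2 => ((rodrigues l k (x.1 2) : ℝ) : ℂ) :=
      Complex.continuous_ofReal.comp h2
    fun_prop
  unfold sphericalHarmonic
  split_ifs
  · exact h _
  · exact continuous_const.mul (Complex.continuous_conj.comp (h _))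

section Field

variable {Ω : Type*} {l : ℕ} {a : ℤ → Ω → ℂ}

theorem continuous_field (ω : Ω) : Continuous (field l a ω) :=
  Complex.continuous_re.comp (continuous_finsetSum _ fun m _ =>
    continuous_const.mul (continuous_sphericalHarmonic l m))

theorem field_congr {a' : ℤ → Ω → ℂ} {ω : Ω}
    (h : ∀ m ∈ Finset.Icc (-(l : ℤ)) (l : ℤ), a m ω = a' m ω) : field l a ω = field l a' ω := by
  ext x
  unfold field harmonicSum
  rw [Finset.sum_congr rfl fun m hm => by rw [h m hm]]

theorem supRemainder_congr {a' : ℤ → Ω → ℂ} {ω : Ω} (h : field l a ω = field l a' ω) :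
    supRemainder l a ω = supRemainder l a' ω := by
  simp only [supRemainder, remainder, empiricalProcess, empiricalMeasure, hermiteIntegral, h]

variable [MeasurableSpace Ω] {P : Measure Ω}

/-- A Gaussian law gives only almost everywhere measurable coefficients, whereas Fubini is applied
to a jointly measurable field. -/
theorem IsGaussianCoeff.exists_measurable (h : IsGaussianCoeff P l a) :
    ∃ a' : ℤ → Ω → ℂ, (∀ m, Measurable (a' m)) ∧ IsGaussianCoeff P l a' ∧
      ∀ᵐ ω ∂P, field l a ω = field l a' ω := by
  have hm : ∀ m ∈ Finset.Icc (-(l : ℤ)) (l : ℤ), AEMeasurable (a m) P := fun m hm =>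
    (h.gaussian.eval ⟨m, hm⟩).aemeasurable
  let a' : ℤ → Ω → ℂ := fun m =>
    if hm' : m ∈ Finset.Icc (-(l : ℤ)) (l : ℤ) then (hm m hm').mk (a m) else 0
  have heq : ∀ m ∈ Finset.Icc (-(l : ℤ)) (l : ℤ), a m =ᵐ[P] a' m := by
    intro m hm'
    simp only [a', dif_pos hm']
    exact (hm m hm').ae_eq_mk
  have hall : ∀ᵐ ω ∂P, ∀ m ∈ Finset.Icc (-(l : ℤ)) (l : ℤ), a m ω = a' m ω :=
    (Finset.eventually_all _).mpr heq
  refine ⟨a', fun m => ?_, ⟨?_, ?_, ?_, ?_⟩, ?_⟩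
  · by_cases hm' : m ∈ Finset.Icc (-(l : ℤ)) (l : ℤ)
    · simp only [a', dif_pos hm']
      exact (hm m hm').measurable_mk
    · simp only [a', dif_neg hm']
      exact measurable_zero
  · refine h.gaussian.congr ?_
    filter_upwards [hall] with ω hω
    ext m
    exact hω m.1 m.2
  · intro m hm'
    rw [← h.mean_zero m hm']
    exact integral_congr_ae (heq m hm').symm
  · intro m hm' m' hm''
    rw [← h.covariance m hm' m' hm'']
    refine integral_congr_ae ?_
    filter_upwards [heq m hm', heq m' hm''] with ω h1 h2
    rw [h1, h2]
  · intro m hm'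
    have hneg : -m ∈ Finset.Icc (-(l : ℤ)) (l : ℤ) := by rw [Finset.mem_Icc] at *; omega
    filter_upwards [h.symmetric m hm', heq m hm', heq (-m) hneg] with ω h0 h1 h2
    rw [← h1, ← h2, h0]
  · filter_upwards [hall] with ω hω
    exact field_congr hω

theorem measurable_field (ha : ∀ m, Measurable (a m)) :
    Measurable fun p : Ω × S2 => field l a p.1 p.2 := by
  refine Complex.measurable_re.comp (Finset.measurable_sum _ fun m _ => ?_)
  exact ((ha m).comp measurable_fst).mul
    ((continuous_sphericalHarmonic l m).measurable.comp measurable_snd)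

theorem IsGaussianCoeff.isGaussianPair_field [IsProbabilityMeasure P] (h : IsGaussianCoeff P l a)
    (x y : S2) :
    IsGaussianPair P (fun ω => field l a ω x) (fun ω => field l a ω y)
      ((legendre l).eval (inner ℝ x.1 y.1)) := by
  have hL2 : ∀ m ∈ Finset.Icc (-(l : ℤ)) (l : ℤ), MemLp (a m) 2 P := fun m hm =>
    (h.gaussian.eval ⟨m, hm⟩).memLp_two
  have hL1 : ∀ m ∈ Finset.Icc (-(l : ℤ)) (l : ℤ), Integrable (a m) P := fun m hm =>
    (hL2 m hm).integrable (by norm_num)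
  have hmean : ∀ x : S2, ∫ ω, field l a ω x ∂P = 0 := by
    intro x
    have hi : Integrable (fun ω => harmonicSum l a ω x) P :=
      integrable_finsetSum _ fun m hm => (hL1 m hm).mul_const _
    have e := Complex.reCLM.integral_comp_comm hi
    simp only [Complex.reCLM_apply] at e
    rw [show (∫ ω, field l a ω x ∂P) = ∫ ω, (harmonicSum l a ω x).re ∂P from rfl, e]
    simp only [harmonicSum]
    rw [integral_finsetSum _ fun m hm => (hL1 m hm).mul_const _]
    rw [Finset.sum_eq_zero, Complex.zero_re]
    intro m hm
    rw [integral_mul_const, h.mean_zero m hm, zero_mul]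
  have hcov : ∀ x y : S2, ∫ ω, field l a ω x * field l a ω y ∂P =
      (legendre l).eval (inner ℝ x.1 y.1) := by
    intro x y
    -- The symmetry makes the harmonic sum real almost surely; the conjugate brings the product into
    -- the form in which the covariances are prescribed.
    have hae : ∀ᵐ ω ∂P, field l a ω x * field l a ω y =
        (harmonicSum l a ω x * conj (harmonicSum l a ω y)).re := by
      have hsymm : ∀ᵐ ω ∂P, ∀ m ∈ Finset.Icc (-(l : ℤ)) (l : ℤ),
          a (-m) ω = (-1) ^ m.natAbs * conj (a m ω) := (Finset.eventually_all _).mpr h.symmetric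
      filter_upwards [hsymm] with ω hω
      simp [field, Complex.mul_re, harmonicSum_im l a ω x hω]
    have hterm : ∀ ω, harmonicSum l a ω x * conj (harmonicSum l a ω y) =
        ∑ m ∈ Finset.Icc (-(l : ℤ)) (l : ℤ), ∑ m' ∈ Finset.Icc (-(l : ℤ)) (l : ℤ),
          (a m ω * conj (a m' ω)) *
            (sphericalHarmonic l m x * conj (sphericalHarmonic l m' y)) := by
      intro ω
      simp only [harmonicSum, map_sum, map_mul, Finset.sum_mul_sum]
      refine Finset.sum_congr rfl fun m _ => Finset.sum_congr rfl fun m' _ => by ring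
    have hi : ∀ m ∈ Finset.Icc (-(l : ℤ)) (l : ℤ), ∀ m' ∈ Finset.Icc (-(l : ℤ)) (l : ℤ),
        Integrable (fun ω => (a m ω * conj (a m' ω)) *
          (sphericalHarmonic l m x * conj (sphericalHarmonic l m' y))) P := fun m hm m' hm' =>
      ((hL2 m hm).integrable_mul (hL2 m' hm').star).mul_const _
    have hI : Integrable (fun ω => harmonicSum l a ω x * conj (harmonicSum l a ω y)) P := by
      simp only [hterm]
      exact integrable_finsetSum _ fun m hm => integrable_finsetSum _ fun m' hm' => hi m hm m' hm'
    have e := Complex.reCLM.integral_comp_comm hI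
    simp only [Complex.reCLM_apply] at e
    rw [integral_congr_ae hae, e]
    simp only [hterm]
    rw [integral_finsetSum _ fun m hm => integrable_finsetSum _ fun m' hm' => hi m hm m' hm']
    have hin : ∀ m ∈ Finset.Icc (-(l : ℤ)) (l : ℤ),
        ∫ ω, ∑ m' ∈ Finset.Icc (-(l : ℤ)) (l : ℤ), (a m ω * conj (a m' ω)) *
            (sphericalHarmonic l m x * conj (sphericalHarmonic l m' y)) ∂P =
        ((4 * Real.pi / (2 * (l : ℝ) + 1) : ℝ) : ℂ) *
          (sphericalHarmonic l m x * conj (sphericalHarmonic l m y)) := by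
      intro m hm
      rw [integral_finsetSum _ fun m' hm' => hi m hm m' hm', Finset.sum_eq_single_of_mem m hm]
      · rw [integral_mul_const, h.covariance m hm m hm, if_pos rfl]
      · intro m' hm' hne
        rw [integral_mul_const, h.covariance m hm m' hm', if_neg hne.symm, zero_mul]
    rw [Finset.sum_congr rfl hin, ← Finset.mul_sum, Complex.re_ofReal_mul,
      sum_sphericalHarmonic_mul_conj]
    have : (2 * (l : ℝ) + 1) ≠ 0 := by positivity
    have := Real.pi_pos.ne'
    field_simp
  have hself : ∀ x : S2, (legendre l).eval (inner ℝ x.1 x.1) = 1 := by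
    intro x
    have hx : ‖x.1‖ = 1 := by simp
    rw [real_inner_self_eq_norm_sq, hx, one_pow, eval_one_legendre]
  refine ⟨?_, hmean x, hmean y, (hcov x x).trans (hself x), (hcov y y).trans (hself y), hcov x y⟩
  -- Joint Gaussianity: the pair of field values is a real-linear image of the coefficient vector.
  let F : S2 → (Finset.Icc (-(l : ℤ)) (l : ℤ) → ℂ) →ₗ[ℝ] ℝ := fun x =>
    { toFun := fun v => (∑ m, v m * sphericalHarmonic l m.1 x).re
      map_add' := fun v w => by simp [add_mul, Finset.sum_add_distrib]
      map_smul' := fun c v => by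
        simp [mul_assoc]
        rw [← Finset.mul_sum, Finset.sum_sub_distrib] }
  have hF : ∀ x ω, field l a ω x = F x (fun m => a m.1 ω) := by
    intro x ω
    change (∑ m ∈ Finset.Icc (-(l : ℤ)) (l : ℤ), a m ω * sphericalHarmonic l m x).re =
      (∑ m : Finset.Icc (-(l : ℤ)) (l : ℤ), a m.1 ω * sphericalHarmonic l m.1 x).re
    rw [Finset.sum_coe_sort (Finset.Icc (-(l : ℤ)) (l : ℤ))
      (fun m => a m ω * sphericalHarmonic l m x)]
  have := h.gaussian.map_fun (((F x).toContinuousLinearMap).prod ((F y).toContinuousLinearMap))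
  refine this.congr (Filter.Eventually.of_forall fun ω => ?_)
  simp [hF]

end Field

/-! ### Second moments of sphere integrals of the field -/

section Moments

variable {Ω : Type*} [MeasurableSpace Ω] {P : Measure Ω} [IsProbabilityMeasure P] {l : ℕ}
  {a : ℤ → Ω → ℂ}

theorem memLp_comp_field (ha : ∀ m, Measurable (a m)) (h : IsGaussianCoeff P l a) {ψ : ℝ → ℝ}
    (hm : Measurable ψ) (hψ : MemLp ψ 2 (gaussianReal 0 1)) {T : Type*} [MeasurableSpace T]
    {τ : Measure T} [IsFiniteMeasure τ] {g : T → S2} (hg : Measurable g) :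
    MemLp (fun p : Ω × T => ψ (field l a p.1 (g p.2))) 2 (P.prod τ) := by
  have hmeas : Measurable fun p : Ω × T => ψ (field l a p.1 (g p.2)) :=
    hm.comp ((measurable_field ha).comp (measurable_fst.prodMk (hg.comp measurable_snd)))
  rw [memLp_two_iff_integrable_sq hmeas.aestronglyMeasurable,
    integrable_prod_iff' (hmeas.pow_const 2).aestronglyMeasurable]
  have hmp : ∀ x : S2, MeasurePreserving (fun ω => field l a ω x) P (gaussianReal 0 1) := fun x =>
    ⟨(measurable_field ha).comp (measurable_id.prodMk measurable_const),
      (h.isGaussianPair_field x x).map_left⟩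
  have hsq : Integrable (fun u => ψ u ^ 2) (gaussianReal 0 1) := hψ.integrable_sq
  refine ⟨Filter.Eventually.of_forall fun t => ?_, ?_⟩
  · exact (hmp (g t)).integrable_comp_of_integrable hsq
  · have e : ∀ t, ∫ ω, ‖ψ (field l a ω (g t)) ^ 2‖ ∂P = ∫ u, ψ u ^ 2 ∂gaussianReal 0 1 := by
      intro t
      rw [← (hmp (g t)).map_eq, integral_map (hmp (g t)).measurable.aemeasurable
        (by exact (hm.pow_const 2).aestronglyMeasurable)]
      simp
    simp only [e]
    exact integrable_const _

theorem integral_sq_sphere_integral (ha : ∀ m, Measurable (a m)) (h : IsGaussianCoeff P l a)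
    {ψ : ℝ → ℝ} (hm : Measurable ψ) (hψ : MemLp ψ 2 (gaussianReal 0 1)) :
    ∫ ω, (∫ x, ψ (field l a ω x) ∂surf) ^ 2 ∂P =
        ∫ p : S2 × S2, ∫ ω, ψ (field l a ω p.1) * ψ (field l a ω p.2) ∂P ∂(surf.prod surf) ∧
      Integrable (fun p : S2 × S2 => ∫ ω, ψ (field l a ω p.1) * ψ (field l a ω p.2) ∂P)
        (surf.prod surf) ∧ Integrable (fun ω => (∫ x, ψ (field l a ω x) ∂surf) ^ 2) P := by
  have hG : Integrable (Function.uncurry fun (ω : Ω) (p : S2 × S2) =>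
      ψ (field l a ω p.1) * ψ (field l a ω p.2)) (P.prod (surf.prod surf)) :=
    (memLp_comp_field ha h hm hψ (τ := surf.prod surf) measurable_fst).integrable_mul
      (memLp_comp_field ha h hm hψ (τ := surf.prod surf) measurable_snd)
  have e : ∀ ω, (∫ x, ψ (field l a ω x) ∂surf) ^ 2 =
      ∫ p : S2 × S2, ψ (field l a ω p.1) * ψ (field l a ω p.2) ∂(surf.prod surf) := by
    intro ω
    rw [integral_prod_mul (fun x => ψ (field l a ω x)) (fun x => ψ (field l a ω x)), pow_two]
  simp only [e]
  exact ⟨integral_integral_swap hG, hG.integral_prod_right, hG.integral_prod_left⟩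

theorem integrable_eval_inner (p : ℝ[X]) :
    Integrable (fun q : S2 × S2 => p.eval (inner ℝ q.1.1 q.2.1)) (surf.prod surf) := by
  apply Continuous.integrable_of_hasCompactSupport
  · exact p.continuous.comp (by fun_prop)
  · exact HasCompactSupport.of_compactSpace _

theorem integral_eval_inner (p : ℝ[X]) :
    ∫ q : S2 × S2, p.eval (inner ℝ q.1.1 q.2.1) ∂(surf.prod surf) =
      8 * Real.pi ^ 2 * intervalInt p := by
  rw [integral_prod_symm _ (integrable_eval_inner p)]
  have e : ∀ y : S2, ∫ x : S2, p.eval (inner ℝ x.1 y.1) ∂surf = 2 * Real.pi * intervalInt p :=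
    fun y => integral_zonal_surf (by simp) p
  simp only [e]
  rw [integral_const, surf_real_univ, smul_eq_mul]
  ring

/-- Cauchy-Schwarz, with `‖H_q‖² = q!`. -/
theorem sq_integral_hermiteR_mul_le {ψ : ℝ → ℝ} (hψ : MemLp ψ 2 (gaussianReal 0 1)) (q : ℕ) :
    (∫ u, (hermiteR q).eval u * ψ u ∂gaussianReal 0 1) ^ 2 ≤
      q.factorial * ∫ u, ψ u ^ 2 ∂gaussianReal 0 1 := by
  have hcs := real_inner_mul_inner_self_le (hermiteLp q) (hψ.toLp ψ)
  have hc := hψ.coeFn_toLp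
  have e1 : inner ℝ (hermiteLp q) (hψ.toLp ψ) =
      ∫ u, (hermiteR q).eval u * ψ u ∂gaussianReal 0 1 := by
    rw [inner_hermiteLp]
    refine integral_congr_ae ?_
    filter_upwards [hc] with x hx
    rw [hx]
  have e2 : inner ℝ (hermiteLp q) (hermiteLp q) = (q.factorial : ℝ) := by
    have := gaussInt_hermiteR_mul_hermiteR q q
    rw [inner_hermiteLp]
    simp only [gaussInt_apply, eval_mul, if_true] at this
    rw [← this]
    refine integral_congr_ae ?_
    filter_upwards [(memLp_eval_gaussianReal (hermiteR q)).coeFn_toLp] with x hx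
    rw [hermiteLp, hx]
  have e3 : inner ℝ (hψ.toLp ψ) (hψ.toLp ψ) = ∫ u, ψ u ^ 2 ∂gaussianReal 0 1 := by
    rw [L2.inner_def]
    refine integral_congr_ae ?_
    filter_upwards [hc] with x hx
    rw [hx]
    simp [pow_two]
  rw [e1, e2, e3] at hcs
  rwa [pow_two]

theorem cube_add_four_bound {c N I J L s : ℝ} (hs : 0 ≤ s) (hL : 0 ≤ L) (hN : 0 ≤ N)
    (hc : 0 ≤ c) (hcN : c ≤ 6 * N) (hI : I ≤ 2 / s) (hJ : J ≤ 6 * (1 + L) / s) :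
    8 * Real.pi ^ 2 * (c / 6 * I + N * J) ≤ 64 * Real.pi ^ 2 * (1 + L) / s * N := by
  have t1 : c / 6 * I ≤ N * (2 / s) := by
    refine (mul_le_mul_of_nonneg_left hI (by positivity)).trans ?_
    exact mul_le_mul_of_nonneg_right (by linarith) (by positivity)
  have t2 : N * J ≤ N * (6 * (1 + L) / s) := mul_le_mul_of_nonneg_left hJ hN
  calc 8 * Real.pi ^ 2 * (c / 6 * I + N * J)
      ≤ 8 * Real.pi ^ 2 * (N * (2 / s) + N * (6 * (1 + L) / s)) :=
        mul_le_mul_of_nonneg_left (add_le_add t1 t2) (by positivity)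
    _ = 8 * Real.pi ^ 2 * (8 + 6 * L) / s * N := by ring
    _ ≤ 64 * Real.pi ^ 2 * (1 + L) / s * N := by
        refine mul_le_mul_of_nonneg_right ?_ hN
        apply div_le_div_of_nonneg_right _ hs
        nlinarith [sq_nonneg Real.pi, mul_nonneg (sq_nonneg Real.pi) hL]

/-- The expansion of `E ψ(f_l(x)) ψ(f_l(y))` is cut at order 4. Orders 0 and 2 vanish by hypothesis,
order 1 integrates to zero, and order 3 and the tail are controlled by the third and fourth moments
of `P_l`. -/
theorem integral_sq_sphere_integral_le (hl : 1 ≤ l) (ha : ∀ m, Measurable (a m))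
    (h : IsGaussianCoeff P l a) {ψ : ℝ → ℝ} (hm : Measurable ψ)
    (hψ : MemLp ψ 2 (gaussianReal 0 1)) (h0 : ∫ u, ψ u ∂gaussianReal 0 1 = 0)
    (h2 : ∫ u, (hermiteR 2).eval u * ψ u ∂gaussianReal 0 1 = 0) :
    ∫ ω, (∫ x, ψ (field l a ω x) ∂surf) ^ 2 ∂P ≤
      64 * Real.pi ^ 2 * (1 + Real.log l) / (l : ℝ) ^ 2 * ∫ u, ψ u ^ 2 ∂gaussianReal 0 1 := by
  have hl' : (1 : ℝ) ≤ l := by exact_mod_cast hl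
  obtain ⟨e, hi, -⟩ := integral_sq_sphere_integral ha h hm hψ
  have hN0 : 0 ≤ ∫ u, ψ u ^ 2 ∂gaussianReal 0 1 := integral_nonneg fun u => sq_nonneg _
  have hc3 := sq_integral_hermiteR_mul_le hψ 3
  rw [show ((Nat.factorial 3 : ℕ) : ℝ) = 6 by norm_num [Nat.factorial]] at hc3
  have hpair : ∀ p : S2 × S2, |∫ ω, ψ (field l a ω p.1) * ψ (field l a ω p.2) ∂P -
      ∑ q ∈ Finset.range 4, (∫ x, (hermiteR q).eval x * ψ x ∂gaussianReal 0 1) ^ 2 *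
        (legendre l).eval (inner ℝ p.1.1 p.2.1) ^ q / (q.factorial : ℝ)| ≤
      |(legendre l).eval (inner ℝ p.1.1 p.2.1)| ^ 4 * ∫ x, ψ x ^ 2 ∂gaussianReal 0 1 := by
    intro p
    have hmeas : ∀ x : S2, Measurable fun ω => field l a ω x := fun x =>
      (measurable_field ha).comp (measurable_id.prodMk measurable_const)
    exact (h.isGaussianPair_field p.1 p.2).abs_integral_sub_le (hmeas _) (hmeas _) hψ 4
  simp only [Finset.sum_range_succ, Finset.sum_range_zero, h2, hermiteR_zero, eval_one, one_mul,
    h0] at hpair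
  generalize ∫ u, ψ u ^ 2 ∂gaussianReal 0 1 = N at *
  generalize ∫ u, (hermiteR 1).eval u * ψ u ∂gaussianReal 0 1 = c1 at *
  generalize ∫ u, (hermiteR 3).eval u * ψ u ∂gaussianReal 0 1 = c3 at *
  have hpt : ∀ p : S2 × S2, ∫ ω, ψ (field l a ω p.1) * ψ (field l a ω p.2) ∂P ≤
      (C (c1 ^ 2) * legendre l + C (c3 ^ 2 / 6) * legendre l ^ 3 + C N * legendre l ^ 4).eval
        (inner ℝ p.1.1 p.2.1) := by
    intro p
    have hb' := (abs_le.mp (hpair p)).2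
    rw [Even.pow_abs (by decide)] at hb'
    simp only [eval_add, eval_mul, eval_C, eval_pow]
    norm_num [Nat.factorial] at hb'
    linarith
  rw [e]
  refine (integral_mono hi (integrable_eval_inner _) hpt).trans ?_
  rw [integral_eval_inner, map_add, map_add, intervalInt_C_mul, intervalInt_C_mul,
    intervalInt_C_mul]
  have hP1 : intervalInt (legendre l) = 0 := by
    have := intervalInt_legendre_mul_legendre (m := l) (n := 0) (by omega)
    rwa [legendre_zero, mul_one] at this
  rw [hP1, mul_zero, zero_add]
  exact cube_add_four_bound (by positivity) (Real.log_nonneg hl') hN0 (sq_nonneg c3) hc3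
    (abs_le.mp (abs_intervalInt_legendre_cube_le hl)).2 (intervalInt_legendre_four_le hl)

/-- Here the covariance is exactly `2 P_l²`. The bound enters only through the discretization error
inside a cell. -/
theorem integral_sq_hermiteIntegral_two_le (hl : 1 ≤ l) (ha : ∀ m, Measurable (a m))
    (h : IsGaussianCoeff P l a) :
    Integrable (fun ω => hermiteIntegral l a 2 ω ^ 2) P ∧
      ∫ ω, hermiteIntegral l a 2 ω ^ 2 ∂P ≤ 16 * Real.pi ^ 2 / l := by
  have hl' : (1 : ℝ) ≤ l := by exact_mod_cast hl
  obtain ⟨e, -, hi⟩ := integral_sq_sphere_integral ha h (hermiteR 2).continuous.measurable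
    (memLp_eval_gaussianReal (hermiteR 2))
  simp only [hermiteIntegral, aeval_hermite]
  refine ⟨hi, ?_⟩
  have e2 : ∀ p : S2 × S2, ∫ ω, (hermiteR 2).eval (field l a ω p.1) *
      (hermiteR 2).eval (field l a ω p.2) ∂P =
      (C 2 * (legendre l * legendre l)).eval (inner ℝ p.1.1 p.2.1) := by
    intro p
    rw [(h.isGaussianPair_field p.1 p.2).integral_hermiteR 2 2]
    simp [pow_two]
  rw [e]
  simp only [e2]
  rw [integral_eval_inner, intervalInt_C_mul, intervalInt_legendre_sq]
  have : 8 * Real.pi ^ 2 * (2 * (2 / (2 * (l : ℝ) + 1))) = 32 * Real.pi ^ 2 / (2 * l + 1) := by ring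
  rw [this, div_le_div_iff₀ (by positivity) (by positivity)]
  nlinarith [sq_nonneg Real.pi]

end Moments

/-! ### The remainder as a set function -/

theorem integral_sub_sub {T : Type*} [MeasurableSpace T] {τ : Measure T} {f g h : T → ℝ}
    (hf : Integrable f τ) (hg : Integrable g τ) (hh : Integrable h τ) :
    ∫ x, f x - g x - h x ∂τ = ∫ x, f x ∂τ - ∫ x, g x ∂τ - ∫ x, h x ∂τ := by
  have hfg : Integrable (fun x => f x - g x) τ := hf.sub hg
  rw [integral_sub hfg hh, integral_sub hf hg]

/-- The function `-x φ(x)` is an antiderivative of `φ(x) H₂(x)` that tends to zero at minus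
infinity. -/
theorem integral_hermiteR_two_Iic (z : ℝ) :
    ∫ u in Set.Iic z, (hermiteR 2).eval u ∂gaussianReal 0 1 = J2 z := by
  have hd : ∀ x : ℝ, HasDerivAt (fun x => -x * gaussianPDFReal 0 1 x)
      (gaussianPDFReal 0 1 x * (hermiteR 2).eval x) x := by
    intro x
    refine ((hasDerivAt_neg x).fun_mul (hasDerivAt_gaussianPDFReal x)).congr_deriv ?_
    rw [hermiteR_two]
    simp
    ring
  have hi1 : Integrable (fun x => gaussianPDFReal 0 1 x * (hermiteR 2).eval x) :=
    integrable_gaussianPDFReal_mul_eval _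
  have hi2 : Integrable (fun x => -x * gaussianPDFReal 0 1 x) := by
    have := integrable_gaussianPDFReal_mul_eval (-X)
    simpa [mul_comm] using this
  have ht := tendsto_zero_of_hasDerivAt_of_integrableOn_Iic (a := z) (fun x _ => hd x)
    hi1.integrableOn hi2.integrableOn
  have := integral_Iic_of_hasDerivAt_of_tendsto' (fun x _ => hd x) (hi1.integrableOn (s := Set.Iic z)) ht
  rw [J2, ← sub_zero (-z * _), ← this, gaussianReal_of_var_ne_zero 0 one_ne_zero,
    setIntegral_withDensity_eq_setIntegral_toReal_smul (measurable_gaussianPDF 0 1)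
      (Filter.Eventually.of_forall fun _ => gaussianPDF_lt_top) _ measurableSet_Iic]
  simp [toReal_gaussianPDF]

theorem continuous_cdf_gaussianReal : Continuous (cdf (gaussianReal 0 1)) := by
  rw [continuous_iff_continuousAt]
  intro x
  rw [(monotone_cdf _).continuousAt_iff_leftLim_eq_rightLim, StieltjesFunction.rightLim_eq]
  have h := (cdf (gaussianReal 0 1)).measure_singleton x
  have := nullSingletonClass_gaussianReal (μ := 0) (v := 1) one_ne_zero
  rw [measure_cdf, measure_singleton, eq_comm, ENNReal.ofReal_eq_zero] at h
  exact le_antisymm ((monotone_cdf _).leftLim_le le_rfl) (by linarith)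

theorem strictMono_cdf_gaussianReal : StrictMono (cdf (gaussianReal 0 1)) := by
  intro x y hxy
  have h : gaussianReal 0 1 (Set.Ioc x y) ≠ 0 := by
    intro h0
    have := gaussianReal_absolutelyContinuous' 0 one_ne_zero h0
    rw [Real.volume_Ioc, ENNReal.ofReal_eq_zero] at this
    linarith
  rw [← measure_cdf (gaussianReal 0 1), StieltjesFunction.measure_Ioc] at h
  by_contra hle
  exact h (ENNReal.ofReal_eq_zero.mpr (by linarith))

theorem cdf_gaussianReal_pos (x : ℝ) : 0 < cdf (gaussianReal 0 1) x :=
  (cdf_nonneg _ (x - 1)).trans_lt (strictMono_cdf_gaussianReal (by linarith))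

theorem cdf_gaussianReal_lt_one (x : ℝ) : cdf (gaussianReal 0 1) x < 1 :=
  (strictMono_cdf_gaussianReal (by linarith)).trans_le (cdf_le_one _ (x + 1))

/-- The set of reals at which the Gaussian distribution function is at most `p`. -/
def cdfSublevel (p : ℝ) : Set ℝ := {x | cdf (gaussianReal 0 1) x ≤ p}

theorem measurableSet_cdfSublevel (p : ℝ) : MeasurableSet (cdfSublevel p) :=
  measurableSet_le (monotone_cdf _).measurable measurable_const

theorem cdfSublevel_mono {p q : ℝ} (h : p ≤ q) : cdfSublevel p ⊆ cdfSublevel q :=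
  fun _ hx => le_trans hx h

theorem cdfSublevel_zero : cdfSublevel 0 = ∅ :=
  Set.eq_empty_of_forall_notMem fun x hx => absurd (cdf_gaussianReal_pos x) (not_lt.mpr hx)

/-- Sublevel sets parametrize half lines by their mass. The values 0 and 1 are not attained by the
distribution function and correspond to the empty set and the whole line, so the grid needs no
infinite endpoints. -/
theorem gaussianReal_real_cdfSublevel {p : ℝ} (h0 : 0 ≤ p) (h1 : p ≤ 1) :
    (gaussianReal 0 1).real (cdfSublevel p) = p := by
  rcases h0.eq_or_lt with rfl | h0
  · simp [cdfSublevel_zero]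
  rcases h1.eq_or_lt with rfl | h1
  · have : cdfSublevel 1 = Set.univ := Set.eq_univ_of_forall fun x => cdf_le_one _ x
    simp [this]
  · obtain ⟨x, hx⟩ : ∃ x, cdf (gaussianReal 0 1) x = p := by
      obtain ⟨u, hu⟩ := ((tendsto_cdf_atBot (gaussianReal 0 1)).eventually_lt_const h0).exists
      obtain ⟨v, hv⟩ := ((tendsto_cdf_atTop (gaussianReal 0 1)).eventually_const_lt h1).exists
      exact mem_range_of_exists_le_of_exists_ge continuous_cdf_gaussianReal ⟨u, hu.le⟩ ⟨v, hv.le⟩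
    have : cdfSublevel p = Set.Iic x := by
      ext y
      simp [cdfSublevel, ← hx, strictMono_cdf_gaussianReal.le_iff_le]
    rw [this, ← cdf_eq_real, hx]

theorem gaussianReal_real_cdfSublevel_diff {p q : ℝ} (h0 : 0 ≤ p) (hpq : p ≤ q) (h1 : q ≤ 1) :
    (gaussianReal 0 1).real (cdfSublevel q \ cdfSublevel p) = q - p := by
  rw [measureReal_sdiff (cdfSublevel_mono hpq) (measurableSet_cdfSublevel p),
    gaussianReal_real_cdfSublevel (h0.trans hpq) h1, gaussianReal_real_cdfSublevel h0 (hpq.trans h1)]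

/-- The coefficient of `H₂` in the Hermite expansion of the indicator of `B`, times `2`. -/
def secondMoment (B : Set ℝ) : ℝ := ∫ u in B, (hermiteR 2).eval u ∂gaussianReal 0 1

theorem memLp_indicator_gaussianReal {B : Set ℝ} (hB : MeasurableSet B) :
    MemLp (B.indicator fun _ => (1 : ℝ)) 2 (gaussianReal 0 1) :=
  memLp_indicator_const 2 hB 1 (Or.inr (measure_ne_top _ _))

theorem integral_hermiteR_two_mul_indicator {B : Set ℝ} (hB : MeasurableSet B) :
    ∫ u, (hermiteR 2).eval u * B.indicator (fun _ => (1 : ℝ)) u ∂gaussianReal 0 1 =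
      secondMoment B := by
  rw [secondMoment, ← integral_indicator hB]
  congr 1
  ext u
  by_cases hu : u ∈ B <;> simp [hu]

theorem integral_indicator_one_gaussianReal {B : Set ℝ} (hB : MeasurableSet B) :
    ∫ u, B.indicator (fun _ => (1 : ℝ)) u ∂gaussianReal 0 1 = (gaussianReal 0 1).real B := by
  rw [integral_indicator hB]
  simp

theorem sq_secondMoment_le {B : Set ℝ} (hB : MeasurableSet B) :
    secondMoment B ^ 2 ≤ 2 * (gaussianReal 0 1).real B := by
  have := sq_integral_hermiteR_mul_le (memLp_indicator_gaussianReal hB) 2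
  rw [integral_hermiteR_two_mul_indicator hB] at this
  refine this.trans_eq ?_
  rw [← integral_indicator_one_gaussianReal hB]
  congr 1
  congr 1
  ext u
  by_cases hu : u ∈ B <;> simp [hu]

/-- The indicator of `B` minus its Hermite components of orders `0` and `2`. -/
def centeredIndicator (B : Set ℝ) (u : ℝ) : ℝ :=
  B.indicator (fun _ => (1 : ℝ)) u - (gaussianReal 0 1).real B -
    secondMoment B / 2 * (hermiteR 2).eval u

theorem measurable_centeredIndicator {B : Set ℝ} (hB : MeasurableSet B) :
    Measurable (centeredIndicator B) :=
  ((measurable_const.indicator hB).sub measurable_const).sub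
    ((hermiteR 2).continuous.measurable.const_mul _)

theorem memLp_centeredIndicator {B : Set ℝ} (hB : MeasurableSet B) :
    MemLp (centeredIndicator B) 2 (gaussianReal 0 1) :=
  ((memLp_indicator_gaussianReal hB).sub (memLp_const _)).sub
    ((memLp_eval_gaussianReal _).const_mul _)

theorem integral_hermiteR_two : ∫ u, (hermiteR 2).eval u ∂gaussianReal 0 1 = 0 := by
  have := gaussInt_hermiteR_mul_hermiteR 2 0
  rw [hermiteR_zero, mul_one, gaussInt_apply] at this
  simpa using this

theorem integral_centeredIndicator {B : Set ℝ} (hB : MeasurableSet B) :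
    ∫ u, centeredIndicator B u ∂gaussianReal 0 1 = 0 := by
  have h1 := (memLp_indicator_gaussianReal hB).integrable one_le_two
  have h2 := (integrable_eval_gaussianReal (hermiteR 2)).const_mul (secondMoment B / 2)
  simp only [centeredIndicator]
  rw [integral_sub_sub h1 (integrable_const _) h2,
    integral_indicator_one_gaussianReal hB, integral_const_mul, integral_hermiteR_two]
  simp

theorem integral_hermiteR_two_mul_centeredIndicator {B : Set ℝ} (hB : MeasurableSet B) :
    ∫ u, (hermiteR 2).eval u * centeredIndicator B u ∂gaussianReal 0 1 = 0 := by
  have h1 : Integrable (fun u => (hermiteR 2).eval u * B.indicator (fun _ => (1 : ℝ)) u)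
      (gaussianReal 0 1) :=
    (memLp_eval_gaussianReal (hermiteR 2)).integrable_mul (memLp_indicator_gaussianReal hB)
  have h2 := (integrable_eval_gaussianReal (hermiteR 2)).const_mul ((gaussianReal 0 1).real B)
  have h3 := (integrable_eval_gaussianReal (hermiteR 2 * hermiteR 2)).const_mul (secondMoment B / 2)
  have h4 := gaussInt_hermiteR_mul_hermiteR 2 2
  rw [gaussInt_apply] at h4
  have e : ∀ u, (hermiteR 2).eval u * centeredIndicator B u =
      (hermiteR 2).eval u * B.indicator (fun _ => (1 : ℝ)) u -
        (gaussianReal 0 1).real B * (hermiteR 2).eval u -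
        secondMoment B / 2 * (hermiteR 2 * hermiteR 2).eval u := by
    intro u
    rw [centeredIndicator, eval_mul]
    ring
  simp only [e]
  rw [integral_sub_sub h1 h2 h3, integral_const_mul, integral_const_mul,
    integral_hermiteR_two_mul_indicator hB, integral_hermiteR_two, h4]
  norm_num [Nat.factorial]

/-- An orthogonal projection does not increase the norm. Pointwise, with `b = ψ + h` the indicator
and `h` its removed part, `ψ² ≤ b² - 2 h ψ` and `b² = b`; the cross terms integrate to zero. -/
theorem integral_sq_centeredIndicator_le {B : Set ℝ} (hB : MeasurableSet B) :
    ∫ u, centeredIndicator B u ^ 2 ∂gaussianReal 0 1 ≤ (gaussianReal 0 1).real B := by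
  have hc := memLp_centeredIndicator hB
  have h1 := hc.integrable one_le_two
  have h2 : Integrable (fun u => (hermiteR 2).eval u * centeredIndicator B u) (gaussianReal 0 1) :=
    (memLp_eval_gaussianReal (hermiteR 2)).integrable_mul hc
  have hi : Integrable (B.indicator fun _ => (1 : ℝ)) (gaussianReal 0 1) :=
    (memLp_indicator_gaussianReal hB).integrable one_le_two
  have h3 : Integrable (fun u => centeredIndicator B u ^ 2) (gaussianReal 0 1) := hc.integrable_sq
  have e : ∀ u, centeredIndicator B u ^ 2 ≤ B.indicator (fun _ => (1 : ℝ)) u -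
      2 * (gaussianReal 0 1).real B * centeredIndicator B u -
      secondMoment B * ((hermiteR 2).eval u * centeredIndicator B u) := by
    intro u
    have hs : B.indicator (fun _ => (1 : ℝ)) u ^ 2 = B.indicator (fun _ => (1 : ℝ)) u := by
      by_cases hu : u ∈ B <;> simp [hu]
    have hu : centeredIndicator B u = B.indicator (fun _ => (1 : ℝ)) u -
      (gaussianReal 0 1).real B - secondMoment B / 2 * (hermiteR 2).eval u := rfl
    generalize B.indicator (fun _ => (1 : ℝ)) u = b at *
    generalize (gaussianReal 0 1).real B = g at *
    generalize (hermiteR 2).eval u = w at *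
    rw [hu]
    nlinarith [sq_nonneg (g + secondMoment B / 2 * w)]
  refine (integral_mono h3 ((hi.sub (h1.const_mul _)).sub (h2.const_mul _)) e).trans_eq ?_
  simp only [Pi.sub_apply]
  rw [integral_sub_sub hi (h1.const_mul _) (h2.const_mul _),
    integral_const_mul, integral_const_mul, integral_centeredIndicator hB,
    integral_hermiteR_two_mul_centeredIndicator hB, integral_indicator_one_gaussianReal hB]
  simp

section SetRemainder

variable {Ω : Type*} (l : ℕ) (a : ℤ → Ω → ℂ)

/-- The extension of `remainder` from half lines to Borel sets, see `remainder_eq_setRemainder`. -/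
def setRemainder (ω : Ω) (B : Set ℝ) : ℝ :=
  Real.sqrt l * (surf.real {x | field l a ω x ∈ B} - 4 * Real.pi * (gaussianReal 0 1).real B -
    secondMoment B / 2 * hermiteIntegral l a 2 ω)

theorem remainder_eq_setRemainder (ω : Ω) (z : ℝ) :
    remainder l a ω z = setRemainder l a ω (Set.Iic z) := by
  rw [remainder, setRemainder, empiricalProcess, empiricalMeasure, secondMoment,
    integral_hermiteR_two_Iic, cdf_eq_real]
  simp only [Set.mem_Iic]
  ring

theorem secondMoment_sdiff {A B : Set ℝ} (hA : MeasurableSet A) (hAB : A ⊆ B) :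
    secondMoment (B \ A) = secondMoment B - secondMoment A :=
  setIntegral_sdiff hA (integrable_eval_gaussianReal _).integrableOn hAB

theorem setRemainder_sdiff (ω : Ω) {A B : Set ℝ} (hA : MeasurableSet A) (hAB : A ⊆ B) :
    setRemainder l a ω (B \ A) = setRemainder l a ω B - setRemainder l a ω A := by
  have hm : MeasurableSet {x | field l a ω x ∈ A} := (continuous_field ω).measurable hA
  have hs : {x | field l a ω x ∈ A} ⊆ {x | field l a ω x ∈ B} := fun x hx => hAB hx
  have e : {x | field l a ω x ∈ B \ A} = {x | field l a ω x ∈ B} \ {x | field l a ω x ∈ A} := rfl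
  rw [setRemainder, setRemainder, setRemainder, secondMoment_sdiff hA hAB, e,
    measureReal_sdiff hs hm, measureReal_sdiff hAB hA]
  ring

theorem setRemainder_eq_integral (ω : Ω) {B : Set ℝ} (hB : MeasurableSet B) :
    setRemainder l a ω B = Real.sqrt l * ∫ x, centeredIndicator B (field l a ω x) ∂surf := by
  have hf := continuous_field (l := l) (a := a) ω
  have hm : MeasurableSet {x | field l a ω x ∈ B} := hf.measurable hB
  have h1 : Integrable (fun x => B.indicator (fun _ => (1 : ℝ)) (field l a ω x)) surf := by
    have : (fun x => B.indicator (fun _ => (1 : ℝ)) (field l a ω x)) =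
      {x | field l a ω x ∈ B}.indicator fun _ => (1 : ℝ) := rfl
    rw [this]
    exact (integrable_const _).indicator hm
  have h2 : Integrable (fun x => (hermiteR 2).eval (field l a ω x)) surf := by
    apply Continuous.integrable_of_hasCompactSupport
    · exact (hermiteR 2).continuous.comp hf
    · exact HasCompactSupport.of_compactSpace _
  have e : ∫ x, B.indicator (fun _ => (1 : ℝ)) (field l a ω x) ∂surf =
      surf.real {x | field l a ω x ∈ B} := by
    have : (fun x => B.indicator (fun _ => (1 : ℝ)) (field l a ω x)) =
      {x | field l a ω x ∈ B}.indicator fun _ => (1 : ℝ) := rfl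
    rw [this, integral_indicator hm]
    simp
  simp only [centeredIndicator]
  rw [integral_sub_sub h1 (integrable_const _) (h2.const_mul _), integral_const_mul, e, integral_const, surf_real_univ,
    setRemainder, hermiteIntegral]
  simp only [aeval_hermite, smul_eq_mul]

/-- The linear dependence on the Gaussian mass of `B` is essential: the bounds over the cells of one
dyadic scale then add up to that of the whole line. -/
theorem integral_sq_setRemainder_le [MeasurableSpace Ω] {P : Measure Ω} [IsProbabilityMeasure P]
    {l : ℕ} {a : ℤ → Ω → ℂ} (hl : 1 ≤ l) (ha : ∀ m, Measurable (a m)) (h : IsGaussianCoeff P l a)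
    {B : Set ℝ} (hB : MeasurableSet B) :
    Integrable (fun ω => setRemainder l a ω B ^ 2) P ∧
    ∫ ω, setRemainder l a ω B ^ 2 ∂P ≤
      64 * Real.pi ^ 2 * (1 + Real.log l) / l * (gaussianReal 0 1).real B := by
  have hl' : (1 : ℝ) ≤ l := by exact_mod_cast hl
  have hlog := Real.log_nonneg hl'
  have e : ∀ ω, setRemainder l a ω B ^ 2 =
      l * (∫ x, centeredIndicator B (field l a ω x) ∂surf) ^ 2 := by
    intro ω
    rw [setRemainder_eq_integral l a ω hB, mul_pow, Real.sq_sqrt (by linarith)]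
  simp only [e]
  have hm := measurable_centeredIndicator hB
  have hψ := memLp_centeredIndicator hB
  refine ⟨(integral_sq_sphere_integral ha h hm hψ).2.2.const_mul _, ?_⟩
  rw [integral_const_mul]
  have h1 := integral_sq_sphere_integral_le hl ha h hm hψ (integral_centeredIndicator hB)
    (integral_hermiteR_two_mul_centeredIndicator hB)
  have h2 := integral_sq_centeredIndicator_le hB
  calc (l : ℝ) * ∫ ω, (∫ x, centeredIndicator B (field l a ω x) ∂surf) ^ 2 ∂P
      ≤ l * (64 * Real.pi ^ 2 * (1 + Real.log l) / (l : ℝ) ^ 2 * (gaussianReal 0 1).real B) := by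
        refine mul_le_mul_of_nonneg_left (h1.trans ?_) (by positivity)
        exact mul_le_mul_of_nonneg_left h2 (by positivity)
    _ = _ := by
        field_simp

end SetRemainder

/-! ### Dyadic chaining -/

/-- The binary expansion of `j` leads from 0 to `j` using at most one increment per scale, and each
is bounded by the `ℓ²` norm of all increments of its scale. The induction step rounds `j` down to an
even number and halves. -/
theorem abs_sub_le_sum_dyadic (K : ℕ) (s : ℕ → ℝ) (j : ℕ) (hj : j ≤ 2 ^ K) :
    |s j - s 0| ≤ ∑ m ∈ Finset.range (K + 1),
      √(∑ i ∈ Finset.range (2 ^ (K - m)), (s ((i + 1) * 2 ^ m) - s (i * 2 ^ m)) ^ 2) := by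
  induction K generalizing s j with
  | zero =>
    have : j = 0 ∨ j = 1 := by
      rw [pow_zero] at hj
      omega
    rcases this with rfl | rfl <;> simp [Real.sqrt_sq_eq_abs]
  | succ K ih =>
    have h1 := ih (fun i => s (2 * i)) (j / 2) (by rw [pow_succ] at hj; omega)
    rw [Finset.sum_range_succ']
    have e : ∀ m i : ℕ, 2 * (i * 2 ^ m) = i * 2 ^ (m + 1) := fun m i => by ring
    simp only [e, mul_zero] at h1
    simp only [Nat.succ_sub_succ]
    have h2 : |s j - s (2 * (j / 2))| ≤ √(∑ i ∈ Finset.range (2 ^ (K + 1 - 0)),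
        (s ((i + 1) * 2 ^ 0) - s (i * 2 ^ 0)) ^ 2) := by
      rcases Nat.even_or_odd' j with ⟨i, rfl | rfl⟩
      · simp [Real.sqrt_nonneg]
      · have : (2 * i + 1) / 2 = i := by omega
        rw [this, ← Real.sqrt_sq_eq_abs]
        refine Real.sqrt_le_sqrt ?_
        simp only [pow_zero, mul_one]
        exact Finset.single_le_sum (f := fun i => (s (i + 1) - s i) ^ 2)
          (fun _ _ => sq_nonneg _) (Finset.mem_range.mpr (by simpa using hj))
    rw [add_comm]
    exact (abs_sub_le (s j) (s (2 * (j / 2))) (s 0)).trans (add_le_add h2 h1)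

/-- The sum of the squared increments of `s` over the dyadic subintervals of `[0, 2 ^ K]`, times
the number of scales. -/
def dyadicEnergy (K : ℕ) (s : ℕ → ℝ) : ℝ :=
  (K + 1) * ∑ m ∈ Finset.range (K + 1),
    ∑ i ∈ Finset.range (2 ^ (K - m)), (s ((i + 1) * 2 ^ m) - s (i * 2 ^ m)) ^ 2

theorem dyadicEnergy_nonneg (K : ℕ) (s : ℕ → ℝ) : 0 ≤ dyadicEnergy K s :=
  mul_nonneg (by positivity)
    (Finset.sum_nonneg fun _ _ => Finset.sum_nonneg fun _ _ => sq_nonneg _)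

theorem abs_sub_le_sqrt_dyadicEnergy (K : ℕ) (s : ℕ → ℝ) (j : ℕ) (hj : j ≤ 2 ^ K) :
    |s j - s 0| ≤ √(dyadicEnergy K s) := by
  refine (abs_sub_le_sum_dyadic K s j hj).trans (Real.le_sqrt_of_sq_le ?_)
  refine (sq_sum_le_card_mul_sum_sq).trans_eq ?_
  rw [dyadicEnergy, Finset.card_range]
  push_cast
  congr 1
  refine Finset.sum_congr rfl fun m _ => ?_
  exact Real.sq_sqrt (Finset.sum_nonneg fun _ _ => sq_nonneg _)

section Chaining

variable {Ω : Type*} {l : ℕ} {a : ℤ → Ω → ℂ}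

/-- The occupied area is nonnegative and monotone in the set, so the remainder of `A` is compared
with that of `B` up to the centering terms, which are small when `B` has small mass. -/
theorem abs_setRemainder_le_of_subset (ω : Ω) {A B : Set ℝ} {δ : ℝ}
    (hA : MeasurableSet A) (hB : MeasurableSet B) (hAB : A ⊆ B)
    (hδ : (gaussianReal 0 1).real B ≤ δ) :
    |setRemainder l a ω A| ≤ |setRemainder l a ω B| +
      √l * (4 * Real.pi * δ + √(2 * δ) * |hermiteIntegral l a 2 ω|) := by
  have hγA : (gaussianReal 0 1).real A ≤ δ := (measureReal_mono hAB).trans hδ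
  have hγ0 : 0 ≤ (gaussianReal 0 1).real A := measureReal_nonneg
  have hmA : 0 ≤ surf.real {x | field l a ω x ∈ A} := measureReal_nonneg
  have hmAB : surf.real {x | field l a ω x ∈ A} ≤ surf.real {x | field l a ω x ∈ B} :=
    measureReal_mono fun x hx => hAB hx
  have hc : ∀ {S : Set ℝ}, MeasurableSet S → (gaussianReal 0 1).real S ≤ δ →
      |secondMoment S / 2 * hermiteIntegral l a 2 ω| ≤
        √(2 * δ) / 2 * |hermiteIntegral l a 2 ω| := by
    intro S hS hSδ
    rw [abs_mul, abs_div, abs_two]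
    refine mul_le_mul_of_nonneg_right ?_ (abs_nonneg _)
    refine div_le_div_of_nonneg_right ?_ two_pos.le
    exact Real.abs_le_sqrt ((sq_secondMoment_le hS).trans (by linarith))
  have hcA := abs_le.mp (hc hA hγA)
  have hcB := abs_le.mp (hc hB hδ)
  have hs : 0 ≤ √(l : ℝ) := Real.sqrt_nonneg _
  have hB' : setRemainder l a ω B ≤ |setRemainder l a ω B| := le_abs_self _
  have hπ : 4 * Real.pi * (gaussianReal 0 1).real B ≤ 4 * Real.pi * δ :=
    mul_le_mul_of_nonneg_left hδ (by positivity)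
  have hπA : 4 * Real.pi * (gaussianReal 0 1).real A ≤ 4 * Real.pi * δ :=
    mul_le_mul_of_nonneg_left hγA (by positivity)
  have hπ0 : 0 ≤ 4 * Real.pi * (gaussianReal 0 1).real A := by positivity
  have hr : 0 ≤ √(2 * δ) / 2 * |hermiteIntegral l a 2 ω| := by positivity
  rw [abs_le]
  constructor
  · have : 0 ≤ √(l : ℝ) * ((surf.real {x | field l a ω x ∈ A} -
        4 * Real.pi * (gaussianReal 0 1).real A - secondMoment A / 2 * hermiteIntegral l a 2 ω) +
        (4 * Real.pi * δ + √(2 * δ) * |hermiteIntegral l a 2 ω|)) :=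
      mul_nonneg hs (by linarith)
    rw [mul_add, ← setRemainder] at this
    linarith [abs_nonneg (setRemainder l a ω B)]
  · refine le_trans ?_ (add_le_add_left hB' _)
    rw [setRemainder, setRemainder, ← mul_add]
    exact mul_le_mul_of_nonneg_left (by linarith) hs

theorem abs_remainder_le (ω : Ω) (K : ℕ) (z : ℝ) :
    |remainder l a ω z| ≤
      3 * √(dyadicEnergy K fun i => setRemainder l a ω (cdfSublevel (i / 2 ^ K))) +
      √l * (4 * Real.pi * (1 / 2 ^ K) + √(2 * (1 / 2 ^ K)) * |hermiteIntegral l a 2 ω|) := by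
  set s : ℕ → ℝ := fun i => setRemainder l a ω (cdfSublevel (i / 2 ^ K)) with hs
  set F := cdf (gaussianReal 0 1) z with hF
  have h2 : (0 : ℝ) < 2 ^ K := by positivity
  -- The cell containing `z` in the quantile scale. As `F < 1` strictly, `i + 1` is still a grid
  -- index.
  obtain ⟨i, hi⟩ : ∃ i : ℕ, i = ⌊2 ^ K * F⌋₊ := ⟨_, rfl⟩
  have hle : (i : ℝ) ≤ 2 ^ K * F := by
    rw [hi]
    exact Nat.floor_le (mul_nonneg h2.le (cdf_nonneg _ _))
  have hlt : 2 ^ K * F < i + 1 := by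
    rw [hi]
    exact Nat.lt_floor_add_one _
  have hiK : i + 1 ≤ 2 ^ K := by
    have : (i : ℝ) < ((2 ^ K : ℕ) : ℝ) := by
      push_cast
      nlinarith [cdf_gaussianReal_lt_one z]
    exact_mod_cast this
  have hs0 : s 0 = 0 := by
    have : cdfSublevel (((0 : ℕ) : ℝ) / 2 ^ K) = ∅ := by simp [cdfSublevel_zero]
    simp only [hs]
    rw [this, setRemainder]
    simp [secondMoment]
  have hM : ∀ j ≤ 2 ^ K, |s j| ≤ √(dyadicEnergy K s) := by
    intro j hj
    have := abs_sub_le_sqrt_dyadicEnergy K s j hj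
    rwa [hs0, sub_zero] at this
  have hA := measurableSet_cdfSublevel ((i : ℝ) / 2 ^ K)
  have hB := measurableSet_cdfSublevel (((i + 1 : ℕ) : ℝ) / 2 ^ K)
  have hAz : cdfSublevel ((i : ℝ) / 2 ^ K) ⊆ Set.Iic z := by
    intro x hx
    refine strictMono_cdf_gaussianReal.le_iff_le.mp (le_trans hx ?_)
    rw [div_le_iff₀ h2]
    linarith
  have hzB : Set.Iic z ⊆ cdfSublevel (((i + 1 : ℕ) : ℝ) / 2 ^ K) := by
    intro x hx
    refine (monotone_cdf _ hx).trans ?_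
    rw [le_div_iff₀ h2]
    push_cast
    linarith
  have hiK' : (((i + 1 : ℕ) : ℝ)) ≤ 2 ^ K := by exact_mod_cast hiK
  have hγ : (gaussianReal 0 1).real (cdfSublevel (((i + 1 : ℕ) : ℝ) / 2 ^ K) \
      cdfSublevel ((i : ℝ) / 2 ^ K)) ≤ 1 / 2 ^ K := by
    rw [gaussianReal_real_cdfSublevel_diff (by positivity) _ ((div_le_one h2).mpr hiK')]
    · rw [← sub_div]
      simp
    · refine div_le_div_of_nonneg_right ?_ h2.le
      simp
  -- Comparison within the cell. The constant 3 counts `|s i|` for the left endpoint and `|s (i +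
  -- 1)| + |s i|` for the cell increment.
  have hk := abs_setRemainder_le_of_subset (l := l) (a := a) ω (measurableSet_Iic.diff hA)
    (hB.diff hA) (Set.sdiff_subset_sdiff_left hzB) hγ
  rw [setRemainder_sdiff l a ω hA hAz, setRemainder_sdiff l a ω hA (hAz.trans hzB),
    ← remainder_eq_setRemainder] at hk
  have e1 : setRemainder l a ω (cdfSublevel ((i : ℝ) / 2 ^ K)) = s i := rfl
  have e2 : setRemainder l a ω (cdfSublevel (((i + 1 : ℕ) : ℝ) / 2 ^ K)) = s (i + 1) := rfl
  rw [e1, e2] at hk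
  have h3 := abs_sub_abs_le_abs_sub (remainder l a ω z) (s i)
  have h4 := abs_sub (s (i + 1)) (s i)
  have h5 := hM i (by omega)
  have h6 := hM (i + 1) hiK
  linarith

/-- The event is contained in one where an integrable variable is at least `ε²`. Markov's inequality
applies to that variable, so measurability of the supremum is not needed. -/
theorem sq_le_of_lt_supRemainder (ω : Ω) (K : ℕ) {ε : ℝ} (hε : 0 < ε)
    (hK : √l * (4 * Real.pi * (1 / 2 ^ K)) ≤ ε / 3)
    (h : ENNReal.ofReal ε < supRemainder l a ω) :
    ε ^ 2 ≤ 81 * dyadicEnergy K (fun i => setRemainder l a ω (cdfSublevel (i / 2 ^ K))) +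
      18 * l / 2 ^ K * hermiteIntegral l a 2 ω ^ 2 := by
  obtain ⟨z, hz⟩ := lt_iSup_iff.mp h
  have hz' : ε < |remainder l a ω z| := (ENNReal.ofReal_lt_ofReal_iff_of_nonneg hε.le).mp hz
  have hb := abs_remainder_le (l := l) (a := a) ω K z
  have hE := dyadicEnergy_nonneg K (fun i => setRemainder l a ω (cdfSublevel (i / 2 ^ K)))
  generalize dyadicEnergy K (fun i => setRemainder l a ω (cdfSublevel (i / 2 ^ K))) = E at *
  have hsq1 := Real.sq_sqrt hE
  have hsq2 : (√l * (√(2 * (1 / 2 ^ K)) * |hermiteIntegral l a 2 ω|)) ^ 2 =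
      2 * l / 2 ^ K * hermiteIntegral l a 2 ω ^ 2 := by
    rw [mul_pow, mul_pow, sq_abs, Real.sq_sqrt (by positivity), Real.sq_sqrt (by positivity)]
    ring
  have hn : 0 ≤ √l * (√(2 * (1 / 2 ^ K)) * |hermiteIntegral l a 2 ω|) := by positivity
  rw [mul_add] at hb
  generalize √l * (√(2 * (1 / 2 ^ K)) * |hermiteIntegral l a 2 ω|) = w at *
  have e : 18 * (l : ℝ) / 2 ^ K * hermiteIntegral l a 2 ω ^ 2 = 9 * w ^ 2 := by
    rw [hsq2]
    ring
  rw [e]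
  have hr := Real.sqrt_nonneg E
  generalize √E = r at *
  -- From `ε < 3 r + ε/3 + w`, either `3 r ≥ ε/3` or `w ≥ ε/3`; squaring gives the factors 81 and 9.
  by_cases hc : ε / 9 ≤ r
  · nlinarith [sq_nonneg w]
  · have : ε / 3 ≤ w := by linarith [not_le.mp hc]
    nlinarith [sq_nonneg w]

variable [MeasurableSpace Ω] {P : Measure Ω} [IsProbabilityMeasure P]

/-- Scale `m` has `2^(K-m)` cells of mass `2^m / 2^K`, so it contributes at most `V`. One factor `K
+ 1` counts the scales and the other is the prefactor in `dyadicEnergy`. -/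
theorem integral_dyadicEnergy_le (hl : 1 ≤ l) (ha : ∀ m, Measurable (a m))
    (h : IsGaussianCoeff P l a) (K : ℕ) :
    Integrable (fun ω => dyadicEnergy K
      fun i => setRemainder l a ω (cdfSublevel (i / 2 ^ K))) P ∧
    ∫ ω, dyadicEnergy K (fun i => setRemainder l a ω (cdfSublevel (i / 2 ^ K))) ∂P ≤
      (K + 1) ^ 2 * (64 * Real.pi ^ 2 * (1 + Real.log l) / l) := by
  set V := 64 * Real.pi ^ 2 * (1 + Real.log l) / l with hV
  have hstep : ∀ m ∈ Finset.range (K + 1), ∀ i ∈ Finset.range (2 ^ (K - m)),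
      Integrable (fun ω => (setRemainder l a ω (cdfSublevel (((i + 1) * 2 ^ m : ℕ) / 2 ^ K)) -
        setRemainder l a ω (cdfSublevel ((i * 2 ^ m : ℕ) / 2 ^ K))) ^ 2) P ∧
      ∫ ω, (setRemainder l a ω (cdfSublevel (((i + 1) * 2 ^ m : ℕ) / 2 ^ K)) -
        setRemainder l a ω (cdfSublevel ((i * 2 ^ m : ℕ) / 2 ^ K))) ^ 2 ∂P ≤
        V * (2 ^ m / 2 ^ K) := by
    intro m hm i hi
    have hm' : m ≤ K := by
      rw [Finset.mem_range] at hm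
      omega
    have hpow : 2 ^ (K - m) * 2 ^ m = 2 ^ K := by rw [← pow_add, Nat.sub_add_cancel hm']
    have hle : (((i + 1) * 2 ^ m : ℕ) : ℝ) ≤ 2 ^ K := by
      have : (i + 1) * 2 ^ m ≤ 2 ^ (K - m) * 2 ^ m :=
        Nat.mul_le_mul_right _ (Finset.mem_range.mp hi)
      rw [hpow] at this
      exact_mod_cast this
    have h2 : (0 : ℝ) < 2 ^ K := by positivity
    have hpq : ((i * 2 ^ m : ℕ) : ℝ) / 2 ^ K ≤ (((i + 1) * 2 ^ m : ℕ) : ℝ) / 2 ^ K := by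
      refine div_le_div_of_nonneg_right ?_ h2.le
      exact_mod_cast Nat.mul_le_mul_right _ (Nat.le_succ i)
    have hA := measurableSet_cdfSublevel (((i * 2 ^ m : ℕ) : ℝ) / 2 ^ K)
    have hB := measurableSet_cdfSublevel ((((i + 1) * 2 ^ m : ℕ) : ℝ) / 2 ^ K)
    have hγ := gaussianReal_real_cdfSublevel_diff (by positivity) hpq ((div_le_one h2).mpr hle)
    have := integral_sq_setRemainder_le hl ha h (hB.diff hA)
    rw [hγ] at this
    simp only [fun ω => setRemainder_sdiff l a ω hA (cdfSublevel_mono hpq)] at this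
    refine ⟨this.1, this.2.trans_eq ?_⟩
    rw [← hV]
    push_cast
    ring
  have hint : ∀ m ∈ Finset.range (K + 1), Integrable (fun ω => ∑ i ∈ Finset.range (2 ^ (K - m)),
      (setRemainder l a ω (cdfSublevel (((i + 1) * 2 ^ m : ℕ) / 2 ^ K)) -
        setRemainder l a ω (cdfSublevel ((i * 2 ^ m : ℕ) / 2 ^ K))) ^ 2) P :=
    fun m hm => integrable_finsetSum _ fun i hi => (hstep m hm i hi).1
  simp only [dyadicEnergy]
  refine ⟨(integrable_finsetSum _ hint).const_mul _, ?_⟩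
  rw [integral_const_mul, integral_finsetSum _ hint]
  have hb : ∀ m ∈ Finset.range (K + 1), ∫ ω, ∑ i ∈ Finset.range (2 ^ (K - m)),
      (setRemainder l a ω (cdfSublevel (((i + 1) * 2 ^ m : ℕ) / 2 ^ K)) -
        setRemainder l a ω (cdfSublevel ((i * 2 ^ m : ℕ) / 2 ^ K))) ^ 2 ∂P ≤ V := by
    intro m hm
    rw [integral_finsetSum _ fun i hi => (hstep m hm i hi).1]
    refine (Finset.sum_le_sum fun i hi => (hstep m hm i hi).2).trans_eq ?_
    have hm' : m ≤ K := by
      rw [Finset.mem_range] at hm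
      omega
    rw [Finset.sum_const, Finset.card_range, nsmul_eq_mul]
    push_cast
    rw [← Nat.sub_add_cancel hm', pow_add, Nat.add_sub_cancel]
    field_simp
  calc (K + 1 : ℝ) * _ ≤ (K + 1) * ∑ m ∈ Finset.range (K + 1), V :=
        mul_le_mul_of_nonneg_left (Finset.sum_le_sum hb) (by positivity)
    _ = _ := by
        rw [Finset.sum_const, Finset.card_range, nsmul_eq_mul]
        push_cast
        ring

theorem measureReal_lt_supRemainder_le (hl : 1 ≤ l) (ha : ∀ m, Measurable (a m))
    (h : IsGaussianCoeff P l a) (K : ℕ) {ε : ℝ} (hε : 0 < ε)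
    (hK : √l * (4 * Real.pi * (1 / 2 ^ K)) ≤ ε / 3) :
    P.real {ω | ENNReal.ofReal ε < supRemainder l a ω} ≤
      (81 * ((K + 1) ^ 2 * (64 * Real.pi ^ 2 * (1 + Real.log l) / l)) +
        18 * l / 2 ^ K * (16 * Real.pi ^ 2 / l)) / ε ^ 2 := by
  obtain ⟨hi1, hb1⟩ := integral_dyadicEnergy_le hl ha h K
  obtain ⟨hi2, hb2⟩ := integral_sq_hermiteIntegral_two_le hl ha h
  have hm := mul_meas_ge_le_integral_of_nonneg (μ := P) (f := fun ω =>
    81 * dyadicEnergy K (fun i => setRemainder l a ω (cdfSublevel (i / 2 ^ K))) +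
      18 * l / 2 ^ K * hermiteIntegral l a 2 ω ^ 2)
    (Filter.Eventually.of_forall fun ω => add_nonneg
      (mul_nonneg (by norm_num) (dyadicEnergy_nonneg _ _)) (by positivity))
    ((hi1.const_mul _).add (hi2.const_mul _)) (ε ^ 2)
  rw [integral_add (hi1.const_mul _) (hi2.const_mul _), integral_const_mul,
    integral_const_mul] at hm
  rw [le_div_iff₀ (by positivity), mul_comm]
  refine le_trans (mul_le_mul_of_nonneg_left (measureReal_mono fun ω hω => ?_) (by positivity))
    (hm.trans (add_le_add (mul_le_mul_of_nonneg_left hb1 (by norm_num))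
      (mul_le_mul_of_nonneg_left hb2 (by positivity))))
  exact sq_le_of_lt_supRemainder ω K hε hK hω

theorem measureReal_lt_supRemainder_le_log (hl : 1 ≤ l) (h : IsGaussianCoeff P l a) {ε : ℝ}
    (hε : 0 < ε) (hεl : 1 ≤ ε * (l * √l)) :
    P.real {ω | ENNReal.ofReal ε < supRemainder l a ω} ≤
      450000 * Real.pi ^ 2 * (1 + Real.log l) ^ 3 / (l * ε ^ 2) := by
  obtain ⟨a', ha', h', hae⟩ := h.exists_measurable
  have hcongr : P.real {ω | ENNReal.ofReal ε < supRemainder l a ω} =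
      P.real {ω | ENNReal.ofReal ε < supRemainder l a' ω} := by
    refine measureReal_congr ?_
    filter_upwards [hae] with ω hω
    refine propext ?_
    change ENNReal.ofReal ε < supRemainder l a ω ↔ ENNReal.ofReal ε < supRemainder l a' ω
    rw [supRemainder_congr hω]
  rw [hcongr]
  have hl' : (1 : ℝ) ≤ l := by exact_mod_cast hl
  have hlog := Real.log_nonneg hl'
  -- The choice `K = 6 + 2c` gives `2^K ≥ 64 l²`, while `K + 1 ≤ 9 (1 + log l)`.
  set c := Nat.clog 2 l with hc
  have hc1 : (l : ℝ) ≤ 2 ^ c := by exact_mod_cast Nat.le_pow_clog one_lt_two l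
  have hc2 : (c : ℝ) ≤ 1 + 2 * Real.log l := by
    rcases Nat.eq_zero_or_pos c with h0 | h0
    · rw [h0]
      push_cast
      linarith
    · have hl2 : 1 < l := by
        by_contra hle
        rw [hc, Nat.clog_of_right_le_one (not_lt.mp hle)] at h0
        exact lt_irrefl _ h0
      have : 2 ^ (c - 1) < l := Nat.pow_pred_clog_lt_self one_lt_two hl2
      have h1 : ((2 : ℝ) ^ (c - 1)) ≤ l := by exact_mod_cast this.le
      have h2 := Real.log_le_log (by positivity) h1
      rw [Real.log_pow, Nat.cast_sub h0] at h2
      push_cast at h2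
      have h3 := Real.log_two_gt_d9
      have h4 : (1 : ℝ) ≤ c := by exact_mod_cast h0
      nlinarith
  have hpow : (2 : ℝ) ^ (6 + 2 * c) = 64 * (2 ^ c) ^ 2 := by
    rw [pow_add, pow_mul']
    norm_num
  have hpow' : 64 * (l : ℝ) ^ 2 ≤ 2 ^ (6 + 2 * c) := by
    rw [hpow]
    gcongr
  have hsl : 0 ≤ √(l : ℝ) := Real.sqrt_nonneg _
  have hsl2 := Real.sq_sqrt (show (0 : ℝ) ≤ l by linarith)
  refine (measureReal_lt_supRemainder_le hl ha' h' (6 + 2 * c) hε ?_).trans ?_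
  -- The deterministic error is at most `4π√l / (64 l²)`. It is below `ε/3` because `ε l^{3/2} ≥ 1`
  -- and `12π < 48`.
  · have h64 : 12 * Real.pi * √l ≤ 64 * (l : ℝ) ^ 2 * ε := by
      have : (l : ℝ) ^ 2 * ε = √l * (ε * (l * √l)) := by
        rw [pow_two]
        nth_rewrite 2 [← hsl2]
        ring
      nlinarith [Real.pi_lt_four, mul_le_mul_of_nonneg_left hεl hsl]
    rw [show √(l : ℝ) * (4 * Real.pi * (1 / 2 ^ (6 + 2 * c))) =
      4 * Real.pi * √l / 2 ^ (6 + 2 * c) by ring, div_le_iff₀ (by positivity)]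
    nlinarith [mul_le_mul_of_nonneg_right hpow' hε.le]
  · rw [← div_div]
    refine div_le_div_of_nonneg_right ?_ (by positivity)
    have hK : ((6 + 2 * c : ℕ) : ℝ) + 1 ≤ 9 * (1 + Real.log l) := by
      push_cast
      linarith
    have h1 : (((6 + 2 * c : ℕ) : ℝ) + 1) ^ 2 ≤ (9 * (1 + Real.log l)) ^ 2 :=
      pow_le_pow_left₀ (by positivity) hK 2
    have h2 : 18 * (l : ℝ) / 2 ^ (6 + 2 * c) ≤ 1 := by
      rw [div_le_one (by positivity)]
      nlinarith
    have h3 : 18 * (l : ℝ) / 2 ^ (6 + 2 * c) * (16 * Real.pi ^ 2 / l) ≤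
        16 * Real.pi ^ 2 * (1 + Real.log l) ^ 3 / l := by
      calc _ ≤ 1 * (16 * Real.pi ^ 2 / l) := mul_le_mul_of_nonneg_right h2 (by positivity)
        _ = 16 * Real.pi ^ 2 * 1 / l := by ring
        _ ≤ _ := by
          gcongr
          exact one_le_pow₀ (by linarith)
    -- Here `419904 = 81 · 81 · 64`; with the 16 from `h3` it stays below 450000.
    have h4 : 81 * ((((6 + 2 * c : ℕ) : ℝ) + 1) ^ 2 *
        (64 * Real.pi ^ 2 * (1 + Real.log l) / l)) ≤
        419904 * Real.pi ^ 2 * (1 + Real.log l) ^ 3 / l := by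
      calc _ ≤ 81 * ((9 * (1 + Real.log l)) ^ 2 * (64 * Real.pi ^ 2 * (1 + Real.log l) / l)) := by
            gcongr
        _ = _ := by ring
    refine (add_le_add h4 h3).trans ?_
    rw [← add_div]
    gcongr
    have : 0 ≤ Real.pi ^ 2 * (1 + Real.log l) ^ 3 := by positivity
    linarith

end Chaining

end SphericalEmpirical

end

/-! ### Deduction of the two stated bounds -/

theorem mainTheorem3 :
    ∃ C : ℝ, 0 < C ∧
      ∀ (Ω : Type*) [MeasurableSpace Ω] (P : MeasureTheory.Measure Ω)
        [MeasureTheory.IsProbabilityMeasure P] (l : ℕ) (a : ℤ → Ω → ℂ),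
        1 ≤ l → SphericalEmpirical.IsGaussianCoeff P l a →
        (2 ≤ l → ∀ ε : ℝ, 0 < ε → ε ≤ 1 →
          P.real {ω | ENNReal.ofReal ε < SphericalEmpirical.supRemainder l a ω} ≤
            C / l * (Real.log l ^ 6 / ε ^ 3)) ∧
        (∀ ε : ℝ, 1 ≤ ε →
          P.real {ω | ENNReal.ofReal ε < SphericalEmpirical.supRemainder l a ω} ≤
            C / l * (ε ^ (-(4 / 3) : ℝ) + Real.log l ^ 6 / ε ^ (7 / 3 : ℝ))) := by
  refine ⟨100000000 * Real.pi ^ 2, by positivity, ?_⟩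
  intro Ω _ P _ l a hl h
  have hl' : (1 : ℝ) ≤ l := by exact_mod_cast hl
  have hlog := Real.log_nonneg hl'
  have hsl : 1 ≤ √(l : ℝ) := Real.one_le_sqrt.mpr hl'
  have hπ : 1 ≤ Real.pi ^ 2 := by nlinarith [Real.pi_gt_three]
  refine ⟨fun hl2 ε hε hε1 => ?_, fun ε hε => ?_⟩
  · have hL : 1 ≤ 2 * Real.log l := by
      have h1 : Real.log 2 ≤ Real.log l := Real.log_le_log two_pos (by exact_mod_cast hl2)
      linarith [Real.log_two_gt_d9]
    by_cases hεl : 1 ≤ ε * (l * √l)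
    · refine (SphericalEmpirical.measureReal_lt_supRemainder_le_log hl h hε hεl).trans ?_
      generalize Real.log l = L at *
      -- Since `l ≥ 2`, `2L ≥ 1`, which absorbs the additive 1 and three missing powers of `L`. The
      -- final constant dominates `450000 · 216`.
      have h3 : (1 + L) ^ 3 ≤ 216 * L ^ 6 := by
        calc (1 + L) ^ 3 ≤ (3 * L) ^ 3 := by gcongr; linarith
          _ = 27 * L ^ 3 * 1 := by ring
          _ ≤ 27 * L ^ 3 * (2 * L) ^ 3 := by
            gcongr
            exact one_le_pow₀ hL
          _ = 216 * L ^ 6 := by ring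
      have h4 : ε ^ 3 ≤ ε ^ 2 := pow_le_pow_of_le_one hε.le hε1 (by norm_num)
      rw [div_mul_div_comm]
      gcongr ?_ / (_ * ?_)
      calc 450000 * Real.pi ^ 2 * (1 + L) ^ 3 ≤ 450000 * Real.pi ^ 2 * (216 * L ^ 6) := by gcongr
        _ ≤ 100000000 * Real.pi ^ 2 * L ^ 6 := by
          have : 0 ≤ Real.pi ^ 2 * L ^ 6 := by positivity
          linarith
    -- For `ε l^{3/2} < 1` the right side exceeds 1, since `l ε³ ≤ 1` and `64 L⁶ ≥ 1`.
    · refine measureReal_le_one.trans ?_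
      generalize Real.log l = L at *
      rw [div_mul_div_comm, one_le_div (by positivity)]
      have h1 : ε * l ≤ 1 := by
        refine le_trans ?_ (not_le.mp hεl).le
        gcongr
        exact le_mul_of_one_le_right (by linarith) hsl
      have h2 : l * ε ^ 3 ≤ 1 := by
        calc l * ε ^ 3 = ε * l * ε ^ 2 := by ring
          _ ≤ 1 * 1 := by
            gcongr
            exact pow_le_one₀ hε.le hε1
          _ = 1 := one_mul 1
      have h3 : 1 ≤ 64 * L ^ 6 := by
        have := one_le_pow₀ hL (n := 6)
        calc (1 : ℝ) ≤ (2 * L) ^ 6 := this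
          _ = 64 * L ^ 6 := by ring
      have h4 : 64 * L ^ 6 ≤ 100000000 * Real.pi ^ 2 * L ^ 6 := by
        gcongr
        linarith
      linarith
  · have hε0 : 0 < ε := by linarith
    have hεl : 1 ≤ ε * (l * √l) :=
      one_le_mul_of_one_le_of_one_le hε (one_le_mul_of_one_le_of_one_le hl' hsl)
    refine (SphericalEmpirical.measureReal_lt_supRemainder_le_log hl h hε0 hεl).trans ?_
    -- With `ε = t³` the fractional powers become integral ones.
    obtain ⟨t, ht, rfl⟩ : ∃ t : ℝ, 1 ≤ t ∧ t ^ 3 = ε := by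
      refine ⟨ε ^ (1 / 3 : ℝ), Real.one_le_rpow hε (by norm_num), ?_⟩
      rw [← Real.rpow_natCast, ← Real.rpow_mul hε0.le]
      norm_num
    have ht0 : 0 < t := by linarith
    have e1 : (t ^ 3) ^ (-(4 / 3) : ℝ) = (t ^ 4)⁻¹ := by
      rw [← Real.rpow_natCast t 3, ← Real.rpow_mul ht0.le, ← Real.rpow_natCast t 4,
        ← Real.rpow_neg ht0.le]
      norm_num
    have e2 : (t ^ 3) ^ (7 / 3 : ℝ) = t ^ 7 := by
      rw [← Real.rpow_natCast t 3, ← Real.rpow_mul ht0.le, ← Real.rpow_natCast t 7]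
      norm_num
    rw [e1, e2]
    generalize Real.log l = L at *
    have h1 : (1 + L) ^ 3 ≤ 4 * (1 + L ^ 3) := by
      nlinarith [mul_nonneg hlog (sq_nonneg (L - 1)), sq_nonneg (L - 1)]
    -- The product `t L³` is split by `2 t L³ ≤ t² + L⁶`. The power `t³` yields the term `ε^(-4/3)`,
    -- which also covers `l = 1`, where `L = 0`.
    have h2 : t * (1 + L ^ 3) ≤ 2 * (t ^ 3 + L ^ 6) := by
      have h3 : t ^ 2 ≤ t ^ 3 := pow_le_pow_right₀ ht (by norm_num)
      have h4 : t ≤ t ^ 2 := by nlinarith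
      nlinarith [sq_nonneg (t - L ^ 3), sq_nonneg (L ^ 3)]
    have e3 : (t ^ 4)⁻¹ + L ^ 6 / t ^ 7 = (t ^ 3 + L ^ 6) / t ^ 7 := by
      field_simp
    have e4 : 450000 * Real.pi ^ 2 * (1 + L) ^ 3 / (l * (t ^ 3) ^ 2) =
        450000 * Real.pi ^ 2 * (t * (1 + L) ^ 3) / (l * t ^ 7) := by
      field_simp
    rw [e3, e4, div_mul_div_comm]
    gcongr ?_ / _
    have h5 : t * (1 + L) ^ 3 ≤ 8 * (t ^ 3 + L ^ 6) := by
      nlinarith [mul_le_mul_of_nonneg_left h1 ht0.le]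
    calc 450000 * Real.pi ^ 2 * (t * (1 + L) ^ 3) ≤
          450000 * Real.pi ^ 2 * (8 * (t ^ 3 + L ^ 6)) := by gcongr
      _ ≤ 100000000 * Real.pi ^ 2 * (t ^ 3 + L ^ 6) := by
        have : 0 ≤ Real.pi ^ 2 * (t ^ 3 + L ^ 6) := by positivity
        linarith
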